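/- **Setting.** A Banach scale on an index set $S\subset\mathbb Z$ is a family of real Banach spaces $(X_s)_{s\in S}$ with injective, for $s>r$ compact, continuous linear bonding maps $X_s\hookrightarrow X_r$ whose limit $X_\infty$ is dense in every $X_s$; its dual scale is $(X^*)_s=(X_{-s})^*$, its shift is $(X^k)_m=X_{m+k}$. sc-smoothness ($\mathrm{sc}^\infty$), sc-smooth manifolds $M$ with their filtration $M_m$ and shifts $M^m$, and tangent bundles $TM=\bigcup_{p\in M_1}\{p\}\times (T_pM)_0$ are in the sense of Hofer–Wysocki–Zehnder (local models on $\mathbb N_0$). A symplectic structure on a Banach scale on $\mathbb Z$ consists of continuous bilinear forms $\omega_s:X_s\times X_{-s}\to\mathbb R$ with $\omega_s(v,w)=-\omega_{-s}(w,v)$ such that $w\mapsto\omega_{-s}(\cdot,w)$ is an isomorphism of scales $X\to X^*$. A symplectic $\mathrm{sc}^\infty$-manifold is a Hausdorff space with a (maximal) atlas of charts onto open subsets of $X_0$ whose transition maps are sc-smooth diffeomorphisms with derivatives $X_0\to X_0$ preserving $\omega_0$. A function $h:M^1\to\mathbb R$ is strongly sc-smooth if in charts it is an $\mathrm{sc}^0$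 map $h:U^1\to\mathbb R$ with a Fréchet derivative on $U_1\subset X_1$ given by an sc-smooth map $Dh:U^1\to X^*$ (so $D_xh\in X_{-m}^*$ for $x\in U_{m+1}$). An sc-smooth vector field $V:M^1\to TM$ is generated by $h$ if $-D_ph=\omega_p(\cdot,V(p))$ for $p\in M_1$; an sc-smooth $\varphi:\mathbb R\times M\to M$ is the global flow of $V$ if $\varphi(0,p)=p$ and $\partial_t\varphi(t,p)=V(\varphi(t,p))$ for $t\in\mathbb R$, $p\in M_1$; it is then Hamiltonian if $V$ is generated by some strongly sc-smooth $h$. **Statement.** (1) Let $E$ be a complex Hilbert space with orthonormal basis indexed by $\mathbb Z$; write $x_n$ for the coefficients of $x\in E$. Let $\nu_n>0$, $\nu_n\to\infty$ as $|n|\to\infty$, and $X_s=\{x\in\mathbb C^{\mathbb Z}:\|x\|_s^2=\sum_n|x_n|^2\nu_n^{2s}<\infty\}$, $s\in\mathbb Z$. Then $X$ is a Banach scale over $\mathbb R$, symplectic with $\omega=\mathrm{Re}\langle i\,\cdot,\cdot\rangle_0=-\mathrm{Im}\langle\cdot,\cdot\rangle_0$, $\langle x,y\rangle_0=\sum_n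 x_n\overline{y_n}$. The projective space $\mathbb P(E)$ with the quotient topology is Hausdorff, and the maps $$\psi_a:U_a=\{[x]:x_a\neq0\}\to B=\{y\in X_0:\|y\|_0<1\},\qquad \psi_a([x])_n=\frac{|x_a|}{x_a\|x\|}\cdot\begin{cases}x_n&n<a\\x_{n+1}&n\ge a\end{cases}\qquad(a\in\mathbb Z)$$ are well defined homeomorphisms onto the open unit ball $B$ and form a symplectic $\mathrm{sc}^\infty$-atlas modeled on $(X,\omega)$, which makes $\mathbb P(E)$ a symplectic $\mathrm{sc}^\infty$-manifold. (2) Let $M=\mathbb P(L^2(S^1,\mathbb C))$, $S^1=\mathbb R/2\pi\mathbb Z$, with the structure of (1) for the Fourier basis and $\nu_n=1+n^2$, so that $X_s$ is $W^{2s,2}(S^1,\mathbb C)$ on the Fourier side. Then $M_m=\{[u]:u\in W^{2m,2}(S^1,\mathbb C)\setminus\{0\}\}$ for $m\ge 0$. The Schrödinger flow $e^{it\Delta}$ on $L^2$ (Fourier multiplier $e^{-itn^2}$) descends to $\bar\varphi:\mathbb R\times M\to M$, $\bar\varphi(t,[u])=[e^{it\Delta}u]$, and $\bar\varphi$ is sc-smooth.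 For $a\in\mathbb Z$ the Fourier multiplier $\sigma_a:X^1\to X$ with coefficients $a^2-n^2$ for $n<a$ and $a^2-(n+1)^2$ for $n\ge a$ is a linear $\mathrm{sc}^0$ map. The map $\bar\varphi$ is the global flow of an sc-smooth vector field $\bar V:M^1\to TM$, which in the chart $\psi_a$ is $B^1\to X$, $u\mapsto i\,\sigma_a(u)$. The function $$\bar h:M^1\to\mathbb R,\qquad \bar h([u])=\frac12\,\frac{\|u_x\|^2}{\|u\|^2}$$ ($u_x\in L^2$ the weak derivative, norms in $L^2$) is well defined and strongly sc-smooth; for each $a\in\mathbb Z$ its local representative $\bar h_a=\bar h\circ\psi_a^{-1}:B^1\to\mathbb R$ is strongly sc-smooth with derivative $D\bar h_a:B^1\to X^*$, $x\mapsto-\mathrm{Re}\langle\sigma_a(x),\cdot\rangle_0$. Finally, $\bar h$ generates $\bar V$; in particular $\bar\varphi$ is a Hamiltonian flow. -/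

import Mathlib

open Filter Topology Set
open scoped LinearAlgebra.Projectivization

noncomputable section

/-! ## Scales of Banach spaces -/

/-- A projective system of real Banach spaces `X_s` indexed by `I`, with bonding maps
`X_s → X_r` for `r ≤ s`. -/
structure ScaleSystem (I : Type) [Preorder I] where
  level : I → Type
  [grp : ∀ s, NormedAddCommGroup (level s)]
  [mod : ∀ s, NormedSpace ℝ (level s)]
  [cpl : ∀ s, CompleteSpace (level s)]
  bond : ∀ {r s : I}, r ≤ s → (level s →L[ℝ] level r)
  bond_self : ∀ s, bond (le_refl s) = ContinuousLinearMap.id ℝ (level s)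
  bond_comp : ∀ {q r s : I} (h : q ≤ r) (h' : r ≤ s),
    (bond h).comp (bond h') = bond (h.trans h')

attribute [instance] ScaleSystem.grp ScaleSystem.mod ScaleSystem.cpl

namespace ScaleSystem

/-- The explicit limit `X_∞` of the projective system. -/
def limit {I : Type} [Preorder I] (X : ScaleSystem I) : Set (∀ s, X.level s) :=
  {x | ∀ (r s : I) (h : r ≤ s), X.bond h (x s) = x r}

/-- A Banach scale: the bonding maps are injective, the limit is dense in every level, and the
bonding maps between distinct levels are compact. -/
structure IsBanachScale {I : Type} [Preorder I] (X : ScaleSystem I) : Prop where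
  injective : ∀ (r s : I) (h : r ≤ s), Function.Injective (X.bond h)
  dense : ∀ s, Dense ((fun x : ∀ t, X.level t => x s) '' X.limit)
  compact : ∀ (r s : I) (h : r < s), IsCompactOperator (X.bond h.le)

/-- The shifted scale `X^k`, with levels `X_{m+k}`. -/
@[reducible] def shift (X : ScaleSystem ℕ) (k : ℕ) : ScaleSystem ℕ where
  level m := X.level (m + k)
  bond h := X.bond (Nat.add_le_add_right h k)
  bond_self s := X.bond_self (s + k)
  bond_comp _ _ := X.bond_comp _ _

/-- The product scale. -/
@[reducible] def prod (X Y : ScaleSystem ℕ) : ScaleSystem ℕ where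
  level m := X.level m × Y.level m
  bond h := (X.bond h).prodMap (Y.bond h)
  bond_self s := by
    rw [X.bond_self, Y.bond_self]; rfl
  bond_comp h h' := by
    rw [← X.bond_comp h h', ← Y.bond_comp h h']; rfl

/-- The model `TX = X^1 × X` of the tangent bundle. -/
@[reducible] def tangent (X : ScaleSystem ℕ) : ScaleSystem ℕ := (X.shift 1).prod X

/-- The restriction `X_{≥ 0}` to nonnegative indices. -/
@[reducible] def nonneg (X : ScaleSystem ℤ) : ScaleSystem ℕ where
  level m := X.level (m : ℤ)
  bond h := X.bond (Int.ofNat_le.mpr h)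
  bond_self s := X.bond_self (s : ℤ)
  bond_comp _ _ := X.bond_comp _ _

/-- The dual scale `X^*`, with levels `(X^*)_s = (X_{-s})^*` (operator norm) and bonding maps the
adjoints of those of `X`. -/
@[reducible] def dual (X : ScaleSystem ℤ) : ScaleSystem ℤ where
  level s := X.level (-s) →L[ℝ] ℝ
  bond h := ContinuousLinearMap.precomp ℝ (X.bond (neg_le_neg h))
  bond_self s := by
    ext L x
    simp [X.bond_self]
  bond_comp h h' := by
    ext L x
    have e := congrArg (fun T => T x) (X.bond_comp (neg_le_neg h') (neg_le_neg h))
    simp only [ContinuousLinearMap.comp_apply] at e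
    simp [e]

/-- The real line as a constant scale. -/
@[reducible] def realLine : ScaleSystem ℕ where
  level _ := ℝ
  bond _ := ContinuousLinearMap.id ℝ ℝ
  bond_self _ := rfl
  bond_comp _ _ := rfl

/-- A symplectic structure on a Banach scale over `ℤ`: continuous bilinear forms
`ω_s : X_s × X_{-s} → ℝ` (written for pairs of levels `s + t = 0`), skew-symmetric, such that
`w ↦ ω_{-s}(·, w)` is an isomorphism of scales `X → X^*`. -/
structure IsSymplectic (X : ScaleSystem ℤ)
    (ω : ∀ s t : ℤ, s + t = 0 → X.level s → X.level t → ℝ) : Prop where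
  bilinear : ∀ s t h, IsBoundedBilinearMap ℝ (fun z : X.level s × X.level t => ω s t h z.1 z.2)
  skew : ∀ s t (h : s + t = 0) (h' : t + s = 0) v w, ω s t h v w = - ω t s h' w v
  iso : ∃ e : ∀ s : ℤ, X.level s ≃L[ℝ] X.dual.level s,
    (∀ s w v, e s w v = ω (-s) s (neg_add_cancel s) v w) ∧
    ∀ (r s : ℤ) (h : r ≤ s) w, e r (X.bond h w) = X.dual.bond h (e s w)

/-! ## Scale calculus -/

/-- The level `U_m = U ∩ X_m` of the open system of subsets induced by `U ⊆ X_0`. -/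
def levelSet {X : ScaleSystem ℕ} (U : Set (X.level 0)) (m : ℕ) : Set (X.level m) :=
  X.bond (Nat.zero_le m) ⁻¹' U

/-- `U^1 = U_1 ⊆ X_1`, regarded as a subset of the zeroth level of `X^1`. -/
def shiftSet {X : ScaleSystem ℕ} (U : Set (X.level 0)) : Set ((X.shift 1).level 0) :=
  levelSet U (0 + 1)

/-- `TU = U^1 × X`. -/
def tangentSet {X : ScaleSystem ℕ} (U : Set (X.level 0)) : Set (X.tangent.level 0) :=
  {z | z.1 ∈ shiftSet U}

/-- A family of functions between the levels of two scales. Only the values on the levels of an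
open set are relevant below. -/
abbrev LevelMap (X Y : ScaleSystem ℕ) : Type := ∀ m, X.level m → Y.level m

/-- `sc⁰` maps: scale maps (compatible with the bonding maps), continuous on every level. -/
structure IsSc0 {X Y : ScaleSystem ℕ} (U : Set (X.level 0)) (f : LevelMap X Y) : Prop where
  compat : ∀ (r s : ℕ) (h : r ≤ s), ∀ x ∈ levelSet U s, f r (X.bond h x) = Y.bond h (f s x)
  cont : ∀ m, ContinuousOn (f m) (levelSet U m)

/-- `Df : TU → Y` is the sc-derivative of `f : U → Y`. -/
structure IsScDeriv {X Y : ScaleSystem ℕ} (U : Set (X.level 0)) (f : LevelMap X Y)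
    (Df : LevelMap X.tangent Y) : Prop where
  sc0 : IsSc0 (tangentSet U) Df
  linear : ∀ m, ∀ x ∈ levelSet U (m + 1), IsLinearMap ℝ (fun v : X.level m => Df m (x, v))
  frechet : ∀ x ∈ levelSet U (0 + 1),
    (fun h : X.level (0 + 1) => f 0 (X.bond (Nat.zero_le _) (x + h))
      - f 0 (X.bond (Nat.zero_le _) x) - Df 0 (x, X.bond (Nat.zero_le _) h)) =o[𝓝 0] fun h => h

/-- The tangent map `Tf (x, v) = (f(x), Df(x, v))`. -/
def tangentMap {X Y : ScaleSystem ℕ} (f : LevelMap X Y) (Df : LevelMap X.tangent Y) :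
    LevelMap X.tangent Y.tangent :=
  fun m z => (f (m + 1) z.1, Df m z)

/-- `f : U → Y` is `sc^k`: it is `sc⁰`, and for `k ≥ 1` it has an sc-derivative such that `Tf` is
`sc^{k-1}`. -/
def IsSc : (k : ℕ) → {X Y : ScaleSystem ℕ} → Set (X.level 0) → LevelMap X Y → Prop
  | 0, _, _, U, f => IsSc0 U f
  | k + 1, _, _, U, f => IsSc0 U f ∧ ∃ Df, IsScDeriv U f Df ∧
      IsSc k (tangentSet U) (tangentMap f Df)

/-- sc-smooth maps. -/
def IsScSmooth {X Y : ScaleSystem ℕ} (U : Set (X.level 0)) (f : LevelMap X Y) : Prop :=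
  ∀ k, IsSc k U f

/-- Scale operators: linear `sc⁰` maps. -/
structure IsScOperator {X Y : ScaleSystem ℕ} (L : LevelMap X Y) : Prop where
  linear : ∀ m, IsLinearMap ℝ (L m)
  sc0 : IsSc0 univ L

/-- `Dh : U^1 → X^*` is the strong sc-derivative of the densely defined `sc⁰` map
`h : U^1 → ℝ`. -/
structure IsStrongScDeriv (X : ScaleSystem ℤ) (U : Set (X.nonneg.level 0))
    (h : LevelMap (X.nonneg.shift 1) realLine)
    (Dh : LevelMap (X.nonneg.shift 1) X.dual.nonneg) : Prop where
  base : IsSc0 (shiftSet U) h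
  sc0 : IsSc0 (shiftSet U) Dh
  frechet : ∀ x ∈ shiftSet U,
    (fun t : X.level ((0 + 1 : ℕ) : ℤ) =>
      h 0 (x + t) - h 0 x - Dh 0 x (X.bond (by simp) t)) =o[𝓝 0] fun t => t

/-- `h : U^1 → ℝ` is strongly (densely defined) sc-smooth, with strong derivative `Dh`. -/
def IsStronglyScSmooth (X : ScaleSystem ℤ) (U : Set (X.nonneg.level 0))
    (h : LevelMap (X.nonneg.shift 1) realLine)
    (Dh : LevelMap (X.nonneg.shift 1) X.dual.nonneg) : Prop :=
  IsStrongScDeriv X U h Dh ∧ IsScSmooth (shiftSet U) Dh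

end ScaleSystem

open ScaleSystem

/-! ## Scale manifolds -/

/-- The data of a chart on `M` modeled on the scale `X`: a coordinate domain and a coordinate map
(relevant on the domain only). -/
structure ScChart (M : Type*) (X : ScaleSystem ℕ) where
  source : Set M
  toFun : M → X.level 0

namespace ScChart

variable {M N : Type*} {X Y : ScaleSystem ℕ}

/-- The image of a chart. -/
def target (φ : ScChart M X) : Set (X.level 0) := φ.toFun '' φ.source

/-- The chart is a homeomorphism of an open subset of `M` onto an open subset of `X_0`. -/
structure IsChart [TopologicalSpace M] (φ : ScChart M X) : Prop where
  open_source : IsOpen φ.source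
  injOn : InjOn φ.toFun φ.source
  continuousOn : ContinuousOn φ.toFun φ.source
  open_image : ∀ O ⊆ φ.source, IsOpen O → IsOpen (φ.toFun '' O)

/-- The level map `F` represents `f : M → N` in the charts `φ` and `ψ`. -/
def Represents (φ : ScChart M X) (ψ : ScChart N Y) (f : M → N) (F : LevelMap X Y) : Prop :=
  ∀ q ∈ φ.source, F 0 (φ.toFun q) = ψ.toFun (f q)

/-- The image `φ(U ∩ U')` of the overlap of two charts, the domain of `ψ ∘ φ⁻¹`. -/
def overlap (φ ψ : ScChart M X) : Set (X.level 0) := φ.toFun '' (φ.source ∩ ψ.source)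

/-- The level map `G` is the transition map `ψ ∘ φ⁻¹` on `φ(U ∩ U')`. -/
def IsTransition (φ ψ : ScChart M X) (G : LevelMap X X) : Prop :=
  ∀ q ∈ φ.source ∩ ψ.source, G 0 (φ.toFun q) = ψ.toFun q

/-- The product of two charts. -/
def prod (φ : ScChart M X) (ψ : ScChart N Y) : ScChart (M × N) (X.prod Y) where
  source := φ.source ×ˢ ψ.source
  toFun p := (φ.toFun p.1, ψ.toFun p.2)

end ScChart

/-- The charts of the real line: the identity on open subsets. -/
def realCharts : Set (ScChart ℝ realLine) := {κ | IsOpen κ.source ∧ κ.toFun = fun t => t}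

/-- The product charts on `M × N`. -/
def prodCharts {M N : Type*} {X Y : ScaleSystem ℕ} (A : Set (ScChart M X))
    (B : Set (ScChart N Y)) : Set (ScChart (M × N) (X.prod Y)) :=
  {χ | ∃ φ ∈ A, ∃ ψ ∈ B, χ = φ.prod ψ}

/-- `f : M → N` is sc-smooth with respect to the sc-smooth structures `A` and `B`. -/
def IsScSmoothMap {M N : Type*} {X Y : ScaleSystem ℕ} (A : Set (ScChart M X))
    (B : Set (ScChart N Y)) (f : M → N) : Prop :=
  ∀ p, ∃ φ ∈ A, ∃ ψ ∈ B, p ∈ φ.source ∧ MapsTo f φ.source ψ.source ∧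
    ∃ F, φ.Represents ψ f F ∧ IsScSmooth φ.target F

section Symplectic

variable {M : Type*} (X : ScaleSystem ℤ) (ω : ∀ s t : ℤ, s + t = 0 → X.level s → X.level t → ℝ)

/-- `ω` on `X_0`, the zeroth level of `X_{≥ 0}`. -/
def centerForm (v w : X.nonneg.level 0) : ℝ := ω ((0 : ℕ) : ℤ) ((0 : ℕ) : ℤ) (by simp) v w

/-- Symplectic compatibility: the transition map `ψ ∘ φ⁻¹` is an sc-smooth diffeomorphism whose
derivative `X_0 → X_0` preserves `ω` at each point of level one. -/
def SymplecticallyCompatible (φ ψ : ScChart M X.nonneg) : Prop :=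
  (∃ G, φ.IsTransition ψ G ∧ IsScSmooth (φ.overlap ψ) G ∧
    ∃ DG, IsScDeriv (φ.overlap ψ) G DG ∧ ∀ x ∈ shiftSet (φ.overlap ψ),
      ∀ v w : X.nonneg.level 0,
        centerForm X ω (DG 0 (x, v)) (DG 0 (x, w)) = centerForm X ω v w) ∧
  ∃ H, ψ.IsTransition φ H ∧ IsScSmooth (ψ.overlap φ) H

/-- `A` is a symplectic sc-smooth atlas on the Hausdorff space `M`, modeled on `(X, ω)`. -/
structure IsSymplecticAtlas [TopologicalSpace M] (A : Set (ScChart M X.nonneg)) : Prop where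
  hausdorff : T2Space M
  chart : ∀ φ ∈ A, φ.IsChart
  cover : ∀ p, ∃ φ ∈ A, p ∈ φ.source
  compatible : ∀ φ ∈ A, ∀ ψ ∈ A, SymplecticallyCompatible X ω φ ψ

/-- The maximal symplectic atlas containing the symplectic atlas `A`: all charts symplectically
compatible with those of `A`. -/
def maximalSymplecticAtlas [TopologicalSpace M] (A : Set (ScChart M X.nonneg)) :
    Set (ScChart M X.nonneg) :=
  {φ | φ.IsChart ∧ ∀ ψ ∈ A, SymplecticallyCompatible X ω φ ψ ∧ SymplecticallyCompatible X ω ψ φ}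

end Symplectic

section Bundles

variable {M : Type*} {X : ScaleSystem ℕ} (A : Set (ScChart M X))

/-- The filtration `M_m` of an sc-manifold. -/
def levelPoints (m : ℕ) : Set M :=
  {p | ∃ φ ∈ A, p ∈ φ.source ∧ φ.toFun p ∈ range (X.bond (Nat.zero_le m))}

/-- The restriction `φ_1 : U_1 → X_1` of a chart of `M` to `M_1`. -/
def ScChart.one (φ : ScChart M X) : ScChart (levelPoints A 1) (X.shift 1) where
  source := {p | p.1 ∈ φ.source}
  toFun p := Function.invFun (X.bond (Nat.zero_le (0 + 1))) (φ.toFun p.1)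

/-- The charts of `M^1`. -/
def oneCharts : Set (ScChart (levelPoints A 1) (X.shift 1)) := ScChart.one A '' A

/-- The pairs `((U, φ), v)` of a chart around `p` and a vector `v ∈ X_0`. -/
abbrev ChartVector (p : levelPoints A 1) : Type _ :=
  {φ : ScChart M X // φ ∈ A ∧ p.1 ∈ φ.source} × X.level 0

/-- `((U, φ), v) ∼ ((U', ψ), w)` if `D(ψ ∘ φ⁻¹)(φ(p), v) = w`. -/
def tangentRel (p : levelPoints A 1) (a b : ChartVector A p) : Prop :=
  ∃ G DG, a.1.1.IsTransition b.1.1 G ∧ IsSc0 (a.1.1.overlap b.1.1) G ∧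
    IsScDeriv (a.1.1.overlap b.1.1) G DG ∧ DG 0 ((a.1.1.one A).toFun p, a.2) = b.2

/-- The tangent space `(T_p M)_0` at `p ∈ M_1`. -/
def ScTangent (p : levelPoints A 1) : Type _ := Quot (tangentRel A p)

/-- The tangent vector `[(U, φ), v]`. -/
def ScTangent.mk (p : levelPoints A 1) (φ : ScChart M X) (hφ : φ ∈ A) (hp : p.1 ∈ φ.source)
    (v : X.level 0) : ScTangent A p :=
  Quot.mk _ (⟨φ, hφ, hp⟩, v)

open Classical in
/-- The coordinate bijection `D_p φ : (T_p M)_0 → X_0`, `[(U, φ), v] ↦ v`. -/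
def ScTangent.coord {p : levelPoints A 1} (φ : ScChart M X) (ξ : ScTangent A p) : X.level 0 :=
  Classical.epsilon fun v => ∃ hφ hp, ScTangent.mk A p φ hφ hp v = ξ

/-- The tangent bundle `TM = ⋃_{p ∈ M_1} {p} × (T_p M)_0`. -/
abbrev ScTangentBundle : Type _ := Σ p : levelPoints A 1, ScTangent A p

/-- The charts `Tφ (p, ξ) = (φ(p), D_p φ(ξ))` of the tangent bundle. -/
def tangentCharts : Set (ScChart (ScTangentBundle A) X.tangent) :=
  {χ | ∃ φ ∈ A, χ.source = {z | z.1.1 ∈ φ.source} ∧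
    χ.toFun = fun z => ((φ.one A).toFun z.1, z.2.coord A φ)}

/-- sc-smooth vector fields: sc-smooth sections `M^1 → TM` of the tangent bundle. -/
def IsScSmoothVectorField (V : ∀ p : levelPoints A 1, ScTangent A p) : Prop :=
  IsScSmoothMap (oneCharts A) (tangentCharts A) fun p => (⟨p, V p⟩ : ScTangentBundle A)

/-- The partial derivative `∂φ/∂t (t, p)` of a map `φ : ℝ × M → M` at `t ∈ ℝ` and `p ∈ M_1` is the
tangent vector `ξ` at `φ(t, p) ∈ M_1`: in charts around `(t, p)` and `φ(t, p)` it is the value of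
the sc-derivative in the direction `(1, 0)`. -/
def HasTimeDeriv (Φ : ℝ × M → M) (t : ℝ) (p : levelPoints A 1) (z : ScTangentBundle A) : Prop :=
  Φ (t, p.1) = z.1.1 ∧
  ∃ κ ∈ realCharts, ∃ φ ∈ A, ∃ ψ, ∃ (hψ : ψ ∈ A) (hq : z.1.1 ∈ ψ.source),
    t ∈ κ.source ∧ p.1 ∈ φ.source ∧ MapsTo Φ (κ.prod φ).source ψ.source ∧
    ∃ F DF, (κ.prod φ).Represents ψ Φ F ∧ IsSc0 (κ.prod φ).target F ∧
      IsScDeriv (κ.prod φ).target F DF ∧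
      z.2 = ScTangent.mk A z.1 ψ hψ hq (DF 0 ((t, (φ.one A).toFun p), ((1 : ℝ), (0 : X.level 0))))

/-- The vector field `V` has the global flow `Φ`: the map `Φ : ℝ × M → M` is sc-smooth,
`Φ(0, p) = p`, and `∂Φ/∂t (t, p) = V(Φ(t, p))`. -/
structure IsGlobalFlow (V : ∀ p : levelPoints A 1, ScTangent A p) (Φ : ℝ × M → M) : Prop where
  smooth : IsScSmoothMap (prodCharts realCharts A) A Φ
  initial : ∀ p, Φ (0, p) = p
  deriv : ∀ (t : ℝ) (p : levelPoints A 1), ∃ q : levelPoints A 1,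
    Φ (t, p.1) = q.1 ∧ HasTimeDeriv A Φ t p ⟨q, V q⟩

/-- The cotangent space `(T_p M)_0^*`: functions on `(T_p M)_0` that are continuous and linear in
every chart. -/
def ScCotangent (p : levelPoints A 1) : Type _ :=
  {α : ScTangent A p → ℝ // ∀ (φ : ScChart M X) (hφ : φ ∈ A) (hp : p.1 ∈ φ.source),
    ∃ L : X.level 0 →L[ℝ] ℝ, ∀ v, α (ScTangent.mk A p φ hφ hp v) = L v}

end Bundles

section Hamiltonian

variable {M : Type*} (X : ScaleSystem ℤ) (ω : ∀ s t : ℤ, s + t = 0 → X.level s → X.level t → ℝ)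
  (A : Set (ScChart M X.nonneg))

/-- `H` represents `h : M^1 → ℝ` in the chart `φ`. -/
def RepresentsFunction (φ : ScChart M X.nonneg) (h : levelPoints A 1 → ℝ)
    (H : LevelMap (X.nonneg.shift 1) realLine) : Prop :=
  ∀ q ∈ (φ.one A).source, H 0 ((φ.one A).toFun q) = h q

/-- `h : M^1 → ℝ` is strongly sc-smooth. -/
def IsStronglyScSmoothFunction (h : levelPoints A 1 → ℝ) : Prop :=
  ∀ p : levelPoints A 1, ∃ φ ∈ A, p.1 ∈ φ.source ∧ ∃ H DH, RepresentsFunction X A φ h H ∧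
    IsStronglyScSmooth X φ.target H DH

/-- `dh` is the derivative of the strongly sc-smooth function `h`, as a section of the cotangent
bundle: `dh_p = D_{φ(p)}(h ∘ φ⁻¹) ∘ D_p φ` for a chart `φ` around `p`. -/
def IsDifferential (h : levelPoints A 1 → ℝ) (dh : ∀ p : levelPoints A 1, ScCotangent A p) :
    Prop :=
  ∀ p : levelPoints A 1, ∃ φ, ∃ (hφ : φ ∈ A) (hp : p.1 ∈ φ.source), ∃ H DH,
    RepresentsFunction X A φ h H ∧ IsStronglyScSmooth X φ.target H DH ∧
    ∀ v : X.nonneg.level 0, (dh p).1 (ScTangent.mk A p φ hφ hp v) =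
      DH 0 ((φ.one A).toFun p) (X.bond (by simp) v)

/-- The symplectic form `ω_p` on `(T_p M)_0`, pulled back from `X_0` by a chart around `p`. -/
def tangentForm (p : levelPoints A 1) (ξ η : ScTangent A p) : ℝ :=
  centerForm X ω (ξ.coord A (Classical.choose p.2)) (η.coord A (Classical.choose p.2))

/-- The function `h` generates the vector field `V`: `h` is strongly sc-smooth and
`-Dh = ι_ω ∘ V`, where `ι_ω(p, η) = (p, ω_p(·, η))`. -/
def Generates (h : levelPoints A 1 → ℝ) (V : ∀ p : levelPoints A 1, ScTangent A p) : Prop :=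
  IsStronglyScSmoothFunction X A h ∧ ∃ dh, IsDifferential X A h dh ∧
    ∀ (p : levelPoints A 1) (ξ : ScTangent A p), -(dh p).1 ξ = tangentForm X ω A p ξ (V p)

/-- A map `ℝ × M → M` is a Hamiltonian flow if it is the global flow of an sc-smooth vector field
generated by some strongly sc-smooth function. -/
def IsHamiltonianFlow (Φ : ℝ × M → M) : Prop :=
  ∃ V, IsScSmoothVectorField A V ∧ IsGlobalFlow A V Φ ∧ ∃ h, Generates X ω A h V

end Hamiltonian

/-! ## Weighted sequence spaces -/

/-- Positive weights `ν_n`, `n ∈ ℤ`, with `ν_n → ∞` as `|n| → ∞`. -/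
structure ScaleWeight where
  ν : ℤ → ℝ
  pos : ∀ n, 0 < ν n
  tendsto : Tendsto ν cofinite atTop

namespace ScaleWeight

variable (W : ScaleWeight)

/-- The sequences `x` with `∑ |x_n|² ν_n^{2s} < ∞`. -/
def seqSubmodule (s : ℤ) : Submodule ℂ (ℤ → ℂ) where
  carrier := {x | Memℓp (fun n => ((W.ν n ^ s : ℝ) : ℂ) * x n) 2}
  add_mem' {x y} hx hy := by
    have := hx.add hy
    simpa [mul_add, Pi.add_def] using this
  zero_mem' := by
    have : (fun n => ((W.ν n ^ s : ℝ) : ℂ) * (0 : ℤ → ℂ) n) = 0 := by ext; simp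
    simp only [mem_ofPred_eq, this]
    exact zero_memℓp
  smul_mem' c x hx := by
    have := hx.const_smul c
    have e : (fun n => ((W.ν n ^ s : ℝ) : ℂ) * (c • x) n) =
        c • fun n => ((W.ν n ^ s : ℝ) : ℂ) * x n := by
      ext n; simp; ring
    simpa only [mem_ofPred_eq, e] using this

/-- The weighted space `l^{2,s}`. -/
@[ext] structure Seq (s : ℤ) where
  entry : ℤ → ℂ
  mem : entry ∈ W.seqSubmodule s

namespace Seq

variable {W} {s : ℤ}

instance : Zero (W.Seq s) := ⟨⟨0, zero_mem _⟩⟩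
instance : Add (W.Seq s) := ⟨fun x y => ⟨x.entry + y.entry, add_mem x.mem y.mem⟩⟩
instance : Neg (W.Seq s) := ⟨fun x => ⟨-x.entry, neg_mem x.mem⟩⟩
instance : Sub (W.Seq s) := ⟨fun x y => ⟨x.entry - y.entry, sub_mem x.mem y.mem⟩⟩
instance : SMul ℕ (W.Seq s) := ⟨fun k x => ⟨k • x.entry, nsmul_mem x.mem k⟩⟩
instance : SMul ℤ (W.Seq s) := ⟨fun k x => ⟨k • x.entry, zsmul_mem x.mem k⟩⟩
instance : SMul ℂ (W.Seq s) := ⟨fun c x => ⟨c • x.entry, Submodule.smul_mem _ c x.mem⟩⟩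

theorem entry_injective : Function.Injective (Seq.entry : W.Seq s → ℤ → ℂ) :=
  fun _ _ h => Seq.ext h

instance : AddCommGroup (W.Seq s) :=
  entry_injective.addCommGroup Seq.entry rfl (fun _ _ => rfl) (fun _ => rfl) (fun _ _ => rfl)
    (fun _ _ => rfl) (fun _ _ => rfl)

/-- The entries, as an additive homomorphism. -/
def entryHom : W.Seq s →+ (ℤ → ℂ) where
  toFun := Seq.entry
  map_zero' := rfl
  map_add' _ _ := rfl

instance : Module ℂ (W.Seq s) :=
  entry_injective.module ℂ (entryHom : W.Seq s →+ (ℤ → ℂ)) (fun _ _ => rfl)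

theorem entry_add (x y : W.Seq s) : (x + y).entry = x.entry + y.entry := rfl

theorem entry_smul (c : ℂ) (x : W.Seq s) : (c • x).entry = c • x.entry := rfl

theorem entry_real_smul (c : ℝ) (x : W.Seq s) : (c • x).entry = (c : ℂ) • x.entry := rfl

end Seq

/-- The isometry `x ↦ (x_n ν_n^s)` of `l^{2,s}` onto `l²`, which defines the norm
`‖x‖_s² = ∑ |x_n|² ν_n^{2s}`. -/
def toL2 (s : ℤ) : W.Seq s →ₗ[ℂ] lp (fun _ : ℤ => ℂ) 2 where
  toFun x := ⟨fun n => ((W.ν n ^ s : ℝ) : ℂ) * x.entry n, x.mem⟩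
  map_add' x y := by
    ext n
    exact mul_add _ _ _
  map_smul' c x := by
    ext n
    exact mul_left_comm _ _ _

theorem toL2_apply (s : ℤ) (x : W.Seq s) (n : ℤ) :
    W.toL2 s x n = ((W.ν n ^ s : ℝ) : ℂ) * x.entry n := rfl

theorem weight_ne (s n : ℤ) : ((W.ν n ^ s : ℝ) : ℂ) ≠ 0 :=
  Complex.ofReal_ne_zero.mpr (zpow_ne_zero _ (W.pos n).ne')

theorem toL2_bijective (s : ℤ) : Function.Bijective (W.toL2 s) := by
  constructor
  · intro x y h
    apply Seq.entry_injective
    funext n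
    have := congrArg (fun z : lp (fun _ : ℤ => ℂ) 2 => z n) h
    exact mul_left_cancel₀ (W.weight_ne s n) this
  · intro y
    have e : (fun n => ((W.ν n ^ s : ℝ) : ℂ) * (((W.ν n ^ s : ℝ) : ℂ)⁻¹ * y n)) = y := by
      funext n
      rw [mul_inv_cancel_left₀ (W.weight_ne s n)]
    refine ⟨⟨fun n => ((W.ν n ^ s : ℝ) : ℂ)⁻¹ * y n, ?_⟩, ?_⟩
    · change Memℓp _ 2
      rw [e]
      exact y.2
    · ext n
      exact congrFun e n

instance (s : ℤ) : NormedAddCommGroup (W.Seq s) :=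
  NormedAddCommGroup.induced (W.Seq s) (lp (fun _ : ℤ => ℂ) 2) (W.toL2 s) (W.toL2_bijective s).1

theorem norm_toL2 (s : ℤ) (x : W.Seq s) : ‖W.toL2 s x‖ = ‖x‖ := rfl

instance (s : ℤ) : NormedSpace ℂ (W.Seq s) where
  norm_smul_le c x := by
    rw [← norm_toL2, ← norm_toL2, map_smul]
    exact norm_smul_le _ _

instance (s : ℤ) : CompleteSpace (W.Seq s) := by
  let e : W.Seq s ≃ₗᵢ[ℂ] lp (fun _ : ℤ => ℂ) 2 :=
    { LinearEquiv.ofBijective (W.toL2 s) (W.toL2_bijective s) with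
      norm_map' := fun x => W.norm_toL2 s x }
  exact (completeSpace_congr (e := e.toLinearEquiv.toEquiv) e.isometry.isUniformEmbedding).mpr
    inferInstance

theorem exists_bound {r s : ℤ} (h : r ≤ s) : ∃ C : ℝ, ∀ n, W.ν n ^ r ≤ C * W.ν n ^ s := by
  have hfin : {n | ¬ 1 ≤ W.ν n}.Finite := W.tendsto.eventually (eventually_ge_atTop 1)
  obtain ⟨C, hC⟩ := (hfin.image fun n => W.ν n ^ (r - s)).bddAbove
  refine ⟨max C 1, fun n => ?_⟩
  have e : W.ν n ^ r = W.ν n ^ (r - s) * W.ν n ^ s := by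
    rw [← zpow_add₀ (W.pos n).ne']; congr 1; ring
  rw [e]
  refine mul_le_mul_of_nonneg_right ?_ (zpow_pos (W.pos n) s).le
  by_cases hn : 1 ≤ W.ν n
  · exact (zpow_le_one_of_nonpos₀ hn (by omega)).trans (le_max_right _ _)
  · exact (hC ⟨n, hn, rfl⟩).trans (le_max_left _ _)

theorem norm_weight_mul_le {r s : ℤ} {C : ℝ} (hC : ∀ n, W.ν n ^ r ≤ C * W.ν n ^ s) (z : ℂ)
    (n : ℤ) : ‖((W.ν n ^ r : ℝ) : ℂ) * z‖ ≤ ‖(C : ℂ) * (((W.ν n ^ s : ℝ) : ℂ) * z)‖ := by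
  have h1 := (zpow_pos (W.pos n) r).le
  have h2 := (zpow_pos (W.pos n) s).le
  have h3 := (hC n).trans (mul_le_mul_of_nonneg_right (le_abs_self C) h2)
  simp only [norm_mul, Complex.norm_real, Real.norm_eq_abs, abs_of_nonneg h1, abs_of_nonneg h2]
  rw [← mul_assoc]
  exact mul_le_mul_of_nonneg_right h3 (norm_nonneg z)

theorem mem_of_le {r s : ℤ} (h : r ≤ s) {x : ℤ → ℂ} (hx : x ∈ W.seqSubmodule s) :
    x ∈ W.seqSubmodule r := by
  obtain ⟨C, hC⟩ := W.exists_bound h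
  have hx' : Memℓp (fun n => ((W.ν n ^ s : ℝ) : ℂ) * x n) 2 := hx
  have h1 := hx'.const_smul (C : ℂ)
  exact h1.mono' fun n => W.norm_weight_mul_le hC (x n) n

/-- The inclusion `l^{2,s} ⊆ l^{2,r}` for `r ≤ s`, as a linear map. -/
def inclLinear {r s : ℤ} (h : r ≤ s) : W.Seq s →ₗ[ℝ] W.Seq r where
  toFun x := ⟨x.entry, W.mem_of_le h x.mem⟩
  map_add' _ _ := rfl
  map_smul' _ _ := rfl

theorem inclLinear_entry {r s : ℤ} (h : r ≤ s) (x : W.Seq s) :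
    (W.inclLinear h x).entry = x.entry := rfl

theorem exists_norm_inclLinear_le {r s : ℤ} (h : r ≤ s) :
    ∃ K : ℝ, ∀ x : W.Seq s, ‖W.inclLinear h x‖ ≤ K * ‖x‖ := by
  obtain ⟨C, hC⟩ := W.exists_bound h
  refine ⟨‖(C : ℂ)‖, fun x => ?_⟩
  have key : ‖W.toL2 r (W.inclLinear h x)‖ ≤ ‖(C : ℂ) • W.toL2 s x‖ := by
    refine lp.norm_mono two_ne_zero fun n => ?_
    rw [lp.coeFn_smul, Pi.smul_apply, toL2_apply, toL2_apply, smul_eq_mul, inclLinear_entry]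
    exact W.norm_weight_mul_le hC (x.entry n) n
  rw [norm_smul, norm_toL2, norm_toL2] at key
  exact key

/-- The inclusion `l^{2,s} ⊆ l^{2,r}` for `r ≤ s`. -/
def incl {r s : ℤ} (h : r ≤ s) : W.Seq s →L[ℝ] W.Seq r :=
  (W.inclLinear h).mkContinuousOfExistsBound (W.exists_norm_inclLinear_le h)

theorem incl_entry {r s : ℤ} (h : r ≤ s) (x : W.Seq s) : (W.incl h x).entry = x.entry := by
  rw [incl, LinearMap.mkContinuousOfExistsBound_apply, inclLinear_entry]

/-- The Hilbert scale `{l^{2,s}}` on `ℤ`, over the reals. -/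
@[reducible] def scale : ScaleSystem ℤ where
  level s := W.Seq s
  bond h := W.incl h
  bond_self s := by
    ext x n
    rw [incl_entry, ContinuousLinearMap.id_apply]
  bond_comp h h' := by
    ext x n
    rw [ContinuousLinearMap.comp_apply, incl_entry, incl_entry, incl_entry]

/-- The pairing `⟨x, y⟩_0 = ∑ x_n conj(y_n)`. -/
def pairing {s t : ℤ} (x : W.Seq s) (y : W.Seq t) : ℂ :=
  ∑' n, x.entry n * (starRingEnd ℂ) (y.entry n)

/-- The standard symplectic structure `ω = Re ⟨i ·, ·⟩_0 = -Im ⟨·, ·⟩_0`. -/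
def stdForm (s t : ℤ) (_ : s + t = 0) (x : W.Seq s) (y : W.Seq t) : ℝ :=
  -(W.pairing x y).im

open Classical in
/-- The element of `l^{2,s}` with entries `x_n`, provided the sequence lies in `l^{2,s}`. -/
def ofSeq (s : ℤ) (x : ℤ → ℂ) : W.Seq s :=
  if h : x ∈ W.seqSubmodule s then ⟨x, h⟩ else 0

/-- The multiplier `x ↦ (c_n x_n)` as a family of maps `X_{m+1} → X_m`. -/
def multiplier (c : ℤ → ℂ) : LevelMap (W.scale.nonneg.shift 1) W.scale.nonneg :=
  fun m (x : W.Seq ((m + 1 : ℕ) : ℤ)) => W.ofSeq (m : ℤ) fun n => c n * x.entry n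

end ScaleWeight

/-! ## Projective Hilbert space -/

section Projective

variable {E : Type*} [NormedAddCommGroup E] [InnerProductSpace ℂ E]

/-- The quotient topology on `P(E)`. -/
instance projectiveTopology : TopologicalSpace (ℙ ℂ E) :=
  inferInstanceAs (TopologicalSpace (Quotient (projectivizationSetoid ℂ E)))

/-- The re-indexing of `ℤ ∖ {a}` by `ℤ`. -/
def skip (a n : ℤ) : ℤ := if n < a then n else n + 1

/-- The entries `|x_a| / (x_a ‖x‖) · x_n` (for `n < a`), `|x_a| / (x_a ‖x‖) · x_{n+1}`
(for `n ≥ a`), where `x_n` are the coefficients of `u` in the Hilbert basis `b`. -/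
def darbouxEntry (b : HilbertBasis ℤ ℂ E) (a : ℤ) (u : E) (n : ℤ) : ℂ :=
  ((‖b.repr u a‖ : ℝ) : ℂ) / (b.repr u a * ((‖u‖ : ℝ) : ℂ)) * b.repr u (skip a n)

/-- The chart `ψ_a` on `U_a = {[x] : x_a ≠ 0}`. -/
def darbouxChart (b : HilbertBasis ℤ ℂ E) (W : ScaleWeight) (a : ℤ) :
    ScChart (ℙ ℂ E) W.scale.nonneg where
  source := {p | b.repr p.rep a ≠ 0}
  toFun p := W.ofSeq ((0 : ℕ) : ℤ) (darbouxEntry b a p.rep)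

/-- The atlas `{(U_a, ψ_a)}`. -/
def darbouxAtlas (b : HilbertBasis ℤ ℂ E) (W : ScaleWeight) :
    Set (ScChart (ℙ ℂ E) W.scale.nonneg) :=
  range (darbouxChart b W)

/-- The symplectic sc-smooth structure of `P(E)` generated by the charts `ψ_a`. -/
def projectiveStructure (b : HilbertBasis ℤ ℂ E) (W : ScaleWeight) :
    Set (ScChart (ℙ ℂ E) W.scale.nonneg) :=
  maximalSymplecticAtlas W.scale W.stdForm (darbouxAtlas b W)

end Projective

/-! ## The free Schrödinger equation on the circle -/

instance circleLength_pos : Fact (0 < 2 * Real.pi) := ⟨Real.two_pi_pos⟩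

/-- `L²(S¹, ℂ)`, where `S¹ = ℝ / 2πℤ` carries the normalized Haar measure. -/
abbrev L2Circle : Type :=
  MeasureTheory.Lp ℂ 2 (AddCircle.haarAddCircle (T := 2 * Real.pi))

/-- The Fourier basis `x ↦ e^{inx}` of `L²(S¹, ℂ)`. -/
def circleBasis : HilbertBasis ℤ ℂ L2Circle := fourierBasis

/-- The weights `1 + n²`, so that the level `s` consists of the Fourier coefficients of
`W^{2s,2}(S¹, ℂ)`. -/
def sobolevWeight : ScaleWeight where
  ν n := 1 + (n : ℝ) ^ 2
  pos n := by positivity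
  tendsto := by
    have h : Tendsto (fun n : ℤ => ‖(n : ℝ)‖) cofinite atTop := by
      have := tendsto_norm_cocompact_atTop.comp Int.tendsto_coe_cofinite
      exact this
    refine tendsto_atTop_mono (fun n => ?_) h
    rw [Real.norm_eq_abs]
    nlinarith [sq_abs (n : ℝ), sq_nonneg (|(n : ℝ)| - 1)]

theorem norm_schrodingerPhase (t : ℝ) (n : ℤ) :
    ‖Complex.exp (-Complex.I * t * (n : ℂ) ^ 2)‖ = 1 := by
  have : -Complex.I * t * (n : ℂ) ^ 2 = ((-t * (n : ℝ) ^ 2 : ℝ) : ℂ) * Complex.I := by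
    push_cast; ring
  rw [this, Complex.norm_exp_ofReal_mul_I]

/-- The operator `e^{itΔ}` on sequences: multiplication by `e^{-itn²}`. -/
def schrodingerSeq (t : ℝ) : lp (fun _ : ℤ => ℂ) 2 →ₗ[ℂ] lp (fun _ : ℤ => ℂ) 2 where
  toFun x := ⟨fun n => Complex.exp (-Complex.I * t * (n : ℂ) ^ 2) * x n,
    x.2.mono' fun n => by rw [norm_mul, norm_schrodingerPhase, one_mul]⟩
  map_add' x y := by
    ext n
    exact mul_add _ _ _
  map_smul' c x := by
    ext n
    exact mul_left_comm _ _ _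

theorem schrodingerSeq_injective (t : ℝ) : Function.Injective (schrodingerSeq t) := by
  intro x y h
  ext n
  have := congrArg (fun z : lp (fun _ : ℤ => ℂ) 2 => z n) h
  exact mul_left_cancel₀ (Complex.exp_ne_zero _) this

/-- The Schrödinger flow `e^{itΔ}` on `L²(S¹, ℂ)`, with Fourier multiplier `e^{-itn²}`. -/
def schrodinger (t : ℝ) : L2Circle →ₗ[ℂ] L2Circle :=
  circleBasis.repr.symm.toLinearEquiv.toLinearMap ∘ₗ schrodingerSeq t ∘ₗ
    circleBasis.repr.toLinearEquiv.toLinearMap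

theorem schrodinger_injective (t : ℝ) : Function.Injective (schrodinger t) :=
  circleBasis.repr.symm.injective.comp
    ((schrodingerSeq_injective t).comp circleBasis.repr.injective)

/-- The descended flow `(t, [u]) ↦ [e^{itΔ} u]` on `P(L²)`. -/
def projectiveFlow (z : ℝ × ℙ ℂ L2Circle) : ℙ ℂ L2Circle :=
  Projectivization.map (schrodinger z.1) (schrodinger_injective z.1) z.2

/-- `v` is the weak derivative of `u`: `∫ u g' = - ∫ v g` for all smooth test functions `g`
on the circle. -/
def HasWeakDeriv (u v : L2Circle) : Prop :=
  ∀ g g' : AddCircle (2 * Real.pi) → ℂ, ContDiff ℝ (⊤ : ℕ∞) (fun t : ℝ => g t) →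
    (∀ t : ℝ, HasDerivAt (fun s : ℝ => g s) (g' t) t) →
    ∫ x, u x * g' x ∂AddCircle.haarAddCircle = - ∫ x, v x * g x ∂AddCircle.haarAddCircle

open Classical in
/-- The weak derivative `u_x`, if it exists in `L²`. -/
def weakDeriv (u : L2Circle) : L2Circle :=
  if h : ∃ v, HasWeakDeriv u v then Classical.choose h else 0

/-- The symplectic sc-smooth structure of `M = P(L²)`. -/
abbrev circleStructure : Set (ScChart (ℙ ℂ L2Circle) sobolevWeight.scale.nonneg) :=
  projectiveStructure circleBasis sobolevWeight

/-- The Hamiltonian `[u] ↦ ‖u_x‖² / (2 ‖u‖²)` on `M_1`. -/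
def projectiveHamiltonian (p : levelPoints circleStructure 1) : ℝ :=
  1 / 2 * (‖weakDeriv p.1.rep‖ ^ 2 / ‖p.1.rep‖ ^ 2)

/-- The coefficients of `σ_a`: `a² - n²` for `n < a` and `a² - (n+1)²` for `n ≥ a`. -/
def sigmaCoeff (a n : ℤ) : ℝ := if n < a then (a : ℝ) ^ 2 - (n : ℝ) ^ 2
  else (a : ℝ) ^ 2 - ((n : ℝ) + 1) ^ 2

/-- The Fourier multiplier `σ_a : X^1 → X`. -/
def sigmaOp (a : ℤ) :
    LevelMap (sobolevWeight.scale.nonneg.shift 1) sobolevWeight.scale.nonneg :=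
  sobolevWeight.multiplier fun n => (sigmaCoeff a n : ℂ)

end

/-! Three mechanisms carry the theorem.

Scale calculus. Maps that are smooth on every level are sc-smooth (`IsLevelSmooth.isScSmooth`),
which covers transition maps and bounded linear families. The flow of a strongly continuous group of
isometries on every level is in general not levelwise smooth, because its generator loses one level.
Its tangent map, however, is the flow of the tangent group after a levelwise smooth shear, so
induction and the chain rule `IsScDeriv.comp` give sc-smoothness (`ScGroup.isScSmooth_flow`). The
chain rule rests on compactness of the bonding maps.

Projective space. Each line with nonzero entry at `a` has exactly one unit vector whose entry at `a`
is positive, and `darbouxMap` deletes that entry. The inverse reinserts √(1 - ‖y‖²). A transition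
map is therefore insertion at `a`, multiplication by a phase, and deletion at `b`. Insertion
followed by deletion alters only finitely many entries, so it is bounded on every level, for
arbitrary weights; the two scalars are smooth functions of the level-zero norm and of one entry. The
deleted entries are real and thus invisible to the imaginary part of the pairing, and rotating unit
vectors by phases preserves that part on tangent vectors of the sphere (`im_inner_phase_smul`).
Hence transitions are symplectic. Nondegeneracy of the form then makes every chart induce a
bijection from tangent space to `X_0` (`ScTangent.mk_injective`).

Schrödinger flow. The mode `k` rotates by e^{-itk²}. The chart divides out the phase of the mode
`a`, so the flow becomes the linear unitary group e^{itσ_a} in each chart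
(`circleChart_projectiveFlow`), with generator iσ_a. Weak derivatives correspond to multiplication
of Fourier coefficients by `in`. As the modulus of the missing mode is determined by the unit norm,
the Hamiltonian is the quadratic function (a² - ⟨σ_a x, x⟩)/2
(`representsFunction_localHamiltonian`). Since σ_a is real, its derivative is -Re⟨σ_a x, ·⟩ = -ω(·,
iσ_a x), which is the Hamiltonian equation. -/

noncomputable section

/-! ## Scale calculus: levels, sc-derivatives and the chain rule -/

namespace ScaleSystem

section Levels

variable {X Y Z : ScaleSystem ℕ}

theorem bond_bond {I : Type} [Preorder I] (X : ScaleSystem I) {q r s : I} (h : q ≤ r) (h' : r ≤ s)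
    (x : X.level s) : X.bond h (X.bond h' x) = X.bond (h.trans h') x := by
  rw [← X.bond_comp h h']; rfl

theorem bond_refl {I : Type} [Preorder I] (X : ScaleSystem I) {s : I} (h : s ≤ s)
    (x : X.level s) : X.bond h x = x := by
  rw [show X.bond h = ContinuousLinearMap.id ℝ _ from X.bond_self s]; rfl

theorem isOpen_levelSet {U : Set (X.level 0)} (hU : IsOpen U) (m : ℕ) : IsOpen (levelSet U m) :=
  hU.preimage (X.bond _).continuous

theorem isOpen_shiftSet {U : Set (X.level 0)} (hU : IsOpen U) : IsOpen (shiftSet U) :=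
  isOpen_levelSet hU _

theorem isOpen_tangentSet {U : Set (X.level 0)} (hU : IsOpen U) : IsOpen (tangentSet U) :=
  (isOpen_shiftSet hU).preimage continuous_fst

theorem bond_mem_levelSet {U : Set (X.level 0)} {r s : ℕ} (h : r ≤ s) {x : X.level s} :
    X.bond h x ∈ levelSet U r ↔ x ∈ levelSet U s := by
  simp only [levelSet, mem_preimage, bond_bond]

theorem mem_levelSet_zero {U : Set (X.level 0)} {x : X.level 0} : x ∈ levelSet U 0 ↔ x ∈ U := by
  simp only [levelSet, mem_preimage, bond_refl]

theorem mem_levelSet_shiftSet {U : Set (X.level 0)} {m : ℕ} {x : (X.shift 1).level m} :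
    x ∈ levelSet (X := X.shift 1) (shiftSet U) m ↔ x ∈ levelSet U (m + 1) :=
  bond_mem_levelSet (X := X) (Nat.add_le_add_right (Nat.zero_le m) 1)

theorem mem_levelSet_tangentSet {U : Set (X.level 0)} {m : ℕ} {z : X.tangent.level m} :
    z ∈ levelSet (X := X.tangent) (tangentSet U) m ↔ z.1 ∈ levelSet U (m + 1) :=
  mem_levelSet_shiftSet (X := X)

theorem levelSet_mono {U U' : Set (X.level 0)} (h : U' ⊆ U) (m : ℕ) :
    levelSet U' m ⊆ levelSet U m :=
  preimage_mono h

theorem tangentSet_mono {U U' : Set (X.level 0)} (h : U' ⊆ U) : tangentSet U' ⊆ tangentSet U :=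
  fun _ hz => levelSet_mono h _ hz

theorem IsSc0.mono {U U' : Set (X.level 0)} (h : U' ⊆ U) {f : LevelMap X Y} (hf : IsSc0 U f) :
    IsSc0 U' f where
  compat r s hrs x hx := hf.compat r s hrs x (levelSet_mono h s hx)
  cont m := (hf.cont m).mono (levelSet_mono h m)

theorem IsScDeriv.mono {U U' : Set (X.level 0)} (h : U' ⊆ U) {f : LevelMap X Y}
    {Df : LevelMap X.tangent Y} (hf : IsScDeriv U f Df) : IsScDeriv U' f Df where
  sc0 := hf.sc0.mono (tangentSet_mono h)
  linear m x hx := hf.linear m x (levelSet_mono h _ hx)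
  frechet x hx := hf.frechet x (levelSet_mono h _ hx)

theorem IsSc0.bond_zero {U : Set (X.level 0)} {f : LevelMap X Y} (hf : IsSc0 U f) {m : ℕ}
    {x : X.level m} (hx : x ∈ levelSet U m) :
    Y.bond (Nat.zero_le m) (f m x) = f 0 (X.bond (Nat.zero_le m) x) :=
  (hf.compat 0 m _ x hx).symm

theorem IsSc0.mem_levelSet {U : Set (X.level 0)} {V : Set (Y.level 0)} {f : LevelMap X Y}
    (hf : IsSc0 U f) (hUV : MapsTo (f 0) U V) {m : ℕ} {x : X.level m} (hx : x ∈ levelSet U m) :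
    f m x ∈ levelSet V m := by
  change Y.bond _ _ ∈ V
  rw [hf.bond_zero hx]
  exact hUV hx

theorem IsSc0.comp {U : Set (X.level 0)} {V : Set (Y.level 0)} {f : LevelMap X Y}
    {g : LevelMap Y Z} (hg : IsSc0 V g) (hf : IsSc0 U f) (hUV : MapsTo (f 0) U V) :
    IsSc0 U (fun m x => g m (f m x)) where
  compat r s h x hx := by
    rw [hf.compat r s h x hx, hg.compat r s h _ (hf.mem_levelSet hUV hx)]
  cont m := (hg.cont m).comp (hf.cont m) fun _ hx => hf.mem_levelSet hUV hx

/-- The sc-derivative at a point of level `m + 1` as a continuous linear map. -/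
def IsScDeriv.toCLM {U : Set (X.level 0)} {f : LevelMap X Y} {Df : LevelMap X.tangent Y}
    (hf : IsScDeriv U f Df) {m : ℕ} {x : X.level (m + 1)} (hx : x ∈ levelSet U (m + 1)) :
    X.level m →L[ℝ] Y.level m where
  toLinearMap := (hf.linear m x hx).mk' _
  cont := by
    have h := (hf.sc0.cont m).comp_continuous (f := fun v : X.level m => ((x, v) : X.tangent.level m))
      (by fun_prop) (fun v => mem_levelSet_tangentSet.2 hx)
    exact h

theorem IsScDeriv.toCLM_apply {U : Set (X.level 0)} {f : LevelMap X Y} {Df : LevelMap X.tangent Y}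
    (hf : IsScDeriv U f Df) {m : ℕ} {x : X.level (m + 1)} (hx : x ∈ levelSet U (m + 1))
    (v : X.level m) : hf.toCLM hx v = Df m (x, v) := rfl

theorem IsScDeriv.hasFDerivAt {U : Set (X.level 0)} {f : LevelMap X Y} {Df : LevelMap X.tangent Y}
    (hf : IsScDeriv U f Df) {x : X.level (0 + 1)} (hx : x ∈ levelSet U (0 + 1)) :
    HasFDerivAt (fun x' : X.level (0 + 1) => f 0 (X.bond (Nat.zero_le _) x'))
      ((hf.toCLM hx).comp (X.bond (Nat.zero_le (0 + 1)))) x := by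
  rw [hasFDerivAt_iff_isLittleO_nhds_zero]
  exact hf.frechet x hx

theorem IsScDeriv.sc0_tangentMap {U : Set (X.level 0)} {f : LevelMap X Y}
    {Df : LevelMap X.tangent Y} (hf0 : IsSc0 U f) (hf : IsScDeriv U f Df) :
    IsSc0 (tangentSet U) (tangentMap f Df) where
  compat r s h z hz := Prod.ext
    (hf0.compat (r + 1) (s + 1) (Nat.add_le_add_right h 1) z.1 (mem_levelSet_tangentSet.1 hz))
    (hf.sc0.compat r s h z hz)
  cont m := ContinuousOn.prodMk
    ((hf0.cont (m + 1)).comp continuous_fst.continuousOn fun _ hz => mem_levelSet_tangentSet.1 hz)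
    (hf.sc0.cont m)

theorem mapsTo_tangentMap {U : Set (X.level 0)} {V : Set (Y.level 0)} {f : LevelMap X Y}
    (Df : LevelMap X.tangent Y) (hf : IsSc0 U f) (hUV : MapsTo (f 0) U V) :
    MapsTo (tangentMap f Df 0) (tangentSet U) (tangentSet V) :=
  fun _ hz => hf.mem_levelSet hUV hz

end Levels

/-! ### The chain rule and uniqueness of sc-derivatives. -/

section ChainRule

variable {X Y Z : ScaleSystem ℕ}

/-- Uniform control of the sc-derivative in directions near a compact set. -/
theorem IsScDeriv.exists_uniform {V : Set (Y.level 0)} (hV : IsOpen V) {g : LevelMap Y Z}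
    {Dg : LevelMap Y.tangent Z} (hg : IsScDeriv V g Dg) {y : Y.level (0 + 1)}
    (hy : y ∈ levelSet V (0 + 1)) {K : Set (Y.level 0)} (hK : IsCompact K) {ε : ℝ} (hε : 0 < ε) :
    ∃ ρ > 0, ∃ δ > 0, Metric.ball y ρ ⊆ levelSet V (0 + 1) ∧ ∀ y' ∈ Metric.ball y ρ,
      ∀ w ∈ Metric.thickening δ K, ‖Dg 0 (y', w) - Dg 0 (y, w)‖ < ε := by
  have hc : ContinuousOn (Dg 0) {z : Y.level (0 + 1) × Y.level 0 | z.1 ∈ levelSet V (0 + 1)} :=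
    (hg.sc0.cont 0).mono fun z hz => mem_levelSet_tangentSet.2 hz
  have hO : IsOpen {z : Y.level (0 + 1) × Y.level 0 | z.1 ∈ levelSet V (0 + 1)} :=
    (isOpen_levelSet hV _).preimage continuous_fst
  have hc2 : ContinuousOn (fun z : Y.level (0 + 1) × Y.level 0 => Dg 0 z - Dg 0 (y, z.2))
      {z | z.1 ∈ levelSet V (0 + 1)} :=
    hc.sub (hc.comp (Continuous.continuousOn (by fun_prop)) fun z _ => hy)
  have hO2 := hc2.isOpen_inter_preimage hO (Metric.isOpen_ball (x := (0 : Z.level 0)) (ε := ε))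
  -- The difference vanishes on `{y} × K`; the tube lemma shrinks its neighbourhood to a product.
  -- Only joint continuity of `Dg` is used, not continuity in operator norm.
  obtain ⟨N, W, hN, hW, hyN, hKW, hNW⟩ := generalized_tube_lemma (isCompact_singleton (x := y)) hK
    hO2 (by
      rintro ⟨y', w⟩ ⟨h1, -⟩
      obtain rfl : y' = y := h1
      refine ⟨hy, ?_⟩
      simpa using hε)
  obtain ⟨ρ, hρ, hρN⟩ := Metric.isOpen_iff.1 (hN.inter (isOpen_levelSet hV (0 + 1))) y
    ⟨hyN rfl, hy⟩
  obtain ⟨δ, hδ, hδW⟩ := hK.exists_thickening_subset_open hW hKW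
  refine ⟨ρ, hρ, δ, hδ, fun z hz => (hρN hz).2, fun y' hy' w hw => ?_⟩
  have := (hNW (mk_mem_prod (hρN hy').1 (hδW hw))).2
  simpa using this

/-- `Dg` need not be continuous in operator norm, so the classical argument fails. Compactness of
`X_1 → X_0` replaces it: the increments of `f`, divided by `‖h‖` and read on level zero, approach a
compact set of directions, and near such a set `Dg` is uniformly close to its value at `y`. -/
theorem IsScDeriv.comp {U : Set (X.level 0)} {V : Set (Y.level 0)} {f : LevelMap X Y}
    {g : LevelMap Y Z} {Df : LevelMap X.tangent Y} {Dg : LevelMap Y.tangent Z}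
    (hX : IsCompactOperator (X.bond (Nat.zero_le (0 + 1)))) (hU : IsOpen U) (hV : IsOpen V)
    (hf0 : IsSc0 U f) (hf : IsScDeriv U f Df) (hg : IsScDeriv V g Dg) (hUV : MapsTo (f 0) U V) :
    IsScDeriv U (fun m x => g m (f m x)) (fun m z => Dg m (tangentMap f Df m z)) where
  sc0 := hg.sc0.comp (hf.sc0_tangentMap hf0) (mapsTo_tangentMap Df hf0 hUV)
  linear m x hx := ((hg.toCLM (hf0.mem_levelSet hUV hx)).comp (hf.toCLM hx)).toLinearMap.isLinear
  frechet x hx := by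
    set y : Y.level (0 + 1) := f (0 + 1) x with hy_def
    have hy : y ∈ levelSet V (0 + 1) := hf0.mem_levelSet hUV hx
    set A : X.level 0 →L[ℝ] Y.level 0 := hf.toCLM hx
    set L : Y.level 0 →L[ℝ] Z.level 0 := hg.toCLM hy
    set β := X.bond (Nat.zero_le (0 + 1)) with hβ
    set k : X.level (0 + 1) → Y.level (0 + 1) := fun h => f (0 + 1) (x + h) - y with hk_def
    set r : X.level (0 + 1) → Y.level 0 := fun h => Y.bond (Nat.zero_le _) (k h) - A (β h)
      with hr_def
    have hev : ∀ᶠ h in 𝓝 (0 : X.level (0 + 1)), x + h ∈ levelSet U (0 + 1) :=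
      ((continuous_const.add continuous_id).continuousAt (x := (0 : X.level (0 + 1)))).preimage_mem_nhds
        ((isOpen_levelSet hU (0 + 1)).mem_nhds (by simpa using hx))
    have hk0 : Tendsto k (𝓝 0) (𝓝 0) := by
      have h1 : ContinuousAt (f (0 + 1)) (x + 0) := by
        rw [add_zero]
        exact (hf0.cont (0 + 1)).continuousAt ((isOpen_levelSet hU (0 + 1)).mem_nhds hx)
      have h2 : Tendsto (fun h => f (0 + 1) (x + h)) (𝓝 0) (𝓝 (f (0 + 1) (x + 0))) :=
        h1.tendsto.comp ((continuous_const.add continuous_id).tendsto 0)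
      simpa [hk_def, hy_def] using h2.sub_const y
    have hr : r =o[𝓝 0] fun h => h := by
      refine (hf.frechet x hx).congr' ?_ EventuallyEq.rfl
      filter_upwards [hev] with h hh
      simp only [hr_def, hk_def, hy_def, map_sub]
      rw [hf0.bond_zero hh, hf0.bond_zero hx]
      rfl
    -- This is where compactness of the bonding map enters: `A ∘ β` sends the unit ball of `X_1`
    -- into a compact set.
    obtain ⟨K, hK, hKs⟩ : ∃ K : Set (Y.level 0), IsCompact K ∧
        ∀ v : X.level (0 + 1), ‖v‖ ≤ 1 → A (β v) ∈ K := by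
      obtain ⟨K, hK, hKs⟩ := IsCompactOperator.image_subset_compact_of_bounded
        (f := ((A.comp β : X.level (0 + 1) →L[ℝ] Y.level 0) : X.level (0 + 1) →ₗ[ℝ] Y.level 0))
        (hX.clm_comp A) (Metric.isBounded_closedBall (x := (0 : X.level (0 + 1))) (r := 1))
      exact ⟨K, hK, fun v hv => hKs (mem_image_of_mem (f := fun v => A (β v)) (by simpa using hv))⟩
    rw [Asymptotics.isLittleO_iff]
    intro c hc
    obtain ⟨ρ, hρ, δ, hδ, hball, hunif⟩ := hg.exists_uniform hV hy hK (half_pos hc)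
    have hLr : (fun h => L (r h)) =o[𝓝 0] fun h => h :=
      (L.isBigO_comp r _).trans_isLittleO hr
    filter_upwards [hev, hk0 (Metric.ball_mem_nhds 0 hρ), (Asymptotics.isLittleO_iff.1 hr) (half_pos hδ),
      (Asymptotics.isLittleO_iff.1 hLr) (half_pos hc)] with h hh hkρ hrδ hLrc
    -- The error splits into the error of `g` for the true increment `k h`, and `L` applied to the
    -- error `r h` of `f`.
    have hgoal : g 0 (f 0 (X.bond (Nat.zero_le _) (x + h))) - g 0 (f 0 (X.bond (Nat.zero_le _) x))
          - Dg 0 (tangentMap f Df 0 (x, X.bond (Nat.zero_le _) h))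
        = (g 0 (Y.bond (Nat.zero_le _) (y + k h)) - g 0 (Y.bond (Nat.zero_le _) y)
          - L (Y.bond (Nat.zero_le _) (k h))) + L (r h) := by
      have e1 : f 0 (X.bond (Nat.zero_le _) (x + h)) = Y.bond (Nat.zero_le (0 + 1)) (y + k h) := by
        rw [← hf0.bond_zero hh]; simp [hk_def]
      have e2 : f 0 (X.bond (Nat.zero_le _) x) = Y.bond (Nat.zero_le (0 + 1)) y :=
        (hf0.bond_zero hx).symm
      have e3 : Dg 0 (tangentMap f Df 0 (x, X.bond (Nat.zero_le _) h)) = L (A (β h)) := rfl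
      rw [e1, e2, e3, hr_def]
      simp only [map_sub]
      abel
    rw [hgoal]
    rcases eq_or_ne h 0 with rfl | hne
    · have hk00 : k 0 = 0 := by simp [hk_def, hy_def]
      simp [hk00, hr_def]
    have hpos : 0 < ‖h‖ := norm_pos_iff.2 hne
    -- The nearby point of `K` is `A (β (h / ‖h‖))`, at distance `‖r h‖ / ‖h‖ ≤ δ / 2`.
    have hw : ‖h‖⁻¹ • Y.bond (Nat.zero_le _) (k h) ∈ Metric.thickening δ K := by
      refine Metric.mem_thickening_iff.2 ⟨A (β (‖h‖⁻¹ • h)), hKs _ ?_, ?_⟩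
      · rw [norm_smul, norm_inv, norm_norm, inv_mul_cancel₀ hpos.ne']
      · rw [dist_eq_norm, map_smul, map_smul, ← smul_sub, norm_smul, norm_inv, norm_norm,
          inv_mul_lt_iff₀ hpos]
        calc ‖r h‖ ≤ δ / 2 * ‖h‖ := hrδ
          _ < ‖h‖ * δ := by nlinarith
    have hseg : ∀ s ∈ Icc (0 : ℝ) 1, y + s • k h ∈ Metric.ball y ρ := by
      intro s hs
      have : ‖k h‖ < ρ := by simpa using hkρ
      rw [Metric.mem_ball, dist_eq_norm, add_sub_cancel_left, norm_smul, Real.norm_eq_abs,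
        abs_of_nonneg hs.1]
      nlinarith [norm_nonneg (k h), hs.2]
    -- Mean value inequality along the segment from `y` to `y + k h` in `Y_1`, with the linear part
    -- at `y` subtracted. By homogeneity, its derivative is `‖h‖` times a difference of values of
    -- `Dg` in a direction near `K`.
    set j : ℝ → Z.level 0 := fun s => g 0 (Y.bond (Nat.zero_le _) (y + s • k h))
      - s • L (Y.bond (Nat.zero_le _) (k h)) with hj
    have hjd : ∀ s ∈ Icc (0 : ℝ) 1, HasDerivWithinAt j
        (Dg 0 (y + s • k h, Y.bond (Nat.zero_le _) (k h)) - L (Y.bond (Nat.zero_le _) (k h)))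
        (Icc 0 1) s := by
      intro s hs
      have h1 := hg.hasFDerivAt (hball (hseg s hs))
      have h2 : HasDerivAt (fun s : ℝ => y + s • k h) (k h) s := by
        simpa using ((hasDerivAt_id s).smul_const (k h)).const_add y
      have h3 : HasDerivAt (fun s : ℝ => s • L (Y.bond (Nat.zero_le _) (k h)))
          (L (Y.bond (Nat.zero_le _) (k h))) s := by
        simpa using (hasDerivAt_id s).smul_const (L (Y.bond (Nat.zero_le _) (k h)))
      exact ((h1.comp_hasDerivAt s h2).sub h3).hasDerivWithinAt
    have hbd : ∀ s ∈ Ico (0 : ℝ) 1, ‖Dg 0 (y + s • k h, Y.bond (Nat.zero_le _) (k h))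
        - L (Y.bond (Nat.zero_le _) (k h))‖ ≤ c / 2 * ‖h‖ := by
      intro s hs
      have hs' := hseg s ⟨hs.1, hs.2.le⟩
      have h1 := (hunif _ hs' _ hw).le
      have h2 : Dg 0 (y + s • k h, Y.bond (Nat.zero_le _) (k h))
          - L (Y.bond (Nat.zero_le _) (k h)) = ‖h‖ • (Dg 0 (y + s • k h,
            ‖h‖⁻¹ • Y.bond (Nat.zero_le _) (k h)) -
            Dg 0 (y, ‖h‖⁻¹ • Y.bond (Nat.zero_le _) (k h))) := by
        rw [← hg.toCLM_apply (hball hs'), ← hg.toCLM_apply (hball hs'), ← hg.toCLM_apply hy,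
          map_smul, map_smul, ← smul_sub, smul_smul, mul_inv_cancel₀ hpos.ne', one_smul]
      rw [h2, norm_smul, norm_norm, mul_comm]
      exact mul_le_mul_of_nonneg_right h1 hpos.le
    have hmv := norm_image_sub_le_of_norm_deriv_le_segment_01' hjd hbd
    have hj1 : j 1 - j 0 = g 0 (Y.bond (Nat.zero_le _) (y + k h)) - g 0 (Y.bond (Nat.zero_le _) y)
          - L (Y.bond (Nat.zero_le _) (k h)) := by
      simp only [hj, one_smul, zero_smul, add_zero, sub_zero]
      abel
    rw [hj1] at hmv
    calc _ ≤ c / 2 * ‖h‖ + c / 2 * ‖h‖ := (norm_add_le _ _).trans (add_le_add hmv hLrc)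
      _ = c * ‖h‖ := by ring

/-- Two sc-derivatives of the same map agree. -/
theorem IsScDeriv.unique {U : Set (X.level 0)} {f f' : LevelMap X Y}
    {Df Df' : LevelMap X.tangent Y} (hX : DenseRange (X.bond (Nat.zero_le (0 + 1)))) (hU : IsOpen U)
    (hf : IsScDeriv U f Df) (hf' : IsScDeriv U f' Df') (hff : EqOn (f 0) (f' 0) U)
    {x : X.level (0 + 1)} (hx : x ∈ levelSet U (0 + 1)) (v : X.level 0) :
    Df 0 (x, v) = Df' 0 (x, v) := by
  have h1 := hf.hasFDerivAt hx
  have h2 := hf'.hasFDerivAt hx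
  have h3 : (fun x' : X.level (0 + 1) => f 0 (X.bond (Nat.zero_le _) x')) =ᶠ[𝓝 x]
      fun x' => f' 0 (X.bond (Nat.zero_le _) x') := by
    filter_upwards [(isOpen_levelSet hU (0 + 1)).mem_nhds hx] with x' hx'
    exact hff hx'
  have h4 := h1.unique (h2.congr_of_eventuallyEq h3)
  -- The Fréchet derivatives see only directions from `X_1`; density of `X_1` in `X_0` and
  -- continuity determine the rest.
  have h5 : (hf.toCLM hx : X.level 0 → Y.level 0) = hf'.toCLM hx :=
    hX.equalizer (hf.toCLM hx).continuous (hf'.toCLM hx).continuous (by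
      funext w
      exact congrArg (fun T => T w) h4)
  exact congrFun h5 v

end ChainRule

end ScaleSystem

end

noncomputable section

/-! ## Compositions of sc-maps, levelwise smooth maps, isometric groups -/

namespace ScaleSystem

section Composition

variable {X Y Z : ScaleSystem ℕ}

/-- The bonding maps between consecutive levels are compact. -/
def HasCompactBonds (X : ScaleSystem ℕ) : Prop :=
  ∀ m, IsCompactOperator (X.bond (Nat.le_add_right m 1))

theorem HasCompactBonds.shift (hX : X.HasCompactBonds) (k : ℕ) : (X.shift k).HasCompactBonds := by
  intro m
  -- The levels `m + 1 + k` and `m + k + 1` agree only propositionally, hence the generalization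
  -- over `n`.
  have : ∀ n (h : m + k ≤ n), n = m + k + 1 → IsCompactOperator (X.bond h) := by
    rintro n h rfl
    exact hX (m + k)
  exact this _ _ (by omega)

theorem HasCompactBonds.prod (hX : X.HasCompactBonds) (hY : Y.HasCompactBonds) :
    (X.prod Y).HasCompactBonds := by
  intro m
  obtain ⟨K, hK, hKX⟩ := hX m
  obtain ⟨L, hL, hLY⟩ := hY m
  exact ⟨K ×ˢ L, hK.prod hL, prod_mem_nhds hKX hLY⟩

theorem HasCompactBonds.tangent (hX : X.HasCompactBonds) : X.tangent.HasCompactBonds :=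
  (hX.shift 1).prod hX

theorem hasCompactBonds_realLine : realLine.HasCompactBonds :=
  fun _ => ⟨Metric.closedBall 0 1, isCompact_closedBall _ _, Metric.closedBall_mem_nhds _ one_pos⟩

theorem IsSc.mono {k : ℕ} : ∀ {X Y : ScaleSystem ℕ} {U U' : Set (X.level 0)} {f : LevelMap X Y},
    U' ⊆ U → IsSc k U f → IsSc k U' f := by
  induction k with
  | zero => exact fun h hf => IsSc0.mono h hf
  | succ k ih =>
    rintro X Y U U' f h ⟨hf0, Df, hDf, hT⟩
    exact ⟨hf0.mono h, Df, hDf.mono h, ih (tangentSet_mono h) hT⟩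

theorem IsScSmooth.mono {U U' : Set (X.level 0)} {f : LevelMap X Y} (h : U' ⊆ U)
    (hf : IsScSmooth U f) : IsScSmooth U' f :=
  fun k => (hf k).mono h

/-- With the derivative from the chain rule, `T(g ∘ f) = Tg ∘ Tf` holds by definition, and
compactness of the bonds passes to the tangent scale, so the induction closes. -/
theorem IsSc.comp {k : ℕ} : ∀ {X Y Z : ScaleSystem ℕ} {U : Set (X.level 0)} {V : Set (Y.level 0)}
    {f : LevelMap X Y} {g : LevelMap Y Z}, X.HasCompactBonds → IsOpen U → IsOpen V →
    IsSc k V g → IsSc k U f → MapsTo (f 0) U V → IsSc k U (fun m x => g m (f m x)) := by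
  induction k with
  | zero => exact fun _ _ _ hg hf hUV => IsSc0.comp hg hf hUV
  | succ k ih =>
    rintro X Y Z U V f g hX hU hV ⟨hg0, Dg, hDg, hTg⟩ ⟨hf0, Df, hDf, hTf⟩ hUV
    exact ⟨hg0.comp hf0 hUV, _, IsScDeriv.comp (hX 0) hU hV hf0 hDf hDg hUV,
      ih (f := tangentMap f Df) (g := tangentMap g Dg) hX.tangent (isOpen_tangentSet hU)
        (isOpen_tangentSet hV) hTg hTf (mapsTo_tangentMap Df hf0 hUV)⟩

end Composition

/-! ### Maps that are smooth on every level. -/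

section LevelSmooth

open scoped ContDiff

variable {X Y : ScaleSystem ℕ}

/-- Scale maps that are smooth on every level. -/
structure IsLevelSmooth (U : Set (X.level 0)) (f : LevelMap X Y) : Prop where
  compat : ∀ (r s : ℕ) (h : r ≤ s), ∀ x ∈ levelSet U s, f r (X.bond h x) = Y.bond h (f s x)
  smooth : ∀ m, ContDiffOn ℝ ∞ (f m) (levelSet U m)

/-- The levelwise derivative. -/
def levelDeriv (f : LevelMap X Y) : LevelMap X.tangent Y :=
  fun m z => fderiv ℝ (f m) (X.bond (Nat.le_add_right m 1) z.1) z.2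

variable {U : Set (X.level 0)} {f : LevelMap X Y}

theorem IsLevelSmooth.isSc0 (hf : IsLevelSmooth U f) : IsSc0 U f where
  compat := hf.compat
  cont m := (hf.smooth m).continuousOn

theorem IsLevelSmooth.contDiffOn_levelDeriv (hU : IsOpen U) (hf : IsLevelSmooth U f) (m : ℕ) :
    ContDiffOn ℝ ∞ (levelDeriv f m) (levelSet (X := X.tangent) (tangentSet U) m) := by
  have h1 : ContDiffOn ℝ ∞ (fderiv ℝ (f m)) (levelSet U m) :=
    (hf.smooth m).fderiv_of_isOpen (isOpen_levelSet hU m) (by simp)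
  have h2 : ContDiffOn ℝ ∞ (fun z : X.level (m + 1) × X.level m =>
      fderiv ℝ (f m) (X.bond (Nat.le_add_right m 1) z.1))
      (levelSet (X := X.tangent) (tangentSet U) m) :=
    h1.comp (((X.bond (Nat.le_add_right m 1)).contDiff.comp contDiff_fst).contDiffOn)
      fun z hz => (bond_mem_levelSet _).2 (mem_levelSet_tangentSet.1 hz)
  exact h2.clm_apply contDiff_snd.contDiffOn

/-- Differentiating `f_r ∘ bond = bond ∘ f_s` and comparing the two derivatives gives compatibility.
-/
theorem IsLevelSmooth.levelDeriv_compat (hU : IsOpen U) (hf : IsLevelSmooth U f) (r s : ℕ)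
    (h : r ≤ s) (z : X.tangent.level s) (hz : z ∈ levelSet (X := X.tangent) (tangentSet U) s) :
    levelDeriv f r (X.tangent.bond h z) = Y.bond h (levelDeriv f s z) := by
  obtain ⟨x, v⟩ := z
  have hx : X.bond (Nat.le_add_right s 1) x ∈ levelSet U s :=
    (bond_mem_levelSet _).2 (mem_levelSet_tangentSet.1 hz)
  set x' := X.bond (Nat.le_add_right s 1) x with hx'
  have e : X.bond (Nat.le_add_right r 1) (X.bond (Nat.add_le_add_right h 1) x) = X.bond h x' := by
    rw [hx', bond_bond, bond_bond]
  have d1 : HasFDerivAt (f s) (fderiv ℝ (f s) x') x' :=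
    (((hf.smooth s).contDiffAt ((isOpen_levelSet hU s).mem_nhds hx)).differentiableAt
      (by simp)).hasFDerivAt
  have d2 : HasFDerivAt (f r) (fderiv ℝ (f r) (X.bond h x')) (X.bond h x') :=
    (((hf.smooth r).contDiffAt ((isOpen_levelSet hU r).mem_nhds
      ((bond_mem_levelSet h).2 hx))).differentiableAt (by simp)).hasFDerivAt
  have d3 := d2.comp x' (X.bond h).hasFDerivAt
  have d4 := (Y.bond h).hasFDerivAt.comp x' d1
  have hev : (fun y => f r (X.bond h y)) =ᶠ[𝓝 x'] fun y => Y.bond h (f s y) := by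
    filter_upwards [(isOpen_levelSet hU s).mem_nhds hx] with y hy
    exact hf.compat r s h y hy
  have d5 := d3.unique (d4.congr_of_eventuallyEq hev)
  have d6 := congrArg (fun T => T v) d5
  change fderiv ℝ (f r) (X.bond (Nat.le_add_right r 1) (X.bond (Nat.add_le_add_right h 1) x))
    (X.bond h v) = Y.bond h (fderiv ℝ (f s) x' v)
  rw [e]
  exact d6

theorem IsLevelSmooth.isScDeriv (hU : IsOpen U) (hf : IsLevelSmooth U f) :
    IsScDeriv U f (levelDeriv f) where
  sc0 := ⟨hf.levelDeriv_compat hU, fun m => (hf.contDiffOn_levelDeriv hU m).continuousOn⟩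
  linear m x _ := (fderiv ℝ (f m) (X.bond (Nat.le_add_right m 1) x)).toLinearMap.isLinear
  frechet x hx := by
    have hx0 : X.bond (Nat.zero_le (0 + 1)) x ∈ levelSet U 0 := (bond_mem_levelSet _).2 hx
    have d := (((hf.smooth 0).contDiffAt ((isOpen_levelSet hU 0).mem_nhds hx0)).differentiableAt
      (by simp)).hasFDerivAt
    have d2 := d.comp x (X.bond (Nat.zero_le (0 + 1))).hasFDerivAt
    exact (hasFDerivAt_iff_isLittleO_nhds_zero.1 d2)

theorem IsLevelSmooth.tangentMap (hU : IsOpen U) (hf : IsLevelSmooth U f) :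
    IsLevelSmooth (tangentSet U) (tangentMap f (levelDeriv f)) where
  compat r s h z hz := Prod.ext
    (hf.compat (r + 1) (s + 1) (Nat.add_le_add_right h 1) z.1 (mem_levelSet_tangentSet.1 hz))
    (hf.levelDeriv_compat hU r s h z hz)
  smooth m := ContDiffOn.prodMk
    ((hf.smooth (m + 1)).comp contDiff_fst.contDiffOn fun _ hz => mem_levelSet_tangentSet.1 hz)
    (hf.contDiffOn_levelDeriv hU m)

/-- The class is closed under the tangent map, so induction over all scales at once suffices. -/
theorem IsLevelSmooth.isSc (k : ℕ) : ∀ {X Y : ScaleSystem ℕ} {U : Set (X.level 0)}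
    {f : LevelMap X Y}, IsOpen U → IsLevelSmooth U f → IsSc k U f := by
  induction k with
  | zero => exact fun _ hf => hf.isSc0
  | succ k ih => exact fun hU hf => ⟨hf.isSc0, _, hf.isScDeriv hU,
      ih (isOpen_tangentSet hU) (hf.tangentMap hU)⟩

theorem IsLevelSmooth.isScSmooth (hU : IsOpen U) (hf : IsLevelSmooth U f) : IsScSmooth U f :=
  fun k => hf.isSc k hU

/-- Compatible families of continuous linear maps are levelwise smooth. -/
theorem isLevelSmooth_of_clm (U : Set (X.level 0)) (L : ∀ m, X.level m →L[ℝ] Y.level m)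
    (hL : ∀ (r s : ℕ) (h : r ≤ s) x, L r (X.bond h x) = Y.bond h (L s x)) :
    IsLevelSmooth U (fun m x => L m x) where
  compat r s h x _ := hL r s h x
  smooth m := (L m).contDiff.contDiffOn

end LevelSmooth

/-- A strongly continuous group of isometries on every level of a scale, with generator
`A : Y^1 → Y`. -/
structure ScGroup (Y : ScaleSystem ℕ) where
  S : ℝ → ∀ m, Y.level m →L[ℝ] Y.level m
  A : ∀ m, Y.level (m + 1) →L[ℝ] Y.level m
  bond_S : ∀ t {r s : ℕ} (h : r ≤ s) y, S t r (Y.bond h y) = Y.bond h (S t s y)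
  bond_A : ∀ {r s : ℕ} (h : r ≤ s) y,
    A r (Y.bond (Nat.add_le_add_right h 1) y) = Y.bond h (A s y)
  norm_S : ∀ t m y, ‖S t m y‖ = ‖y‖
  cont_S : ∀ m y, Continuous fun t => S t m y
  deriv : ∀ m t y, HasDerivAt (fun t => S t m (Y.bond (Nat.le_add_right m 1) y)) (S t m (A m y)) t

/-! ### Flows of groups of isometries. -/

namespace ScGroup

open scoped ContDiff

variable {Y : ScaleSystem ℕ} (𝒮 : ScGroup Y)

/-- The diagonal group on the tangent scale. -/
def tangent : ScGroup Y.tangent where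
  S t m := (𝒮.S t (m + 1)).prodMap (𝒮.S t m)
  A m := (𝒮.A (m + 1)).prodMap (𝒮.A m)
  bond_S t _ _ h y := Prod.ext (𝒮.bond_S t (Nat.add_le_add_right h 1) y.1) (𝒮.bond_S t h y.2)
  bond_A h y := Prod.ext (𝒮.bond_A (Nat.add_le_add_right h 1) y.1) (𝒮.bond_A h y.2)
  norm_S t m y := by
    change max ‖𝒮.S t (m + 1) y.1‖ ‖𝒮.S t m y.2‖ = max ‖y.1‖ ‖y.2‖
    rw [𝒮.norm_S, 𝒮.norm_S]
  cont_S m y := (𝒮.cont_S (m + 1) y.1).prodMk (𝒮.cont_S m y.2)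
  deriv m t y := (𝒮.deriv (m + 1) t y.1).prodMk (𝒮.deriv m t y.2)

/-- The flow `(t, y) ↦ S_t y`. -/
def flow : LevelMap (realLine.prod Y) Y := fun m z => 𝒮.S z.1 m z.2

/-- The derivative of the flow. -/
def flowDeriv : LevelMap (realLine.prod Y).tangent Y :=
  fun m z => 𝒮.S z.1.1 m (z.2.2 + z.2.1 • 𝒮.A m z.1.2)

/-- Strong continuity upgrades to joint continuity because the operators are isometries, uniformly
in time. -/
theorem continuous_flow (m : ℕ) : Continuous (𝒮.flow m) := by
  rw [continuous_iff_continuousAt]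
  rintro ⟨t₀, y₀⟩
  change Tendsto _ _ _
  rw [tendsto_iff_norm_sub_tendsto_zero]
  have h1 : Tendsto (fun z : ℝ × Y.level m => ‖z.2 - y₀‖ + ‖𝒮.S z.1 m y₀ - 𝒮.S t₀ m y₀‖)
      (𝓝 (t₀, y₀)) (𝓝 0) := by
    have hc : Continuous fun z : ℝ × Y.level m =>
        ‖z.2 - y₀‖ + ‖𝒮.S z.1 m y₀ - 𝒮.S t₀ m y₀‖ := by
      have := (𝒮.cont_S m y₀).comp (continuous_fst (X := ℝ) (Y := Y.level m))
      simp only [Function.comp_def] at this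
      fun_prop
    simpa using hc.tendsto (t₀, y₀)
  refine squeeze_zero (fun _ => norm_nonneg _) (fun z => ?_) h1
  have : 𝒮.flow m z - 𝒮.flow m (t₀, y₀) =
      𝒮.S z.1 m (z.2 - y₀) + (𝒮.S z.1 m y₀ - 𝒮.S t₀ m y₀) := by
    simp only [flow, map_sub]; abel
  rw [this]
  exact (norm_add_le _ _).trans_eq (by rw [𝒮.norm_S])

theorem isSc0_flow : IsSc0 univ 𝒮.flow where
  compat _ _ h z _ := 𝒮.bond_S z.1 h z.2
  cont m := (𝒮.continuous_flow m).continuousOn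

/-- The velocity of an orbit starting in level `m + 1` has the constant norm `‖A y‖`. -/
theorem norm_S_sub_le (m : ℕ) (t s : ℝ) (y : Y.level (m + 1)) :
    ‖𝒮.S (t + s) m (Y.bond (Nat.le_add_right m 1) y) - 𝒮.S t m (Y.bond (Nat.le_add_right m 1) y)‖
      ≤ ‖𝒮.A m y‖ * ‖s‖ := by
  have h := Convex.norm_image_sub_le_of_norm_hasDerivWithin_le (s := univ)
    (fun x _ => (𝒮.deriv m x y).hasDerivWithinAt) (fun x _ => (𝒮.norm_S x m (𝒮.A m y)).le)
    convex_univ (mem_univ t) (mem_univ (t + s))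
  simpa using h

/-- The increment splits into a pure time increment at `y ∈ Y_1`, differentiable by assumption on
the group, and a mixed term in time and space, which is bounded by `‖A‖ ‖z‖²` and hence negligible.
-/
theorem isScDeriv_flow : IsScDeriv univ 𝒮.flow 𝒮.flowDeriv where
  sc0 :=
    { compat := fun r s h z _ => by
        change 𝒮.S z.1.1 r (Y.bond h z.2.2 +
          z.2.1 • 𝒮.A r (Y.bond (Nat.add_le_add_right h 1) z.1.2)) = Y.bond h (𝒮.S _ _ _)
        rw [← 𝒮.bond_S, 𝒮.bond_A h, map_add (Y.bond h), map_smul (Y.bond h)]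
      cont := fun m => by
        have h1 : Continuous fun z : (ℝ × Y.level (m + 1)) × (ℝ × Y.level m) =>
            ((z.1.1, z.2.2 + z.2.1 • 𝒮.A m z.1.2) : ℝ × Y.level m) := by fun_prop
        exact ((𝒮.continuous_flow m).comp h1).continuousOn }
  linear m x _ :=
    { map_add := fun v w => by
        simp only [flowDeriv, ← map_add, Prod.fst_add, Prod.snd_add, add_smul]
        congr 1; abel
      map_smul := fun c v => by
        simp only [flowDeriv, ← map_smul, Prod.smul_fst, Prod.smul_snd, smul_add, smul_smul,
          smul_eq_mul] }
  frechet x _ := by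
    obtain ⟨t, y⟩ := x
    set β := Y.bond (Nat.le_add_right 0 1) with hβ
    have h1 : (fun s : ℝ => 𝒮.S (t + s) 0 (β y) - 𝒮.S t 0 (β y) - s • 𝒮.S t 0 (𝒮.A 0 y))
        =o[𝓝 0] fun s => s := by
      simpa using (hasDerivAt_iff_isLittleO_nhds_zero.1 (𝒮.deriv 0 t y))
    have h2 : (fun z : ℝ × Y.level (0 + 1) => 𝒮.S (t + z.1) 0 (β y) - 𝒮.S t 0 (β y)
        - z.1 • 𝒮.S t 0 (𝒮.A 0 y)) =o[𝓝 0] fun z => z := by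
      have h3 := h1.comp_tendsto (k := fun z : ℝ × Y.level (0 + 1) => z.1) (l' := 𝓝 0)
        (by simpa using (continuous_fst (X := ℝ) (Y := Y.level (0 + 1))).tendsto 0)
      exact h3.trans_isBigO (Asymptotics.isBigO_fst_prod')
    have h3 : (fun z : ℝ × Y.level (0 + 1) => 𝒮.S (t + z.1) 0 (β z.2) - 𝒮.S t 0 (β z.2))
        =o[𝓝 0] fun z => z := by
      have h4 : (fun z : ℝ × Y.level (0 + 1) => 𝒮.S (t + z.1) 0 (β z.2) - 𝒮.S t 0 (β z.2))
          =O[𝓝 0] fun z => ‖z‖ * ‖z‖ := by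
        refine Asymptotics.IsBigO.of_bound ‖𝒮.A 0‖ (Eventually.of_forall fun z => ?_)
        rw [norm_mul, norm_norm]
        calc _ ≤ ‖𝒮.A 0 z.2‖ * ‖z.1‖ := 𝒮.norm_S_sub_le 0 t z.1 z.2
          _ ≤ (‖𝒮.A 0‖ * ‖z‖) * ‖z‖ := by
            gcongr
            · exact ((𝒮.A 0).le_opNorm _).trans (by gcongr; exact norm_snd_le z)
            · exact norm_fst_le z
          _ = _ := by ring
      refine h4.trans_isLittleO ?_
      have h5 : (fun z : ℝ × Y.level (0 + 1) => ‖z‖) =o[𝓝 0] fun _ => (1 : ℝ) := by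
        rw [Asymptotics.isLittleO_one_iff]
        simpa using (continuous_norm (E := ℝ × Y.level (0 + 1))).tendsto 0
      have h6 := h5.mul_isBigO
        (Asymptotics.isBigO_refl (fun z : ℝ × Y.level (0 + 1) => ‖z‖) (𝓝 0))
      simp only [one_mul] at h6
      exact Asymptotics.isLittleO_norm_right.1 h6
    refine (h2.add h3).congr' (Eventually.of_forall fun z => ?_) EventuallyEq.rfl
    change _ = 𝒮.S (t + z.1) 0 (β (y + z.2)) - 𝒮.S t 0 (β y) - 𝒮.S t 0 (β z.2 + z.1 • 𝒮.A 0 y)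
    simp only [map_add, map_smul]
    abel

/-- The shear `(t, y, s, v) ↦ (t, (y, v + s A y))`, which relates the tangent map of the flow to
the flow of the tangent group. -/
def shear : LevelMap (realLine.prod Y).tangent (realLine.prod Y.tangent) :=
  fun m z => (z.1.1, (z.1.2, z.2.2 + z.2.1 • 𝒮.A m z.1.2))

theorem isLevelSmooth_shear : IsLevelSmooth univ 𝒮.shear where
  compat r s h z _ := by
    refine Prod.ext rfl (Prod.ext rfl ?_)
    change Y.bond h z.2.2 + z.2.1 • 𝒮.A r (Y.bond (Nat.add_le_add_right h 1) z.1.2)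
      = Y.bond h (z.2.2 + z.2.1 • 𝒮.A s z.1.2)
    rw [𝒮.bond_A, map_add, map_smul]
  smooth m := by
    have : ContDiff ℝ ∞ fun z : (ℝ × Y.level (m + 1)) × (ℝ × Y.level m) =>
        (z.1.1, (z.1.2, z.2.2 + z.2.1 • 𝒮.A m z.1.2)) := by fun_prop
    exact this.contDiffOn

/-- The tangent map sends `(t, y, s, v)` to `(S_t y, S_t (v + s A y))`: it is the flow of
`𝒮.tangent` after `𝒮.shear`. The induction must therefore range over all groups and scales. -/
theorem isSc_flow (k : ℕ) : ∀ {Y : ScaleSystem ℕ} (𝒮 : ScGroup Y), Y.HasCompactBonds →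
    IsSc k univ 𝒮.flow := by
  induction k with
  | zero => exact fun 𝒮 _ => 𝒮.isSc0_flow
  | succ k ih =>
    intro Y 𝒮 hY
    refine ⟨𝒮.isSc0_flow, _, 𝒮.isScDeriv_flow, ?_⟩
    have h := IsSc.comp (hasCompactBonds_realLine.prod hY).tangent isOpen_univ isOpen_univ
      (ih 𝒮.tangent hY.tangent) (𝒮.isLevelSmooth_shear.isSc k isOpen_univ) (mapsTo_univ _ _)
    exact h.mono (subset_univ _)

theorem isScSmooth_flow (hY : Y.HasCompactBonds) : IsScSmooth univ 𝒮.flow :=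
  fun k => isSc_flow k 𝒮 hY

end ScGroup

end ScaleSystem

end

noncomputable section

/-! ## The weighted sequence spaces -/

namespace ScaleWeight

variable {W : ScaleWeight} {s t : ℤ}

theorem ofSeq_entry {x : ℤ → ℂ} (hx : x ∈ W.seqSubmodule s) : (W.ofSeq s x).entry = x := by
  simp [ofSeq, hx]

theorem ofSeq_self (x : W.Seq s) : W.ofSeq s x.entry = x :=
  Seq.ext (ofSeq_entry x.mem)

theorem Seq.entry_sub (x y : W.Seq s) : (x - y).entry = x.entry - y.entry := rfl

theorem Seq.entry_zero : (0 : W.Seq s).entry = 0 := rfl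

theorem mem_seqSubmodule_of_finite {x : ℤ → ℂ} (hx : {n | x n ≠ 0}.Finite) :
    x ∈ W.seqSubmodule s := by
  have h0 : Memℓp (fun n => ((W.ν n ^ s : ℝ) : ℂ) * x n) 0 := by
    rw [memℓp_zero_iff]
    exact hx.subset fun n hn h => hn (by simp [h])
  exact h0.of_exponent_ge zero_le

theorem mem_seqSubmodule_of_finite_ne {x y : ℤ → ℂ} (hx : {n | x n ≠ y n}.Finite)
    (hy : y ∈ W.seqSubmodule s) : x ∈ W.seqSubmodule s := by
  have h : x - y ∈ W.seqSubmodule s :=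
    mem_seqSubmodule_of_finite (hx.subset fun n hn h => hn (by simp [h]))
  simpa using add_mem h hy

/-- A bounded multiplier from `l^{2,s}` to `l^{2,t}`. -/
theorem mem_seqSubmodule_of_le {x y : ℤ → ℂ} {C : ℝ}
    (h : ∀ n, W.ν n ^ t * ‖x n‖ ≤ C * (W.ν n ^ s * ‖y n‖)) (hy : y ∈ W.seqSubmodule s) :
    x ∈ W.seqSubmodule t := by
  have hy' : Memℓp (fun n => ((W.ν n ^ s : ℝ) : ℂ) * y n) 2 := hy
  refine (hy'.const_smul (C : ℂ)).mono' fun n => ?_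
  simp only [Pi.smul_apply, norm_smul, norm_mul, Complex.norm_real, Real.norm_eq_abs,
    abs_of_pos (zpow_pos (W.pos n) _)]
  exact (h n).trans (mul_le_mul_of_nonneg_right (le_abs_self C)
    (mul_nonneg (zpow_pos (W.pos n) _).le (norm_nonneg _)))

theorem norm_le_of_entry_le {x : W.Seq t} {y : W.Seq s} {C : ℝ} (hC : 0 ≤ C)
    (h : ∀ n, W.ν n ^ t * ‖x.entry n‖ ≤ C * (W.ν n ^ s * ‖y.entry n‖)) : ‖x‖ ≤ C * ‖y‖ := by
  have key : ‖W.toL2 t x‖ ≤ ‖(C : ℂ) • W.toL2 s y‖ := by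
    refine lp.norm_mono two_ne_zero fun n => ?_
    rw [lp.coeFn_smul, Pi.smul_apply, toL2_apply, toL2_apply]
    simp only [norm_smul, norm_mul, Complex.norm_real, Real.norm_eq_abs,
      abs_of_pos (zpow_pos (W.pos n) _), abs_of_nonneg hC]
    exact h n
  rwa [norm_smul, norm_toL2, norm_toL2, Complex.norm_real, Real.norm_eq_abs, abs_of_nonneg hC]
    at key

theorem norm_eq_of_norm_entry_eq {x y : W.Seq s} (h : ∀ n, ‖x.entry n‖ = ‖y.entry n‖) :
    ‖x‖ = ‖y‖ := by
  refine le_antisymm ?_ ?_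
  · simpa using norm_le_of_entry_le (x := x) (y := y) zero_le_one fun n => by rw [h, one_mul]
  · simpa using norm_le_of_entry_le (x := y) (y := x) zero_le_one fun n => by rw [h, one_mul]

/-- The isometry of `l^{2,s}` onto `l²`. -/
def l2Equiv (W : ScaleWeight) (s : ℤ) : W.Seq s ≃ₗᵢ[ℂ] lp (fun _ : ℤ => ℂ) 2 :=
  { LinearEquiv.ofBijective (W.toL2 s) (W.toL2_bijective s) with
    norm_map' := fun x => W.norm_toL2 s x }

theorem l2Equiv_apply (x : W.Seq s) (n : ℤ) :
    W.l2Equiv s x n = ((W.ν n ^ s : ℝ) : ℂ) * x.entry n := rfl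

theorem l2Equiv_zero_apply (x : W.Seq ((0 : ℕ) : ℤ)) (n : ℤ) :
    W.l2Equiv ((0 : ℕ) : ℤ) x n = x.entry n := by
  simp [l2Equiv_apply]

theorem continuous_entry (n : ℤ) : Continuous fun x : W.Seq s => x.entry n := by
  have h1 : Continuous fun x : W.Seq s => W.l2Equiv s x n :=
    (lp.evalCLM ℂ (fun _ : ℤ => ℂ) 2 n).continuous.comp (W.l2Equiv s).continuous
  have h2 : (fun x : W.Seq s => x.entry n) =
      fun x => ((W.ν n ^ s : ℝ) : ℂ)⁻¹ * W.l2Equiv s x n := by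
    funext x
    rw [l2Equiv_apply, inv_mul_cancel_left₀ (W.weight_ne s n)]
  rw [h2]
  exact continuous_const.mul h1

/-- The entries, as continuous functionals. -/
def entryCLM (W : ScaleWeight) (s n : ℤ) : W.Seq s →L[ℝ] ℂ where
  toFun x := x.entry n
  map_add' _ _ := rfl
  map_smul' c x := by simp [Seq.entry_real_smul]
  cont := continuous_entry n

theorem entryCLM_apply (n : ℤ) (x : W.Seq s) : W.entryCLM s n x = x.entry n := rfl

theorem ext_entryCLM {x y : W.Seq s} (h : ∀ n, x.entry n = y.entry n) : x = y :=
  Seq.ext (funext h)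

/-- By the closed graph theorem, a linear map into `l^{2,s}` with continuous entries is
continuous. -/
def clmOfEntry {F : Type*} [NormedAddCommGroup F] [NormedSpace ℝ F] [CompleteSpace F]
    (f : F →ₗ[ℝ] W.Seq s) (h : ∀ n, Continuous fun v => (f v).entry n) : F →L[ℝ] W.Seq s where
  toLinearMap := f
  cont := by
    -- A limit in `l^{2,s}` is determined by its entries, which are continuous on both sides, so the
    -- graph is closed.
    refine LinearMap.continuous_of_seq_closed_graph f fun u x y hu hy => ext_entryCLM fun n => ?_
    have h1 := ((continuous_entry n).tendsto y).comp hy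
    have h2 := ((h n).tendsto x).comp hu
    exact tendsto_nhds_unique h1 h2

/-- A sequence supported at one index. -/
def single (W : ScaleWeight) (s n : ℤ) (c : ℂ) : W.Seq s :=
  ⟨Pi.single n c, mem_seqSubmodule_of_finite ((finite_singleton n).subset fun k hk => by
    by_contra h
    exact hk (Pi.single_eq_of_ne (by simpa using h) _))⟩

theorem single_entry (n : ℤ) (c : ℂ) : (W.single s n c).entry = Pi.single n c := rfl

theorem hasSum_single (x : W.Seq s) : HasSum (fun n => W.single s n (x.entry n)) x := by
  have h := lp.hasSum_single (p := 2) (by simp) (W.l2Equiv s x)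
  have h2 := h.map (W.l2Equiv s).symm (W.l2Equiv s).symm.continuous
  rw [LinearIsometryEquiv.symm_apply_apply] at h2
  convert h2 using 1
  funext n
  apply (W.l2Equiv s).injective
  ext k
  simp only [Function.comp_apply, LinearIsometryEquiv.apply_symm_apply, l2Equiv_apply, single_entry,
    lp.single_apply]
  by_cases hk : k = n
  · subst hk; simp
  · simp [hk]

theorem finite_ne_zero_sum_single (F : Finset ℤ) (x : ℤ → ℂ) :
    {n | (∑ k ∈ F, (W.single s k (x k))).entry n ≠ 0}.Finite := by
  refine F.finite_toSet.subset fun n hn => ?_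
  by_contra h
  apply hn
  change W.entryCLM s n _ = 0
  rw [map_sum]
  refine Finset.sum_eq_zero fun k hk => ?_
  rw [entryCLM_apply, single_entry]
  exact Pi.single_eq_of_ne (by rintro rfl; exact h hk) _

/-- Finitely supported sequences are dense. -/
theorem dense_finite : Dense {x : W.Seq s | {n | x.entry n ≠ 0}.Finite} := fun x =>
  mem_closure_of_tendsto (hasSum_single x)
    (Eventually.of_forall fun F => finite_ne_zero_sum_single F x.entry)

/-! ### The axioms of a Banach scale: density and compactness. -/

theorem scale_bond_entry {r s : ℤ} (h : r ≤ s) (x : W.Seq s) :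
    (W.scale.bond h x).entry = x.entry := W.incl_entry h x

theorem nonneg_bond_entry {r s : ℕ} (h : r ≤ s) (x : W.scale.nonneg.level s) :
    (W.scale.nonneg.bond h x).entry = x.entry := W.incl_entry _ x

/-- A finitely supported sequence lies in every level, so it defines a constant family in the limit.
-/
theorem dense_scale_limit (s : ℤ) : Dense ((fun x : ∀ t, W.scale.level t => x s) '' W.scale.limit) := by
  refine dense_finite.mono ?_
  intro x hx
  refine ⟨fun t => ⟨x.entry, mem_seqSubmodule_of_finite hx⟩, fun r s h => ?_, rfl⟩
  exact Seq.ext (scale_bond_entry h _)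

/-- The map factors through the finite-dimensional space `ℂ`. -/
theorem isCompactOperator_single_entry (r s n : ℤ) :
    IsCompactOperator fun x : W.Seq s => W.single r n (x.entry n) := by
  let f : ℂ →ₗ[ℝ] W.Seq r :=
    { toFun := W.single r n
      map_add' := fun c d => Seq.ext (by simp [single_entry, Seq.entry_add, Pi.single_add])
      map_smul' := fun c d => Seq.ext (by
        simp only [single_entry, Seq.entry_real_smul, RingHom.id_apply]
        ext k
        by_cases hk : k = n
        · subst hk; simp
        · simp [hk]) }
  have h1 : IsCompactOperator (f.toContinuousLinearMap : ℂ → W.Seq r) := by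
    refine ⟨f.toContinuousLinearMap '' Metric.closedBall 0 1,
      (isCompact_closedBall _ _).image f.toContinuousLinearMap.continuous, ?_⟩
    exact mem_of_superset (Metric.closedBall_mem_nhds _ one_pos) fun z hz => mem_image_of_mem _ hz
  exact h1.comp_clm (W.entryCLM s n)

/-- The inclusion is the operator-norm limit of its truncations to finite index sets, since the
weight ratio `ν_n^(r - s)` tends to zero. -/
theorem isCompactOperator_incl {r s : ℤ} (h : r < s) : IsCompactOperator (W.incl h.le) := by
  let f : ℂ → ℤ → W.Seq r := fun c n => W.single r n c
  let T : Finset ℤ → W.Seq s →L[ℝ] W.Seq r := fun F => clmOfEntry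
    { toFun := fun x => ∑ n ∈ F, W.single r n (x.entry n)
      map_add' := fun x y => by
        rw [← Finset.sum_add_distrib]
        refine Finset.sum_congr rfl fun n _ => Seq.ext ?_
        simp [single_entry, Seq.entry_add, Pi.single_add]
      map_smul' := fun c x => by
        simp only [RingHom.id_apply]
        rw [Finset.smul_sum]
        refine Finset.sum_congr rfl fun n _ => Seq.ext ?_
        simp only [single_entry, Seq.entry_real_smul]
        ext k
        by_cases hk : k = n
        · subst hk; simp
        · simp [hk] } (fun n => by
      have : (fun x : W.Seq s => (∑ k ∈ F, W.single r k (x.entry k)).entry n) =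
          fun x => ∑ k ∈ F, (Pi.single k (x.entry k) : ℤ → ℂ) n := by
        funext x
        change W.entryCLM r n _ = _
        rw [map_sum]
        rfl
      change Continuous fun x : W.Seq s => (∑ k ∈ F, W.single r k (x.entry k)).entry n
      rw [this]
      refine continuous_finsetSum _ fun k _ => ?_
      by_cases hk : n = k
      · subst hk; simpa using continuous_entry n
      · simpa [hk] using continuous_const)
  have hT : ∀ F x n, (T F x).entry n = if n ∈ F then x.entry n else 0 := by
    intro F x n
    change W.entryCLM r n (∑ k ∈ F, W.single r k (x.entry k)) = _
    rw [map_sum]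
    simp only [entryCLM_apply, single_entry, Pi.single_apply]
    simp
  have hTc : ∀ F, IsCompactOperator (T F) := by
    intro F
    have h1 : (T F : W.Seq s → W.Seq r) = ∑ n ∈ F, fun x : W.Seq s => W.single r n (x.entry n) := by
      funext x
      rw [Finset.sum_apply]
      rfl
    rw [h1]
    refine Finset.sum_induction _ (fun g : W.Seq s → W.Seq r => IsCompactOperator g)
      (fun _ _ => IsCompactOperator.add) ?_ fun n _ => isCompactOperator_single_entry r s n
    exact isCompactOperator_zero
  refine isCompactOperator_of_tendsto (F := T) (l := atTop) ?_ (Eventually.of_forall hTc)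
  rw [Metric.tendsto_nhds]
  intro ε hε
  have hlim : Tendsto (fun n => W.ν n ^ (r - s)) cofinite (𝓝 0) :=
    (tendsto_zpow_atTop_zero (by omega)).comp W.tendsto
  have hfin : {n | ¬ W.ν n ^ (r - s) < ε / 2}.Finite :=
    hlim.eventually (gt_mem_nhds (half_pos hε))
  -- Once `F` contains the finitely many indices with large weight ratio, the truncation error has
  -- norm at most `ε / 2`.
  filter_upwards [eventually_ge_atTop hfin.toFinset] with F hF
  rw [dist_eq_norm]
  refine (ContinuousLinearMap.opNorm_le_bound _ (half_pos hε).le fun x => ?_).trans_lt (half_lt_self hε)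
  refine norm_le_of_entry_le (half_pos hε).le fun n => ?_
  rw [_root_.sub_apply, Seq.entry_sub, Pi.sub_apply, hT, incl_entry]
  have hpos : 0 ≤ ε / 2 * (W.ν n ^ s * ‖x.entry n‖) :=
    mul_nonneg (half_pos hε).le (mul_nonneg (zpow_pos (W.pos n) _).le (norm_nonneg _))
  by_cases hn : n ∈ F
  · simpa [hn] using hpos
  · have h1 : W.ν n ^ (r - s) < ε / 2 := by
      by_contra h1
      exact hn (hF (hfin.mem_toFinset.2 h1))
    have e : W.ν n ^ r = W.ν n ^ (r - s) * W.ν n ^ s := by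
      rw [← zpow_add₀ (W.pos n).ne']; congr 1; ring
    simp only [hn, if_false, zero_sub, norm_neg]
    rw [e, mul_assoc]
    exact mul_le_mul_of_nonneg_right h1.le
      (mul_nonneg (zpow_pos (W.pos n) _).le (norm_nonneg _))

theorem isBanachScale_scale (W : ScaleWeight) : W.scale.IsBanachScale where
  injective r s h x y hxy := Seq.ext (by
    have := congrArg Seq.entry hxy
    rwa [scale_bond_entry, scale_bond_entry] at this)
  dense s := dense_scale_limit s
  compact r s h := isCompactOperator_incl h

theorem hasCompactBonds_nonneg (W : ScaleWeight) : W.scale.nonneg.HasCompactBonds :=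
  fun m => isCompactOperator_incl (by simp)

theorem dense_range_nonneg_bond {r s : ℕ} (h : r ≤ s) : DenseRange (W.scale.nonneg.bond h) := by
  refine dense_finite.mono ?_
  intro x hx
  exact ⟨⟨x.entry, mem_seqSubmodule_of_finite hx⟩, Seq.ext (nonneg_bond_entry h _)⟩

theorem nonneg_bond_injective {r s : ℕ} (h : r ≤ s) :
    Function.Injective (W.scale.nonneg.bond h) :=
  W.isBanachScale_scale.injective _ _ _

theorem mem_range_nonneg_bond {r s : ℕ} (h : r ≤ s) {x : W.scale.nonneg.level r} :
    x ∈ range (W.scale.nonneg.bond h) ↔ x.entry ∈ W.seqSubmodule (s : ℤ) := by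
  constructor
  · rintro ⟨y, rfl⟩
    rw [nonneg_bond_entry]
    exact y.mem
  · intro hx
    exact ⟨⟨x.entry, hx⟩, Seq.ext (nonneg_bond_entry h _)⟩

/-! ### The symplectic form -/

/-- The weights of dual levels cancel, so the pairing is the `l²` inner product of the rescaled
sequences. The order is reversed because `inner` is conjugate-linear in its first argument. -/
theorem pairing_eq_inner (h : s + t = 0) (x : W.Seq s) (y : W.Seq t) :
    W.pairing x y = inner ℂ (W.l2Equiv t y) (W.l2Equiv s x) := by
  rw [lp.inner_eq_tsum, pairing]
  refine tsum_congr fun n => ?_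
  have e : ((W.ν n ^ s : ℝ) : ℂ) * ((W.ν n ^ t : ℝ) : ℂ) = 1 := by
    rw [← Complex.ofReal_mul, ← zpow_add₀ (W.pos n).ne', h, zpow_zero, Complex.ofReal_one]
  rw [l2Equiv_apply, l2Equiv_apply, RCLike.inner_apply, map_mul, Complex.conj_ofReal]
  linear_combination (-(x.entry n * (starRingEnd ℂ) (y.entry n))) * e

theorem stdForm_eq_inner (h : s + t = 0) (x : W.Seq s) (y : W.Seq t) :
    W.stdForm s t h x y = -(inner ℂ (W.l2Equiv t y) (W.l2Equiv s x)).im := by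
  rw [stdForm, pairing_eq_inner h]

theorem lp_real_inner_eq (x y : lp (fun _ : ℤ => ℂ) 2) : inner ℝ x y = (inner ℂ x y).re :=
  (lp.hasSum_inner (𝕜 := ℝ) x y).unique (Complex.hasSum_re (lp.hasSum_inner (𝕜 := ℂ) x y))

theorem stdForm_eq_real_inner (h : s + t = 0) (x : W.Seq s) (y : W.Seq t) :
    W.stdForm s t h x y = inner ℝ (-(Complex.I • W.l2Equiv t y)) (W.l2Equiv s x) := by
  rw [stdForm_eq_inner, lp_real_inner_eq, inner_neg_left, inner_smul_left]
  simp

theorem isBoundedBilinearMap_stdForm (h : s + t = 0) :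
    IsBoundedBilinearMap ℝ (fun z : W.Seq s × W.Seq t => W.stdForm s t h z.1 z.2) where
  add_left x x' y := by simp [stdForm_eq_real_inner, inner_add_right]
  smul_left c x y := by
    have : W.l2Equiv s (c • x) = c • W.l2Equiv s x := (W.l2Equiv s).map_smul (c : ℂ) x
    rw [stdForm_eq_real_inner, this, inner_smul_right, stdForm_eq_real_inner, smul_eq_mul]
  add_right x y y' := by
    simp only [stdForm_eq_inner, map_add, inner_add_left, Complex.add_im]; ring
  smul_right c x y := by
    have : W.l2Equiv t (c • y) = (c : ℂ) • W.l2Equiv t y := (W.l2Equiv t).map_smul (c : ℂ) y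
    simp only [stdForm_eq_inner, this, inner_smul_left, Complex.conj_ofReal,
      Complex.im_ofReal_mul, smul_eq_mul]
    ring
  bound := by
    refine ⟨1, one_pos, fun x y => ?_⟩
    rw [stdForm_eq_real_inner, one_mul]
    refine (norm_inner_le_norm (𝕜 := ℝ) _ _).trans_eq ?_
    rw [norm_neg, norm_smul, Complex.norm_I, one_mul, (W.l2Equiv t).norm_map,
      (W.l2Equiv s).norm_map, mul_comm]

theorem stdForm_skew (h : s + t = 0) (h' : t + s = 0) (v : W.Seq s) (w : W.Seq t) :
    W.stdForm s t h v w = -W.stdForm t s h' w v := by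
  rw [stdForm_eq_inner, stdForm_eq_inner, ← inner_conj_symm, Complex.conj_im]

/-- The map `w ↦ ω(·, w)`. -/
def stdFormDual (W : ScaleWeight) (s : ℤ) : W.Seq s →L[ℝ] (W.Seq (-s) →L[ℝ] ℝ) :=
  (isBoundedBilinearMap_stdForm (W := W) (neg_add_cancel s)).toContinuousLinearMap.flip

theorem stdFormDual_apply (w : W.Seq s) (v : W.Seq (-s)) :
    W.stdFormDual s w v = W.stdForm (-s) s (neg_add_cancel s) v w := rfl

/-- Up to the isometries with `l²` and multiplication by `-i`, this is the Riesz isomorphism of the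
real Hilbert space `l²`. -/
theorem stdFormDual_bijective (s : ℤ) : Function.Bijective (W.stdFormDual s) := by
  constructor
  · rw [injective_iff_map_eq_zero]
    intro w hw
    have h1 : ∀ x, inner ℝ (-(Complex.I • W.l2Equiv s w)) x = 0 := by
      intro x
      have := congrArg (fun T => T ((W.l2Equiv (-s)).symm x)) hw
      simp only [stdFormDual_apply, stdForm_eq_real_inner,
        LinearIsometryEquiv.apply_symm_apply] at this
      exact this
    have h2 : -(Complex.I • W.l2Equiv s w) = 0 := inner_self_eq_zero.1 (h1 _)
    simpa using h2
  · intro L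
    set z := (InnerProductSpace.toDual ℝ (lp (fun _ : ℤ => ℂ) 2)).symm
      (L.comp ((W.l2Equiv (-s)).symm.toContinuousLinearEquiv.toContinuousLinearMap.restrictScalars ℝ))
      with hz
    -- The factor `i` is forced by `-(i · (i z)) = z`, where `z` is the Riesz vector of `L`.
    refine ⟨(W.l2Equiv s).symm (Complex.I • z), ?_⟩
    ext v
    rw [stdFormDual_apply, stdForm_eq_real_inner, LinearIsometryEquiv.apply_symm_apply, smul_smul,
      Complex.I_mul_I, neg_smul, one_smul, neg_neg, hz, InnerProductSpace.toDual_symm_apply]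
    exact congrArg L ((W.l2Equiv (-s)).symm_apply_apply v)

theorem isSymplectic_scale (W : ScaleWeight) : W.scale.IsSymplectic W.stdForm where
  bilinear s t h := isBoundedBilinearMap_stdForm h
  skew s t h h' v w := stdForm_skew h h' v w
  iso := by
    refine ⟨fun s => ContinuousLinearEquiv.ofBijective (W.stdFormDual s)
      (LinearMap.ker_eq_bot.2 (stdFormDual_bijective s).1)
      (LinearMap.range_eq_top.2 (stdFormDual_bijective s).2), fun s w v => rfl, ?_⟩
    intro r s h w
    ext v
    change -(W.pairing v (W.scale.bond h w)).im
      = -(W.pairing (W.scale.bond (neg_le_neg h) v) w).im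
    simp only [pairing, incl_entry]

end ScaleWeight

end

noncomputable section

open ScaleSystem

/-! ## Deleting and inserting an entry -/

theorem skip_injective (a : ℤ) : Function.Injective (skip a) := by
  intro m n h
  unfold skip at h
  split_ifs at h <;> omega

theorem skip_ne (a n : ℤ) : skip a n ≠ a := by
  unfold skip
  split_ifs <;> omega

theorem range_skip (a : ℤ) : range (skip a) = {a}ᶜ := by
  ext n
  simp only [mem_range, mem_compl_iff, mem_singleton_iff]
  constructor
  · rintro ⟨k, rfl⟩
    exact skip_ne a k
  · intro hn
    rcases lt_or_gt_of_ne hn with h | h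
    · exact ⟨n, by simp [skip, h]⟩
    · exact ⟨n - 1, by unfold skip; split_ifs <;> omega⟩

/-- The sequence with entry `z` at `a` and the entries of `y` at the other indices. -/
def insertEntry (a : ℤ) (z : ℂ) (y : ℤ → ℂ) (n : ℤ) : ℂ :=
  if n = a then z else if n < a then y n else y (n - 1)

theorem insertEntry_self (a : ℤ) (z : ℂ) (y : ℤ → ℂ) : insertEntry a z y a = z := if_pos rfl

theorem insertEntry_skip (a : ℤ) (z : ℂ) (y : ℤ → ℂ) (n : ℤ) :
    insertEntry a z y (skip a n) = y n := by
  rw [insertEntry, if_neg (skip_ne a n)]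
  unfold skip
  split_ifs
  · rfl
  · omega
  · congr 1; omega

theorem insertEntry_add (a : ℤ) (z z' : ℂ) (y y' : ℤ → ℂ) (n : ℤ) :
    insertEntry a (z + z') (y + y') n = insertEntry a z y n + insertEntry a z' y' n := by
  unfold insertEntry; split_ifs <;> rfl

theorem insertEntry_mul (a : ℤ) (c z : ℂ) (y : ℤ → ℂ) (n : ℤ) :
    insertEntry a (c * z) (c • y) n = c * insertEntry a z y n := by
  unfold insertEntry; split_ifs <;> rfl

theorem insertEntry_real_smul (a : ℤ) (c : ℝ) (z : ℂ) (y : ℤ → ℂ) (n : ℤ) :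
    insertEntry a (c • z) ((c : ℂ) • y) n = (c : ℂ) * insertEntry a z y n := by
  rw [Complex.real_smul, insertEntry_mul]

theorem ext_skip (a : ℤ) {x y : ℤ → ℂ} (h0 : x a = y a) (h : ∀ n, x (skip a n) = y (skip a n)) :
    x = y := by
  funext n
  by_cases hn : n = a
  · rw [hn, h0]
  · obtain ⟨k, rfl⟩ : n ∈ range (skip a) := by rw [range_skip]; exact hn
    exact h k

theorem insertEntry_skip_of_lt {a b n : ℤ} (ha : n < a) (hb : n < b) (z : ℂ) (y : ℤ → ℂ) :
    insertEntry a z y (skip b n) = y n := by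
  simp [skip, hb, insertEntry, ha, ha.ne]

theorem insertEntry_skip_of_le {a b n : ℤ} (ha : a ≤ n) (hb : b ≤ n) (z : ℂ) (y : ℤ → ℂ) :
    insertEntry a z y (skip b n) = y n := by
  have h1 : ¬ n < b := by omega
  have h2 : n + 1 ≠ a := by omega
  have h3 : ¬ n + 1 < a := by omega
  simp [skip, h1, insertEntry, h2, h3]

theorem summable_comp_skip {α : Type*} [NormedAddCommGroup α] (a : ℤ) (f : ℤ → α) :
    Summable (fun n => f (skip a n)) ↔ Summable f := by
  have h1 : Summable (Function.update f a 0) ↔ Summable f := by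
    refine summable_congr_cofinite ?_
    have : {a}ᶜ ∈ (cofinite : Filter ℤ) := (finite_singleton a).compl_mem_cofinite
    filter_upwards [this] with n hn
    exact Function.update_of_ne hn _ _
  rw [← h1, ← (skip_injective a).summable_iff (f := Function.update f a 0)]
  · refine summable_congr fun n => ?_
    exact (Function.update_of_ne (skip_ne a n) _ _).symm
  · intro n hn
    rw [range_skip, notMem_compl_iff] at hn
    rw [hn, Function.update_self]

theorem tsum_skip {α : Type*} [NormedAddCommGroup α] [CompleteSpace α] (a : ℤ) {f : ℤ → α}
    (hf : Summable f) : ∑' n, f n = f a + ∑' n, f (skip a n) := by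
  rw [hf.tsum_eq_add_tsum_ite a]
  congr 1
  rw [← (skip_injective a).tsum_eq]
  · refine tsum_congr fun n => if_neg (skip_ne a n)
  · intro n hn
    rw [range_skip]
    rintro rfl
    simp at hn

namespace ScaleWeight

variable {W : ScaleWeight}

theorem mem_seqSubmodule_zero {x : ℤ → ℂ} :
    x ∈ W.seqSubmodule ((0 : ℕ) : ℤ) ↔ Summable fun n => ‖x n‖ ^ 2 := by
  change Memℓp _ 2 ↔ _
  rw [memℓp_gen_iff (by simp)]
  simp

/-- On level zero all weights are `1`, so shifting indices is harmless for every `W`. -/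
theorem mem_seqSubmodule_zero_comp_skip (a : ℤ) (x : ℤ → ℂ) :
    (fun n => x (skip a n)) ∈ W.seqSubmodule ((0 : ℕ) : ℤ) ↔
      x ∈ W.seqSubmodule ((0 : ℕ) : ℤ) := by
  rw [mem_seqSubmodule_zero, mem_seqSubmodule_zero, summable_comp_skip a fun n => ‖x n‖ ^ 2]

theorem insertEntry_mem {a : ℤ} {z : ℂ} {y : ℤ → ℂ} (hy : y ∈ W.seqSubmodule ((0 : ℕ) : ℤ)) :
    insertEntry a z y ∈ W.seqSubmodule ((0 : ℕ) : ℤ) := by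
  rw [← mem_seqSubmodule_zero_comp_skip a]
  simpa only [insertEntry_skip] using hy

/-- Deletion of the entry at `a`. -/
def drop (W : ScaleWeight) (a : ℤ) : W.Seq ((0 : ℕ) : ℤ) →L[ℝ] W.Seq ((0 : ℕ) : ℤ) :=
  clmOfEntry
    { toFun := fun x => ⟨fun n => x.entry (skip a n), (mem_seqSubmodule_zero_comp_skip a _).2 x.mem⟩
      map_add' := fun _ _ => rfl
      map_smul' := fun _ _ => rfl } fun _ => continuous_entry _

theorem drop_entry (a : ℤ) (x : W.Seq ((0 : ℕ) : ℤ)) (n : ℤ) :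
    (W.drop a x).entry n = x.entry (skip a n) := rfl

theorem drop_smul (a : ℤ) (c : ℂ) (x : W.Seq ((0 : ℕ) : ℤ)) :
    W.drop a (c • x) = c • W.drop a x := rfl

theorem continuous_insertEntry {F : Type*} [TopologicalSpace F] {z : F → ℂ} {y : F → ℤ → ℂ}
    (hz : Continuous z) (hy : ∀ n, Continuous fun v => y v n) (a n : ℤ) :
    Continuous fun v => insertEntry a (z v) (y v) n := by
  unfold insertEntry
  split_ifs
  · exact hz
  · exact hy _
  · exact hy _

/-- Insertion of an entry at `a`. -/
def ins (W : ScaleWeight) (a : ℤ) : ℂ × W.Seq ((0 : ℕ) : ℤ) →L[ℝ] W.Seq ((0 : ℕ) : ℤ) :=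
  clmOfEntry
    { toFun := fun z => ⟨insertEntry a z.1 z.2.entry, insertEntry_mem z.2.mem⟩
      map_add' := fun _ _ => Seq.ext (funext fun _ => insertEntry_add _ _ _ _ _ _)
      map_smul' := fun c z => Seq.ext (funext fun n =>
        insertEntry_real_smul a c z.1 z.2.entry n) }
    fun n => continuous_insertEntry continuous_fst
      (fun k => (continuous_entry k).comp continuous_snd) a n

theorem ins_entry (a : ℤ) (z : ℂ × W.Seq ((0 : ℕ) : ℤ)) (n : ℤ) :
    (W.ins a z).entry n = insertEntry a z.1 z.2.entry n := rfl

theorem drop_ins (a : ℤ) (z : ℂ × W.Seq ((0 : ℕ) : ℤ)) : W.drop a (W.ins a z) = z.2 :=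
  ext_entryCLM fun n => by rw [drop_entry, ins_entry, insertEntry_skip]

/-- Outside the interval between `a` and `b` the shifts of insertion and deletion cancel, so only
finitely many entries change. The composite therefore acts on every level, although either operation
alone would require `ν_n` and `ν_{n+1}` to be comparable. -/
theorem insertEntry_skip_mem {s : ℤ} (a b : ℤ) (z : ℂ) {y : ℤ → ℂ} (hy : y ∈ W.seqSubmodule s) :
    (fun n => insertEntry a z y (skip b n)) ∈ W.seqSubmodule s := by
  refine mem_seqSubmodule_of_finite_ne ((finite_Icc (min a b) (max a b)).subset fun n hn => ?_) hy
  by_contra h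
  apply hn
  rw [mem_Icc, not_and_or, not_le, not_le, lt_min_iff, max_lt_iff] at h
  rcases h with h | h
  · exact insertEntry_skip_of_lt h.1 h.2 z y
  · exact insertEntry_skip_of_le h.1.le h.2.le z y

/-- Insertion of an entry at `a` followed by deletion of the entry at `b`, on any level. -/
def exchange (W : ScaleWeight) (a b s : ℤ) : ℂ × W.Seq s →L[ℝ] W.Seq s :=
  clmOfEntry
    { toFun := fun z => ⟨fun n => insertEntry a z.1 z.2.entry (skip b n),
        insertEntry_skip_mem a b z.1 z.2.mem⟩
      map_add' := fun _ _ => Seq.ext (funext fun _ => insertEntry_add _ _ _ _ _ _)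
      map_smul' := fun c z => Seq.ext (funext fun n =>
        insertEntry_real_smul a c z.1 z.2.entry (skip b n)) }
    fun n => continuous_insertEntry continuous_fst
      (fun k => (continuous_entry k).comp continuous_snd) a (skip b n)

/-- The entry at `b` after insertion of an entry at `a`. -/
def insertedEntry (W : ScaleWeight) (a b s : ℤ) : ℂ × W.Seq s →L[ℝ] ℂ where
  toFun z := insertEntry a z.1 z.2.entry b
  map_add' _ _ := insertEntry_add _ _ _ _ _ _
  map_smul' c z := (insertEntry_real_smul a c z.1 z.2.entry b).trans (Complex.real_smul).symm
  cont := continuous_insertEntry continuous_fst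
    (fun k => (continuous_entry k).comp continuous_snd) a b

theorem insertedEntry_apply (a b : ℤ) {s : ℤ} (z : ℂ × W.Seq s) :
    W.insertedEntry a b s z = insertEntry a z.1 z.2.entry b := rfl

theorem summable_pairing (x y : W.Seq ((0 : ℕ) : ℤ)) :
    Summable fun n => x.entry n * (starRingEnd ℂ) (y.entry n) := by
  have := (lp.hasSum_inner (𝕜 := ℂ) (W.l2Equiv _ y) (W.l2Equiv _ x)).summable
  simpa only [l2Equiv_zero_apply, RCLike.inner_apply] using this

theorem pairing_drop (a : ℤ) (x y : W.Seq ((0 : ℕ) : ℤ)) :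
    W.pairing x y = x.entry a * (starRingEnd ℂ) (y.entry a)
      + W.pairing (W.drop a x) (W.drop a y) :=
  tsum_skip a (summable_pairing x y)

theorem pairing_self (x : W.Seq ((0 : ℕ) : ℤ)) : W.pairing x x = ((‖x‖ ^ 2 : ℝ) : ℂ) := by
  rw [pairing_eq_inner (by simp), inner_self_eq_norm_sq_to_K, (W.l2Equiv _).norm_map]
  simp

theorem norm_sq_drop (a : ℤ) (x : W.Seq ((0 : ℕ) : ℤ)) :
    ‖x‖ ^ 2 = ‖x.entry a‖ ^ 2 + ‖W.drop a x‖ ^ 2 := by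
  have h := pairing_drop a x x
  rw [pairing_self, pairing_self, Complex.mul_conj, Complex.normSq_eq_norm_sq,
    ← Complex.ofReal_add] at h
  exact Complex.ofReal_injective h

end ScaleWeight

end

noncomputable section

open ScaleSystem

/-! ## The charts of projective space -/

namespace ScaleWeight

variable {W : ScaleWeight}

/-- The real entry that completes `y` to a unit vector. -/
def residual {s : ℤ} (y : W.Seq s) : ℝ := √(1 - ‖y‖ ^ 2)

/-- The unit vector with positive entry at `a` and remaining entries `y`. -/
def unitSection (W : ScaleWeight) (a : ℤ) (y : W.Seq ((0 : ℕ) : ℤ)) : W.Seq ((0 : ℕ) : ℤ) :=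
  W.ins a ((residual y : ℂ), y)

/-- The scalar `|z| / (z r)`. -/
def phase (z : ℂ) (r : ℝ) : ℂ := ((‖z‖ : ℝ) : ℂ) / (z * (r : ℂ))

/-- The chart map on vectors. -/
def darbouxMap (W : ScaleWeight) (a : ℤ) (x : W.Seq ((0 : ℕ) : ℤ)) : W.Seq ((0 : ℕ) : ℤ) :=
  phase (x.entry a) ‖x‖ • W.drop a x

/-- This homogeneity makes the chart map depend only on the line through a vector. -/
theorem phase_mul {c z : ℂ} {r : ℝ} (hc : c ≠ 0) :
    phase (c * z) (‖c‖ * r) * c = phase z r := by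
  have h1 : ((‖c‖ : ℝ) : ℂ) ≠ 0 := by simpa using hc
  unfold phase
  rw [norm_mul]
  push_cast
  rcases eq_or_ne z 0 with rfl | hz
  · simp
  rcases eq_or_ne r 0 with rfl | hr
  · simp
  have h2 : (r : ℂ) ≠ 0 := by simpa using hr
  field_simp

theorem norm_phase {z : ℂ} {r : ℝ} (hz : z ≠ 0) (hr : 0 < r) : ‖phase z r‖ = r⁻¹ := by
  have h1 : ‖z‖ ≠ 0 := by simpa using hz
  rw [phase, norm_div, norm_mul, Complex.norm_real, Complex.norm_real, norm_norm, Real.norm_eq_abs,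
    abs_of_pos hr]
  field_simp

theorem phase_mul_self {z : ℂ} {r : ℝ} (hz : z ≠ 0) :
    phase z r * z = ((‖z‖ / r : ℝ) : ℂ) := by
  rw [phase]
  push_cast
  rcases eq_or_ne r 0 with rfl | hr
  · simp
  have h2 : (r : ℂ) ≠ 0 := by simpa using hr
  field_simp

theorem phase_ofReal {r : ℝ} (hr : 0 < r) : phase r 1 = 1 := by
  have h2 : (r : ℂ) ≠ 0 := by simpa using hr.ne'
  rw [phase, Complex.norm_real, Real.norm_eq_abs, abs_of_pos hr, Complex.ofReal_one, mul_one,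
    div_self h2]

theorem darbouxMap_smul (a : ℤ) {c : ℂ} (hc : c ≠ 0) (x : W.Seq ((0 : ℕ) : ℤ)) :
    W.darbouxMap a (c • x) = W.darbouxMap a x := by
  rw [darbouxMap, darbouxMap, drop_smul, smul_smul, norm_smul, Seq.entry_smul, Pi.smul_apply,
    smul_eq_mul, phase_mul hc]

theorem residual_pos {y : W.Seq ((0 : ℕ) : ℤ)} (hy : y ∈ Metric.ball (0 : W.Seq ((0 : ℕ) : ℤ)) 1) :
    0 < residual y := by
  have h : ‖y‖ < 1 := by simpa using hy
  exact Real.sqrt_pos.2 (by nlinarith [norm_nonneg y])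

theorem section_entry_self (a : ℤ) (y : W.Seq ((0 : ℕ) : ℤ)) :
    (W.unitSection a y).entry a = (residual y : ℂ) := insertEntry_self _ _ _

theorem drop_section (a : ℤ) (y : W.Seq ((0 : ℕ) : ℤ)) : W.drop a (W.unitSection a y) = y :=
  drop_ins a _

theorem norm_section {a : ℤ} {y : W.Seq ((0 : ℕ) : ℤ)}
    (hy : y ∈ Metric.ball (0 : W.Seq ((0 : ℕ) : ℤ)) 1) : ‖W.unitSection a y‖ = 1 := by
  have h : ‖y‖ < 1 := by simpa using hy
  have h1 := norm_sq_drop a (W.unitSection a y)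
  rw [drop_section, section_entry_self, Complex.norm_real, Real.norm_eq_abs, sq_abs, residual,
    Real.sq_sqrt (by nlinarith [norm_nonneg y])] at h1
  exact (pow_eq_one_iff_of_nonneg (norm_nonneg _) two_ne_zero).1 (by linarith)

/-- This holds also outside the ball: a zero section would force `y = 0`, whose residual is `1`.
Hence `darbouxInv` can be a total function. -/
theorem section_ne_zero (a : ℤ) (y : W.Seq ((0 : ℕ) : ℤ)) : W.unitSection a y ≠ 0 := by
  intro h
  have h1 := drop_section a y
  rw [h, map_zero] at h1
  have h2 := section_entry_self a y
  rw [h, Seq.entry_zero, ← h1] at h2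
  simp [residual] at h2

theorem continuous_section (a : ℤ) : Continuous (W.unitSection a) := by
  refine (W.ins a).continuous.comp (Continuous.prodMk ?_ continuous_id)
  unfold residual
  fun_prop

theorem darbouxMap_section {a : ℤ} {y : W.Seq ((0 : ℕ) : ℤ)}
    (hy : y ∈ Metric.ball (0 : W.Seq ((0 : ℕ) : ℤ)) 1) : W.darbouxMap a (W.unitSection a y) = y := by
  rw [darbouxMap, drop_section, norm_section hy, section_entry_self, phase_ofReal (residual_pos hy),
    one_smul]

theorem norm_pos_of_entry {a : ℤ} {x : W.Seq ((0 : ℕ) : ℤ)} (hx : x.entry a ≠ 0) : 0 < ‖x‖ := by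
  refine norm_pos_iff.2 ?_
  rintro rfl
  exact hx rfl

/-- The mass missing from the unit norm is that of the deleted entry, so the residual recovers its
modulus. -/
theorem norm_sq_darbouxMap {a : ℤ} {x : W.Seq ((0 : ℕ) : ℤ)} (hx : x.entry a ≠ 0) :
    1 - ‖W.darbouxMap a x‖ ^ 2 = (‖x.entry a‖ / ‖x‖) ^ 2 := by
  have h0 := norm_pos_of_entry hx
  have h1 := norm_sq_drop a x
  rw [darbouxMap, norm_smul, norm_phase hx h0, mul_pow, inv_pow, div_pow]
  field_simp
  linarith

theorem darbouxMap_mem_ball {a : ℤ} {x : W.Seq ((0 : ℕ) : ℤ)} (hx : x.entry a ≠ 0) :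
    W.darbouxMap a x ∈ Metric.ball (0 : W.Seq ((0 : ℕ) : ℤ)) 1 := by
  have h1 := norm_sq_darbouxMap hx
  have h2 : 0 < (‖x.entry a‖ / ‖x‖) ^ 2 :=
    pow_pos (div_pos (norm_pos_iff.2 hx) (norm_pos_of_entry hx)) 2
  rw [mem_ball_zero_iff]
  nlinarith [norm_nonneg (W.darbouxMap a x)]

/-- The phase factor moves `x` to the unit vector on its line with positive entry at `a`, which is
the vector that the section reconstructs. -/
theorem section_darbouxMap {a : ℤ} {x : W.Seq ((0 : ℕ) : ℤ)} (hx : x.entry a ≠ 0) :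
    W.unitSection a (W.darbouxMap a x) = phase (x.entry a) ‖x‖ • x := by
  apply Seq.ext
  refine ext_skip a ?_ fun n => ?_
  · rw [section_entry_self, residual, norm_sq_darbouxMap hx, Real.sqrt_sq (by positivity),
      Seq.entry_smul, Pi.smul_apply, smul_eq_mul, phase_mul_self hx]
  · rw [← drop_entry, drop_section]
    rfl

theorem phase_ne_zero {a : ℤ} {x : W.Seq ((0 : ℕ) : ℤ)} (hx : x.entry a ≠ 0) :
    phase (x.entry a) ‖x‖ ≠ 0 := by
  have h0 := norm_pos_of_entry hx
  rw [← norm_pos_iff, norm_phase hx h0]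
  exact inv_pos.2 h0

theorem continuousOn_darbouxMap (a : ℤ) :
    ContinuousOn (W.darbouxMap a) {x | x.entry a ≠ 0} := by
  have h1 : ContinuousOn (fun x : W.Seq ((0 : ℕ) : ℤ) => phase (x.entry a) ‖x‖)
      {x | x.entry a ≠ 0} := by
    have h2 := continuous_entry (W := W) (s := ((0 : ℕ) : ℤ)) a
    unfold phase
    refine ContinuousOn.div (by fun_prop) (by fun_prop) fun x hx => ?_
    exact mul_ne_zero hx (by simpa using (norm_pos_of_entry hx).ne')
  exact h1.smul (W.drop a).continuous.continuousOn

end ScaleWeight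

/-! ### Inverse charts and the Hausdorff property of projective space. -/

section Projective

open ScaleWeight

variable {E : Type*} [NormedAddCommGroup E] [InnerProductSpace ℂ E] (b : HilbertBasis ℤ ℂ E)
  (W : ScaleWeight)

/-- The coefficients of a vector, on level zero of the scale. -/
def coeff : E ≃ₗᵢ[ℂ] W.Seq ((0 : ℕ) : ℤ) := b.repr.trans (W.l2Equiv ((0 : ℕ) : ℤ)).symm

theorem coeff_entry (u : E) (n : ℤ) : (coeff b W u).entry n = b.repr u n := by
  rw [← l2Equiv_zero_apply, coeff, LinearIsometryEquiv.trans_apply,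
    LinearIsometryEquiv.apply_symm_apply]

theorem darbouxEntry_eq (a : ℤ) (u : E) :
    darbouxEntry b a u = (W.darbouxMap a (coeff b W u)).entry := by
  funext n
  rw [darbouxMap, Seq.entry_smul, Pi.smul_apply, smul_eq_mul, drop_entry, coeff_entry, coeff_entry,
    (coeff b W).norm_map]
  rfl

theorem darbouxChart_toFun (a : ℤ) (p : ℙ ℂ E) :
    (darbouxChart b W a).toFun p = W.darbouxMap a (coeff b W p.rep) := by
  change W.ofSeq _ _ = _
  rw [darbouxEntry_eq b W, ofSeq_self]

/-- The chart is defined through the chosen representative `rep`; invariance under nonzero scalars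
replaces it by an arbitrary one. -/
theorem darbouxChart_toFun_mk (a : ℤ) (u : E) (hu : u ≠ 0) :
    (darbouxChart b W a).toFun (Projectivization.mk ℂ u hu) = W.darbouxMap a (coeff b W u) := by
  obtain ⟨c, hc⟩ := Projectivization.exists_smul_eq_mk_rep ℂ u hu
  rw [darbouxChart_toFun, ← hc]
  change W.darbouxMap a (coeff b W ((c : ℂ) • u)) = _
  rw [map_smul, darbouxMap_smul a c.ne_zero]

theorem mk_mem_darbouxChart_source (a : ℤ) (u : E) (hu : u ≠ 0) :
    Projectivization.mk ℂ u hu ∈ (darbouxChart b W a).source ↔ b.repr u a ≠ 0 := by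
  obtain ⟨c, hc⟩ := Projectivization.exists_smul_eq_mk_rep ℂ u hu
  change b.repr (Projectivization.mk ℂ u hu).rep a ≠ 0 ↔ _
  rw [← hc]
  change b.repr ((c : ℂ) • u) a ≠ 0 ↔ _
  rw [map_smul]
  simp

/-- The inverse of the chart `ψ_a`. -/
def darbouxInv (a : ℤ) (y : W.Seq ((0 : ℕ) : ℤ)) : ℙ ℂ E :=
  Projectivization.mk ℂ ((coeff b W).symm (W.unitSection a y))
    ((map_ne_zero_iff _ (coeff b W).symm.injective).2 (section_ne_zero a y))

theorem isQuotientMap_mk : IsQuotientMap (Projectivization.mk' ℂ : {v : E // v ≠ 0} → ℙ ℂ E) :=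
  isQuotientMap_quot_mk

theorem continuous_darbouxInv (a : ℤ) : Continuous (darbouxInv b W a) := by
  have h : Continuous fun y : W.Seq ((0 : ℕ) : ℤ) => (⟨(coeff b W).symm (W.unitSection a y),
      (map_ne_zero_iff _ (coeff b W).symm.injective).2 (section_ne_zero a y)⟩ : {v : E // v ≠ 0}) :=
    ((coeff b W).symm.continuous.comp (continuous_section a)).subtype_mk _
  exact isQuotientMap_mk.continuous.comp h

theorem darbouxInv_mem (a : ℤ) {y : W.Seq ((0 : ℕ) : ℤ)}
    (hy : y ∈ Metric.ball (0 : W.Seq ((0 : ℕ) : ℤ)) 1) :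
    darbouxInv b W a y ∈ (darbouxChart b W a).source := by
  rw [darbouxInv, mk_mem_darbouxChart_source, ← coeff_entry b W,
    LinearIsometryEquiv.apply_symm_apply, section_entry_self]
  exact Complex.ofReal_ne_zero.2 (residual_pos hy).ne'

theorem darbouxChart_darbouxInv (a : ℤ) {y : W.Seq ((0 : ℕ) : ℤ)}
    (hy : y ∈ Metric.ball (0 : W.Seq ((0 : ℕ) : ℤ)) 1) :
    (darbouxChart b W a).toFun (darbouxInv b W a y) = y := by
  rw [darbouxInv, darbouxChart_toFun_mk, LinearIsometryEquiv.apply_symm_apply,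
    darbouxMap_section hy]

variable {b W} in
theorem coeff_rep_ne {a : ℤ} {p : ℙ ℂ E} (hp : p ∈ (darbouxChart b W a).source) :
    (coeff b W p.rep).entry a ≠ 0 := by
  rw [coeff_entry]
  exact hp

theorem darbouxInv_darbouxChart (a : ℤ) {p : ℙ ℂ E} (hp : p ∈ (darbouxChart b W a).source) :
    darbouxInv b W a ((darbouxChart b W a).toFun p) = p := by
  have h1 := coeff_rep_ne hp
  conv_rhs => rw [← p.mk_rep]
  rw [darbouxInv, Projectivization.mk_eq_mk_iff']
  refine ⟨phase ((coeff b W p.rep).entry a) ‖coeff b W p.rep‖, ?_⟩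
  rw [darbouxChart_toFun, section_darbouxMap h1, map_smul, LinearIsometryEquiv.symm_apply_apply]

theorem darbouxChart_mem_ball (a : ℤ) {p : ℙ ℂ E} (hp : p ∈ (darbouxChart b W a).source) :
    (darbouxChart b W a).toFun p ∈ Metric.ball (0 : W.Seq ((0 : ℕ) : ℤ)) 1 := by
  rw [darbouxChart_toFun]
  exact darbouxMap_mem_ball (coeff_rep_ne hp)

theorem darbouxChart_target (a : ℤ) : (darbouxChart b W a).target = Metric.ball 0 1 := by
  ext y
  constructor
  · rintro ⟨p, hp, rfl⟩
    exact darbouxChart_mem_ball b W a hp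
  · exact fun hy => ⟨_, darbouxInv_mem b W a hy, darbouxChart_darbouxInv b W a hy⟩

/-- Openness of the source and continuity are checked on nonzero vectors, by the quotient topology.
Images are open because they are preimages under the continuous map `darbouxInv`, cut down to the
ball. -/
theorem isChart_darbouxChart (a : ℤ) : (darbouxChart b W a).IsChart := by
  have hc : Continuous fun v : {v : E // v ≠ 0} => b.repr v.1 a := by
    simp only [← coeff_entry b W]
    exact (continuous_entry a).comp ((coeff b W).continuous.comp continuous_subtype_val)
  have hpre : (Projectivization.mk' ℂ : {v : E // v ≠ 0} → ℙ ℂ E) ⁻¹' (darbouxChart b W a).source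
      = {v | b.repr v.1 a ≠ 0} := by
    ext v
    exact mk_mem_darbouxChart_source b W a v.1 v.2
  have hopen : IsOpen (darbouxChart b W a).source := by
    rw [← isQuotientMap_mk.isOpen_preimage, hpre]
    exact isOpen_ne.preimage hc
  refine ⟨hopen, fun p hp q hq h => ?_, ?_, fun O hO hO' => ?_⟩
  · rw [← darbouxInv_darbouxChart b W a hp, h, darbouxInv_darbouxChart b W a hq]
  · rw [isQuotientMap_mk.continuousOn_isOpen_iff hopen, hpre]
    have h1 : (darbouxChart b W a).toFun ∘ (Projectivization.mk' ℂ : {v : E // v ≠ 0} → ℙ ℂ E)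
        = W.darbouxMap a ∘ fun v => coeff b W v.1 := by
      funext v
      exact darbouxChart_toFun_mk b W a v.1 v.2
    rw [h1]
    refine (continuousOn_darbouxMap a).comp
      ((coeff b W).continuous.comp continuous_subtype_val).continuousOn fun v hv => ?_
    change (coeff b W v.1).entry a ≠ 0
    rw [coeff_entry]
    exact hv
  · have h1 : (darbouxChart b W a).toFun '' O
        = Metric.ball (0 : W.Seq ((0 : ℕ) : ℤ)) 1 ∩ darbouxInv b W a ⁻¹' O := by
      ext y
      constructor
      · rintro ⟨p, hp, rfl⟩
        refine ⟨darbouxChart_mem_ball b W a (hO hp), ?_⟩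
        rw [mem_preimage, darbouxInv_darbouxChart b W a (hO hp)]
        exact hp
      · rintro ⟨hy, hyO⟩
        exact ⟨_, hyO, darbouxChart_darbouxInv b W a hy⟩
    rw [h1]
    exact Metric.isOpen_ball.inter (hO'.preimage (continuous_darbouxInv b W a))

/-- The numbers `u_m conj(u_n) / ‖u‖²` are the matrix entries of the orthogonal projection onto the
line. They are continuous on the quotient and separate lines, so they inject it continuously into a
product of copies of `ℂ`. -/
theorem t2Space_projectivization (b : HilbertBasis ℤ ℂ E) : T2Space (ℙ ℂ E) := by
  let F : {v : E // v ≠ 0} → ℤ × ℤ → ℂ := fun v n =>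
    b.repr v.1 n.1 * (starRingEnd ℂ) (b.repr v.1 n.2) / ((‖v.1‖ ^ 2 : ℝ) : ℂ)
  have hF : ∀ v w : {v : E // v ≠ 0}, ∀ t : ℂ, v.1 = t • w.1 → F v = F w := by
    intro v w t h
    have ht : t ≠ 0 := by
      rintro rfl
      exact v.2 (by simpa using h)
    have h1 : ((‖t‖ : ℝ) : ℂ) ≠ 0 := by simpa using ht
    have h2 : ((‖w.1‖ : ℝ) : ℂ) ≠ 0 := by simpa using w.2
    funext n
    simp only [F, h, map_smul, lp.coeFn_smul, Pi.smul_apply, smul_eq_mul, map_mul, norm_smul]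
    have h3 : t * (starRingEnd ℂ) t = ((‖t‖ : ℝ) : ℂ) ^ 2 := Complex.mul_conj' t
    push_cast
    rw [div_eq_div_iff (by positivity) (by positivity)]
    linear_combination (b.repr w.1 n.1 * (starRingEnd ℂ) (b.repr w.1 n.2) * ((‖w.1‖ : ℝ) : ℂ) ^ 2) * h3
  let f : ℙ ℂ E → ℤ × ℤ → ℂ := Projectivization.lift F hF
  have hfc : Continuous f := by
    rw [isQuotientMap_mk.continuous_iff]
    refine continuous_pi fun n => ?_
    have hc : ∀ k, Continuous fun v : {v : E // v ≠ 0} => b.repr v.1 k := fun k =>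
      (lp.evalCLM ℂ (fun _ : ℤ => ℂ) 2 k).continuous.comp
        (b.repr.continuous.comp continuous_subtype_val)
    refine Continuous.div ((hc n.1).mul (Complex.continuous_conj.comp (hc n.2))) ?_ fun v => ?_
    · exact Complex.continuous_ofReal.comp (continuous_subtype_val.norm.pow 2)
    · simpa using v.2
  refine T2Space.of_injective_continuous (f := f) ?_ hfc
  intro p q
  induction p using Projectivization.ind with | _ u hu => ?_
  induction q using Projectivization.ind with | _ v hv => ?_
  intro h
  have h' : ∀ m n, b.repr u m * (starRingEnd ℂ) (b.repr u n) / ((‖u‖ ^ 2 : ℝ) : ℂ)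
      = b.repr v m * (starRingEnd ℂ) (b.repr v n) / ((‖v‖ ^ 2 : ℝ) : ℂ) :=
    fun m n => congrFun h (m, n)
  have hu2 : ((‖u‖ ^ 2 : ℝ) : ℂ) ≠ 0 := by simpa using hu
  have hv2 : ((‖v‖ ^ 2 : ℝ) : ℂ) ≠ 0 := by simpa using hv
  obtain ⟨a, ha⟩ : ∃ a, b.repr u a ≠ 0 := by
    by_contra hcon
    push Not at hcon
    apply hu
    apply b.repr.injective
    rw [map_zero]
    ext n
    exact hcon n
  rw [Projectivization.mk_eq_mk_iff']
  have ha' : (starRingEnd ℂ) (b.repr u a) ≠ 0 := by simpa using ha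
  -- The scalar is read off from the matrix entries `(n, a)`, solved for `u_n`.
  refine ⟨(starRingEnd ℂ) (b.repr v a) * ((‖u‖ ^ 2 : ℝ) : ℂ) /
    (((‖v‖ ^ 2 : ℝ) : ℂ) * (starRingEnd ℂ) (b.repr u a)), ?_⟩
  apply b.repr.injective
  ext n
  rw [map_smul, lp.coeFn_smul, Pi.smul_apply, smul_eq_mul]
  have := h' n a
  rw [div_eq_div_iff hu2 hv2] at this
  rw [div_mul_eq_mul_div, div_eq_iff (mul_ne_zero hv2 ha')]
  linear_combination -this

end Projective

end

noncomputable section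

open ScaleSystem

/-! ## The transition maps -/

namespace ScaleWeight

open scoped ContDiff

variable {W : ScaleWeight}

/-- The projection of a level onto level zero. -/
abbrev toZero (W : ScaleWeight) (m : ℕ) : W.Seq (m : ℤ) →L[ℝ] W.Seq ((0 : ℕ) : ℤ) :=
  W.scale.nonneg.bond (Nat.zero_le m)

theorem toZero_entry {m : ℕ} (y : W.Seq (m : ℤ)) : (W.toZero m y).entry = y.entry :=
  nonneg_bond_entry _ y

/-- The entry at `b` of the unit vector determined by `y`. -/
def transitionEntry (W : ScaleWeight) (a b : ℤ) (m : ℕ) (y : W.Seq (m : ℤ)) : ℂ :=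
  W.insertedEntry a b m ((residual (W.toZero m y) : ℂ), y)

/-- The transition map `ψ_b ∘ ψ_a⁻¹`. -/
def transition (W : ScaleWeight) (a b : ℤ) : LevelMap W.scale.nonneg W.scale.nonneg :=
  fun m (y : W.Seq (m : ℤ)) => phase (W.transitionEntry a b m y) 1 •
    W.exchange a b m ((residual (W.toZero m y) : ℂ), y)

/-- The domain of the transition map. -/
def transitionDomain (W : ScaleWeight) (a b : ℤ) : Set (W.scale.nonneg.level 0) :=
  {y | y ∈ Metric.ball (0 : W.Seq ((0 : ℕ) : ℤ)) 1 ∧ (W.unitSection a y).entry b ≠ 0}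

theorem toZero_zero (y : W.Seq ((0 : ℕ) : ℤ)) : W.toZero 0 y = y :=
  Seq.ext (toZero_entry y)

theorem transitionEntry_eq (a b : ℤ) (m : ℕ) (y : W.Seq (m : ℤ)) :
    W.transitionEntry a b m y = (W.unitSection a (W.toZero m y)).entry b := by
  rw [unitSection, ins_entry, transitionEntry, insertedEntry_apply, toZero_entry]

theorem transition_zero (a b : ℤ) (y : W.Seq ((0 : ℕ) : ℤ)) :
    W.transition a b 0 y = phase ((W.unitSection a y).entry b) 1 • W.drop b (W.unitSection a y) := by
  rw [transition, transitionEntry_eq, toZero_zero]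
  rfl

theorem transition_zero_eq_darbouxMap (a b : ℤ) {y : W.Seq ((0 : ℕ) : ℤ)}
    (hy : y ∈ Metric.ball (0 : W.Seq ((0 : ℕ) : ℤ)) 1) :
    W.transition a b 0 y = W.darbouxMap b (W.unitSection a y) := by
  rw [transition_zero, darbouxMap, norm_section hy]

/-- The square of a Hilbert norm is smooth; it is reached through the isometry with `l²`. The
radicand is positive on the ball, where the square root is smooth. -/
theorem contDiffAt_residual {m : ℕ} {y : W.Seq (m : ℤ)}
    (hy : W.toZero m y ∈ Metric.ball (0 : W.Seq ((0 : ℕ) : ℤ)) 1) :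
    ContDiffAt ℝ ∞ (fun y : W.Seq (m : ℤ) => ((residual (W.toZero m y) : ℝ) : ℂ)) y := by
  have h1 : ContDiff ℝ ∞ fun y : W.Seq (m : ℤ) => 1 - ‖W.toZero m y‖ ^ 2 := by
    have h2 : ContDiff ℝ ∞ fun y : W.Seq (m : ℤ) => W.l2Equiv ((0 : ℕ) : ℤ) (W.toZero m y) :=
      ((W.l2Equiv ((0 : ℕ) : ℤ)).toContinuousLinearEquiv.toContinuousLinearMap.restrictScalars ℝ
        |>.contDiff).comp (W.toZero m).contDiff
    have h3 : ContDiff ℝ ∞ fun y : W.Seq (m : ℤ) => ‖W.l2Equiv ((0 : ℕ) : ℤ) (W.toZero m y)‖ ^ 2 :=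
      h2.norm_sq ℝ
    simp only [(W.l2Equiv _).norm_map] at h3
    exact contDiff_const.sub h3
  have h4 : ContDiffAt ℝ ∞ (fun y : W.Seq (m : ℤ) => residual (W.toZero m y)) y := by
    refine h1.contDiffAt.sqrt ?_
    have := residual_pos hy
    exact (Real.sqrt_pos.1 this).ne'
  exact Complex.ofRealCLM.contDiff.contDiffAt.comp y h4

theorem contDiffAt_phase {z : ℂ} (hz : z ≠ 0) : ContDiffAt ℝ ∞ (fun z => phase z 1) z := by
  have h1 : (fun z => phase z 1) = fun z : ℂ => ((‖z‖ : ℝ) : ℂ) * z⁻¹ := by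
    funext z
    rw [phase, Complex.ofReal_one, mul_one, div_eq_mul_inv]
  rw [h1]
  exact (Complex.ofRealCLM.contDiff.contDiffAt.comp z (contDiffAt_norm ℝ hz)).mul
    (contDiffAt_inv ℝ hz)

theorem contDiffAt_transitionEntry (a b : ℤ) {m : ℕ} {y : W.Seq (m : ℤ)}
    (hy : W.toZero m y ∈ Metric.ball (0 : W.Seq ((0 : ℕ) : ℤ)) 1) :
    ContDiffAt ℝ ∞ (W.transitionEntry a b m) y :=
  (W.insertedEntry a b m).contDiff.contDiffAt.comp y ((contDiffAt_residual hy).prodMk contDiffAt_id)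

theorem contDiffAt_transitionPhase (a b : ℤ) {m : ℕ} {y : W.Seq (m : ℤ)}
    (hy : W.toZero m y ∈ W.transitionDomain a b) :
    ContDiffAt ℝ ∞ (fun y => phase (W.transitionEntry a b m y) 1) y := by
  refine ContDiffAt.comp (g := fun z => phase z 1) y (contDiffAt_phase ?_) (contDiffAt_transitionEntry a b hy.1)
  rw [transitionEntry_eq]
  exact hy.2

theorem contDiffAt_transition (a b : ℤ) {m : ℕ} {y : W.Seq (m : ℤ)}
    (hy : W.toZero m y ∈ W.transitionDomain a b) :
    ContDiffAt ℝ ∞ (W.transition a b m) y :=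
  (contDiffAt_transitionPhase a b hy).smul ((W.exchange a b m).contDiff.contDiffAt.comp y
    ((contDiffAt_residual hy.1).prodMk contDiffAt_id))

theorem isOpen_transitionDomain (a b : ℤ) : IsOpen (W.transitionDomain a b) :=
  Metric.isOpen_ball.inter (isOpen_ne.preimage ((continuous_entry b).comp (continuous_section a)))

/-- All the nonlinearity sits in scalars, the residual and the phase, while `exchange` is bounded
linear on every level; so nothing loses regularity. -/
theorem isLevelSmooth_transition (a b : ℤ) :
    IsLevelSmooth (W.transitionDomain a b) (W.transition a b) where
  compat r s h y hy := by
    have h1 : W.toZero r (W.scale.nonneg.bond h y) = W.toZero s y :=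
      bond_bond (W.scale.nonneg) (Nat.zero_le r) h y
    apply Seq.ext
    rw [nonneg_bond_entry, transition, transition, Seq.entry_smul, Seq.entry_smul,
      transitionEntry_eq, transitionEntry_eq, h1]
    congr 1
  smooth m := fun y hy => (contDiffAt_transition a b hy).contDiffWithinAt

/-! ### Transition maps preserve the symplectic form. -/

theorem hasFDerivAt_l2Equiv (x : W.Seq ((0 : ℕ) : ℤ)) : HasFDerivAt (W.l2Equiv ((0 : ℕ) : ℤ))
    ((W.l2Equiv ((0 : ℕ) : ℤ)).toContinuousLinearEquiv.toContinuousLinearMap.restrictScalars ℝ) x :=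
  ((W.l2Equiv ((0 : ℕ) : ℤ)).toContinuousLinearEquiv.toContinuousLinearMap.restrictScalars
    ℝ).hasFDerivAt

/-- Two real entries contribute a real term to the pairing, so deleting them does not affect the
imaginary part. -/
theorem im_pairing_drop {a : ℤ} {x y : W.Seq ((0 : ℕ) : ℤ)} (hx : (x.entry a).im = 0)
    (hy : (y.entry a).im = 0) :
    (W.pairing (W.drop a x) (W.drop a y)).im = (W.pairing x y).im := by
  rw [pairing_drop a x y, Complex.add_im, Complex.mul_im, Complex.conj_im, Complex.conj_re, hx, hy]
  ring

/-- Multiplying a curve of unit vectors by unit scalars does not change the symplectic form. -/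
theorem im_inner_phase_smul {H : Type*} [NormedAddCommGroup H] [InnerProductSpace ℂ H]
    {l κ μ : ℂ} {σ v w : H} (hl : ‖l‖ = 1) (hκ : ((starRingEnd ℂ) l * κ).re = 0)
    (hμ : ((starRingEnd ℂ) l * μ).re = 0) (hσ : ‖σ‖ = 1) (hv : (inner ℂ σ v).re = 0)
    (hw : (inner ℂ σ w).re = 0) :
    (inner ℂ (μ • σ + l • w) (κ • σ + l • v)).im = (inner ℂ w v).im := by
  have hll : (starRingEnd ℂ) l * l = 1 := by
    rw [Complex.conj_mul', hl]; simp
  set κ' := ((starRingEnd ℂ) l * κ).im with hκ'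
  set μ' := ((starRingEnd ℂ) l * μ).im with hμ'
  -- `κ` is tangent to the circle at `l`, hence `l` times an imaginary number; `μ` is treated alike.
  have e1 : κ = l * (κ' * Complex.I) := by
    have : (starRingEnd ℂ) l * κ = κ' * Complex.I := by
      apply Complex.ext <;> simp [hκ, hκ']
    rw [← this]; linear_combination (-κ) * hll
  have e2 : μ = l * (μ' * Complex.I) := by
    have : (starRingEnd ℂ) l * μ = μ' * Complex.I := by
      apply Complex.ext <;> simp [hμ, hμ']
    rw [← this]; linear_combination (-μ) * hll
  have h1 : inner ℂ σ σ = 1 := by rw [inner_self_eq_norm_sq_to_K, hσ]; simp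
  have h2 : μ • σ + l • w = l • ((μ' * Complex.I) • σ + w) := by rw [smul_add, smul_smul, ← e2]
  have h3 : κ • σ + l • v = l • ((κ' * Complex.I) • σ + v) := by rw [smul_add, smul_smul, ← e1]
  have hw' : (inner ℂ w σ).re = 0 := by rw [← inner_conj_symm, Complex.conj_re, hw]
  rw [h2, h3, inner_smul_left, inner_smul_right, ← mul_assoc, hll, one_mul, inner_add_left,
    inner_add_right, inner_add_right, inner_smul_left, inner_smul_left, inner_smul_right,
    inner_smul_right, h1]
  -- The term with both rotations is `μ' κ'`, and each mixed term is `i` times a purely imaginary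
  -- number; only the inner product of `w` and `v` has an imaginary part left.
  simp [hv, hw']

/-- The transition is deletion at `b` of `l • σ`, where `σ` is the unit section at `a` and `l` a
phase. Derivatives of `σ` have real entry at `a`, those of `l • σ` real entry at `b`, so both
deletions preserve the imaginary part of the pairing. As `σ` stays on the unit sphere and `l` on the
unit circle, `im_inner_phase_smul` compares the two sides. -/
theorem centerForm_fderiv_transition (a b : ℤ) {y : W.Seq ((0 : ℕ) : ℤ)}
    (hy : y ∈ W.transitionDomain a b) (v w : W.Seq ((0 : ℕ) : ℤ)) :
    centerForm W.scale W.stdForm (fderiv ℝ (W.transition a b 0) y v)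
      (fderiv ℝ (W.transition a b 0) y w) = centerForm W.scale W.stdForm v w := by
  have hy' : W.toZero 0 y ∈ W.transitionDomain a b := by rwa [toZero_zero]
  have hnhds := (isOpen_transitionDomain (W := W) a b).mem_nhds hy
  set σ := W.unitSection a with hσ
  set l : W.Seq ((0 : ℕ) : ℤ) → ℂ := fun y => phase ((σ y).entry b) 1 with hl
  have dσ : DifferentiableAt ℝ σ y := by
    have h1 := contDiffAt_residual hy'.1
    simp only [toZero_zero] at h1
    exact ((W.ins a).contDiff.contDiffAt.comp y (h1.prodMk contDiffAt_id)).differentiableAt (by simp)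
  have dl : DifferentiableAt ℝ l y := by
    have h1 := contDiffAt_transitionPhase a b hy'
    simp only [transitionEntry_eq, toZero_zero] at h1
    exact h1.differentiableAt (by simp)
  set S' := fderiv ℝ σ y
  set l' := fderiv ℝ l y
  have hS : HasFDerivAt σ S' y := dσ.hasFDerivAt
  have hL : HasFDerivAt l l' y := dl.hasFDerivAt
  have hF := hL.smul hS
  set F' := l y • S' + l'.smulRight (σ y) with hF'
  have hG : fderiv ℝ (W.transition a b 0) y = (W.drop b).comp F' := by
    have h1 := (W.drop b).hasFDerivAt.comp y hF
    have h2 : W.transition a b 0 = W.drop b ∘ fun y => l y • σ y := by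
      funext y
      rw [transition_zero]
      rfl
    rw [h2]
    exact h1.fderiv
  have hdrop : ∀ u, W.drop a (S' u) = u := by
    intro u
    have h1 := (W.drop a).hasFDerivAt.comp y hS
    have h2 : W.drop a ∘ σ = id := funext fun y => drop_section a y
    rw [h2] at h1
    exact congrArg (fun T => T u) (h1.unique (hasFDerivAt_id y))
  have him : ∀ u, ((S' u).entry a).im = 0 := by
    intro u
    have h1 := (Complex.imCLM.comp (W.entryCLM _ a)).hasFDerivAt.comp y hS
    have h2 : (Complex.imCLM.comp (W.entryCLM _ a)) ∘ σ = fun _ => 0 := funext fun y => by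
      change ((σ y).entry a).im = 0
      rw [hσ, section_entry_self, Complex.ofReal_im]
    rw [h2] at h1
    exact congrArg (fun T => T u) (h1.unique (hasFDerivAt_const _ y))
  have himF : ∀ u, ((F' u).entry b).im = 0 := by
    intro u
    have h1 := (Complex.imCLM.comp (W.entryCLM _ b)).hasFDerivAt.comp y hF
    -- On the domain, the phase makes the entry at `b` equal to its modulus, which is real.
    have h2 : (Complex.imCLM.comp (W.entryCLM _ b)) ∘ (fun y => l y • σ y) =ᶠ[𝓝 y] fun _ => 0 := by
      filter_upwards [hnhds] with x hx
      change ((l x • σ x).entry b).im = 0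
      rw [Seq.entry_smul, Pi.smul_apply, smul_eq_mul, hl, phase_mul_self hx.2, Complex.ofReal_im]
    exact congrArg (fun T => T u) (h1.unique ((hasFDerivAt_const _ y).congr_of_eventuallyEq h2))
  have hre : ∀ u, (inner ℂ (W.l2Equiv _ (σ y)) (W.l2Equiv _ (S' u))).re = 0 := by
    intro u
    have h1 := (((hasFDerivAt_l2Equiv (σ y)).comp y hS).norm_sq)
    have h2 : (fun x => ‖(W.l2Equiv ((0 : ℕ) : ℤ) ∘ σ) x‖ ^ 2) =ᶠ[𝓝 y] fun _ => 1 := by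
      filter_upwards [hnhds] with x hx
      rw [Function.comp_apply, (W.l2Equiv _).norm_map, norm_section hx.1, one_pow]
    have h3 := congrArg (fun T => T u)
      (h1.unique ((hasFDerivAt_const (1 : ℝ) y).congr_of_eventuallyEq h2))
    rw [← lp_real_inner_eq]
    simpa using h3
  have hlre : ∀ u, ((starRingEnd ℂ) (l y) * l' u).re = 0 := by
    intro u
    have h1 := hL.norm_sq
    have h2 : (fun x => ‖l x‖ ^ 2) =ᶠ[𝓝 y] fun _ => 1 := by
      filter_upwards [hnhds] with x hx
      rw [hl, norm_phase hx.2 one_pos]; simp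
    have h3 := congrArg (fun T => T u)
      (h1.unique ((hasFDerivAt_const (1 : ℝ) y).congr_of_eventuallyEq h2))
    have h4 : 2 • inner ℝ (l y) (l' u) = 0 := h3
    rwa [smul_eq_zero_iff_right two_ne_zero, Complex.inner, mul_comm (l' u)] at h4
  have hFu : ∀ u, W.l2Equiv ((0 : ℕ) : ℤ) (F' u)
      = l' u • W.l2Equiv _ (σ y) + l y • W.l2Equiv _ (S' u) := by
    intro u
    change W.l2Equiv ((0 : ℕ) : ℤ) (l y • S' u + l' u • σ y) = _
    rw [map_add, map_smul, map_smul, add_comm]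
  have e1 : centerForm W.scale W.stdForm v w = -(W.pairing (S' v) (S' w)).im := by
    rw [← im_pairing_drop (him v) (him w), hdrop, hdrop]; rfl
  have e2 : centerForm W.scale W.stdForm (fderiv ℝ (W.transition a b 0) y v)
      (fderiv ℝ (W.transition a b 0) y w) = -(W.pairing (F' v) (F' w)).im := by
    rw [hG, ← im_pairing_drop (himF v) (himF w)]; rfl
  rw [e1, e2, pairing_eq_inner (by simp), pairing_eq_inner (by simp), hFu, hFu,
    im_inner_phase_smul (by rw [hl, norm_phase hy.2 one_pos]; simp) (hlre v) (hlre w)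
      (by rw [(W.l2Equiv _).norm_map, norm_section hy.1]) (hre v) (hre w)]

end ScaleWeight

/-! ### The Darboux charts form a symplectic atlas. -/

section Projective

open ScaleWeight

variable {E : Type*} [NormedAddCommGroup E] [InnerProductSpace ℂ E] (b : HilbertBasis ℤ ℂ E)
  (W : ScaleWeight)

/-- The unit section returns the representative up to a nonzero scalar, which the second chart
ignores. -/
theorem transition_darbouxChart (a c : ℤ) {p : ℙ ℂ E} (hp : p ∈ (darbouxChart b W a).source) :
    W.transition a c 0 ((darbouxChart b W a).toFun p) = (darbouxChart b W c).toFun p := by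
  rw [transition_zero_eq_darbouxMap a c (darbouxChart_mem_ball b W a hp), darbouxChart_toFun,
    section_darbouxMap (coeff_rep_ne hp), darbouxMap_smul c (phase_ne_zero (coeff_rep_ne hp)),
    darbouxChart_toFun]

theorem isTransition_darbouxChart (a c : ℤ) :
    (darbouxChart b W a).IsTransition (darbouxChart b W c) (W.transition a c) :=
  fun _ hq => transition_darbouxChart b W a c hq.1

theorem overlap_darbouxChart_subset (a c : ℤ) :
    (darbouxChart b W a).overlap (darbouxChart b W c) ⊆ W.transitionDomain a c := by
  rintro y ⟨p, ⟨hpa, hpc⟩, rfl⟩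
  refine ⟨darbouxChart_mem_ball b W a hpa, ?_⟩
  rw [darbouxChart_toFun, section_darbouxMap (coeff_rep_ne hpa), Seq.entry_smul]
  exact mul_ne_zero (phase_ne_zero (coeff_rep_ne hpa)) (coeff_rep_ne hpc)

theorem symplecticallyCompatible_darbouxChart (a c : ℤ) :
    SymplecticallyCompatible W.scale W.stdForm (darbouxChart b W a) (darbouxChart b W c) := by
  have h := overlap_darbouxChart_subset b W a c
  refine ⟨⟨_, isTransition_darbouxChart b W a c,
    ((isLevelSmooth_transition a c).isScSmooth (isOpen_transitionDomain a c)).mono h, _,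
    ((isLevelSmooth_transition a c).isScDeriv (isOpen_transitionDomain a c)).mono h,
    fun x hx v w => centerForm_fderiv_transition a c (h hx) v w⟩, _,
    isTransition_darbouxChart b W c a,
    ((isLevelSmooth_transition c a).isScSmooth (isOpen_transitionDomain c a)).mono
      (overlap_darbouxChart_subset b W c a)⟩

theorem isSymplecticAtlas_darbouxAtlas :
    IsSymplecticAtlas W.scale W.stdForm (darbouxAtlas b W) where
  hausdorff := t2Space_projectivization b
  chart := by
    rintro _ ⟨a, rfl⟩
    exact isChart_darbouxChart b W a
  cover p := by
    obtain ⟨a, ha⟩ : ∃ a, b.repr p.rep a ≠ 0 := by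
      by_contra hcon
      push Not at hcon
      apply p.rep_nonzero
      apply b.repr.injective
      rw [map_zero]
      ext n
      exact hcon n
    exact ⟨_, ⟨a, rfl⟩, ha⟩
  compatible := by
    rintro _ ⟨a, rfl⟩ _ ⟨c, rfl⟩
    exact symplecticallyCompatible_darbouxChart b W a c

theorem darbouxChart_mem_projectiveStructure (a : ℤ) :
    darbouxChart b W a ∈ projectiveStructure b W := by
  refine ⟨isChart_darbouxChart b W a, ?_⟩
  rintro _ ⟨c, rfl⟩
  exact ⟨symplecticallyCompatible_darbouxChart b W a c,
    symplecticallyCompatible_darbouxChart b W c a⟩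

end Projective

end

noncomputable section

open ScaleSystem

/-! ## Tangent spaces of symplectic sc-manifolds -/

namespace ScaleSystem.IsBanachScale

variable {X : ScaleSystem ℤ}

theorem nonneg_bond_injective (hX : X.IsBanachScale) {r s : ℕ} (h : r ≤ s) :
    Function.Injective (X.nonneg.bond h) :=
  hX.injective _ _ _

theorem nonneg_denseRange (hX : X.IsBanachScale) {r s : ℕ} (h : r ≤ s) :
    DenseRange (X.nonneg.bond h) := by
  refine (hX.dense (r : ℤ)).mono ?_
  rintro _ ⟨x, hx, rfl⟩
  exact ⟨x (s : ℤ), hx _ _ (Int.ofNat_le.mpr h)⟩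

theorem hasCompactBonds (hX : X.IsBanachScale) : X.nonneg.HasCompactBonds :=
  fun m => hX.compact (m : ℤ) ((m + 1 : ℕ) : ℤ) (by simp)

end ScaleSystem.IsBanachScale

section Tangent

variable {M : Type*} {X : ScaleSystem ℤ}
  {ω : ∀ s t : ℤ, s + t = 0 → X.level s → X.level t → ℝ} {A B : Set (ScChart M X.nonneg)}

/-- The transition data between two charts: a representative, its sc-derivative, and invariance of
the symplectic form. -/
structure TransitionData (X : ScaleSystem ℤ)
    (ω : ∀ s t : ℤ, s + t = 0 → X.level s → X.level t → ℝ) (φ ψ : ScChart M X.nonneg) where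
  G : LevelMap X.nonneg X.nonneg
  DG : LevelMap X.nonneg.tangent X.nonneg
  isTransition : φ.IsTransition ψ G
  sc0 : IsSc0 (φ.overlap ψ) G
  deriv : IsScDeriv (φ.overlap ψ) G DG
  symplectic : ∀ x ∈ shiftSet (φ.overlap ψ), ∀ v w : X.nonneg.level 0,
    centerForm X ω (DG 0 (x, v)) (DG 0 (x, w)) = centerForm X ω v w

theorem SymplecticallyCompatible.nonempty_transitionData {φ ψ : ScChart M X.nonneg}
    (h : SymplecticallyCompatible X ω φ ψ) : Nonempty (TransitionData X ω φ ψ) := by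
  obtain ⟨G, hG, hs, DG, hDG, hω⟩ := h.1
  exact ⟨⟨G, DG, hG, hs 0, hDG, hω⟩⟩

theorem ScChart.mem_overlap {φ ψ : ScChart M X.nonneg} {p : M} (hφ : p ∈ φ.source)
    (hψ : p ∈ ψ.source) : φ.toFun p ∈ φ.overlap ψ :=
  mem_image_of_mem _ ⟨hφ, hψ⟩

theorem ScChart.mem_range_bond_of_transition {φ ψ : ScChart M X.nonneg}
    {G : LevelMap X.nonneg X.nonneg} (hG : φ.IsTransition ψ G) (hs : IsSc0 (φ.overlap ψ) G) {p : M}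
    (hφ : p ∈ φ.source) (hψ : p ∈ ψ.source) {m : ℕ}
    (h : φ.toFun p ∈ range (X.nonneg.bond (Nat.zero_le m))) :
    ψ.toFun p ∈ range (X.nonneg.bond (Nat.zero_le m)) := by
  obtain ⟨x, hx⟩ := h
  refine ⟨G m x, ?_⟩
  have hxU : x ∈ levelSet (φ.overlap ψ) m := by
    change X.nonneg.bond _ x ∈ φ.overlap ψ
    rw [hx]
    exact mem_overlap hφ hψ
  rw [hs.bond_zero hxU, hx, hG p ⟨hφ, hψ⟩]

theorem ScTangent.mk_eq_mk {p : levelPoints A 1} {φ ψ : ScChart M X.nonneg} (hφ : φ ∈ A)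
    (hψ : ψ ∈ A) (hpφ : p.1 ∈ φ.source) (hpψ : p.1 ∈ ψ.source) (T : TransitionData X ω φ ψ)
    (v : X.nonneg.level 0) :
    ScTangent.mk A p φ hφ hpφ v = ScTangent.mk A p ψ hψ hpψ (T.DG 0 ((φ.one A).toFun p, v)) :=
  Quot.sound ⟨T.G, T.DG, T.isTransition, T.sc0, T.deriv, rfl⟩

variable [TopologicalSpace M]

theorem subset_maximalSymplecticAtlas (hB : IsSymplecticAtlas X ω B) :
    B ⊆ maximalSymplecticAtlas X ω B :=
  fun φ hφ => ⟨hB.chart φ hφ, fun ψ hψ => ⟨hB.compatible φ hφ ψ hψ, hB.compatible ψ hψ φ hφ⟩⟩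

theorem ScChart.IsChart.isOpen_overlap {φ ψ : ScChart M X.nonneg} (hφ : φ.IsChart)
    (hψ : ψ.IsChart) : IsOpen (φ.overlap ψ) :=
  hφ.open_image _ inter_subset_left (hφ.open_source.inter hψ.open_source)

/-- Charts of the maximal atlas are compatible by definition only with those of `B`, so the
comparison passes through a chart of `B`. This shows that the filtration does not depend on the
chart. -/
theorem mem_range_bond_of_levelPoints (hB : IsSymplecticAtlas X ω B)
    (hA : A = maximalSymplecticAtlas X ω B) {m : ℕ} {p : M} (hp : p ∈ levelPoints A m)
    {φ : ScChart M X.nonneg} (hφ : φ ∈ A) (hpφ : p ∈ φ.source) :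
    φ.toFun p ∈ range (X.nonneg.bond (Nat.zero_le m)) := by
  subst hA
  obtain ⟨χ, hχ, hpχ, hr⟩ := hp
  obtain ⟨ψ, hψ, hpψ⟩ := hB.cover p
  obtain ⟨S⟩ := (hχ.2 ψ hψ).1.nonempty_transitionData
  obtain ⟨T⟩ := (hφ.2 ψ hψ).2.nonempty_transitionData
  exact ScChart.mem_range_bond_of_transition T.isTransition T.sc0 hpψ hpφ
    (ScChart.mem_range_bond_of_transition S.isTransition S.sc0 hpχ hpψ hr)

theorem bond_one (hB : IsSymplecticAtlas X ω B) (hA : A = maximalSymplecticAtlas X ω B)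
    (p : levelPoints A 1) {φ : ScChart M X.nonneg} (hφ : φ ∈ A) (hp : p.1 ∈ φ.source) :
    X.nonneg.bond (Nat.zero_le (0 + 1)) ((φ.one A).toFun p) = φ.toFun p.1 :=
  Function.invFun_eq (mem_range_bond_of_levelPoints hB hA p.2 hφ hp)

theorem one_mem_levelSet (hB : IsSymplecticAtlas X ω B) (hA : A = maximalSymplecticAtlas X ω B)
    (p : levelPoints A 1) {φ : ScChart M X.nonneg} (hφ : φ ∈ A) (hp : p.1 ∈ φ.source)
    {U : Set (X.nonneg.level 0)} (hU : φ.toFun p.1 ∈ U) :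
    (φ.one A).toFun p ∈ levelSet U (0 + 1) := by
  change X.nonneg.bond _ _ ∈ U
  rw [bond_one hB hA p hφ hp]
  exact hU

theorem transition_one (hX : X.IsBanachScale) (hB : IsSymplecticAtlas X ω B)
    (hA : A = maximalSymplecticAtlas X ω B) (p : levelPoints A 1) {φ ψ : ScChart M X.nonneg}
    (hφ : φ ∈ A) (hψ : ψ ∈ A) (hpφ : p.1 ∈ φ.source) (hpψ : p.1 ∈ ψ.source)
    {G : LevelMap X.nonneg X.nonneg} (hG : φ.IsTransition ψ G) (hs : IsSc0 (φ.overlap ψ) G) :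
    G (0 + 1) ((φ.one A).toFun p) = (ψ.one A).toFun p := by
  apply hX.nonneg_bond_injective (Nat.zero_le (0 + 1))
  rw [hs.bond_zero (one_mem_levelSet hB hA p hφ hpφ (ScChart.mem_overlap hpφ hpψ)),
    bond_one hB hA p hφ hpφ, bond_one hB hA p hψ hpψ, hG p.1 ⟨hpφ, hpψ⟩]

/-- The cocycle condition for the derivatives of transition maps. -/
theorem transition_deriv_comp (hX : X.IsBanachScale) (hB : IsSymplecticAtlas X ω B)
    (hA : A = maximalSymplecticAtlas X ω B) (p : levelPoints A 1) {φ ψ χ : ScChart M X.nonneg}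
    (hφ : φ ∈ A) (hψ : ψ ∈ A) (hχ : χ ∈ A) (hpφ : p.1 ∈ φ.source) (hpψ : p.1 ∈ ψ.source)
    (hpχ : p.1 ∈ χ.source) {G : LevelMap X.nonneg X.nonneg}
    {DG : LevelMap X.nonneg.tangent X.nonneg} (hG : φ.IsTransition ψ G)
    (hs : IsSc0 (φ.overlap ψ) G) (hD : IsScDeriv (φ.overlap ψ) G DG)
    (S : TransitionData X ω φ χ) (T : TransitionData X ω ψ χ) (v : X.nonneg.level 0) :
    S.DG 0 ((φ.one A).toFun p, v) =
      T.DG 0 ((ψ.one A).toFun p, DG 0 ((φ.one A).toFun p, v)) := by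
  have hcharts : ∀ φ ∈ A, φ.IsChart := by subst hA; exact fun φ h => h.1
  -- The image of the triple overlap, on which the direct and the composite transition are both
  -- defined and agree.
  set U := φ.toFun '' (φ.source ∩ ψ.source ∩ χ.source) with hU
  have hUo : IsOpen U := (hcharts φ hφ).open_image _ (fun q hq => hq.1.1)
    (((hcharts φ hφ).open_source.inter (hcharts ψ hψ).open_source).inter (hcharts χ hχ).open_source)
  have hU1 : U ⊆ φ.overlap ψ := image_mono fun q hq => hq.1
  have hU2 : U ⊆ φ.overlap χ := image_mono fun q hq => ⟨hq.1.1, hq.2⟩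
  have hmaps : MapsTo (G 0) U (ψ.overlap χ) := by
    rintro _ ⟨q, hq, rfl⟩
    rw [hG q hq.1]
    exact ScChart.mem_overlap hq.1.2 hq.2
  have hcomp := IsScDeriv.comp (hX.hasCompactBonds 0) hUo
    ((hcharts ψ hψ).isOpen_overlap (hcharts χ hχ)) (hs.mono hU1) (hD.mono hU1) T.deriv hmaps
  have heq : EqOn (S.G 0) (fun x => T.G 0 (G 0 x)) U := by
    rintro _ ⟨q, hq, rfl⟩
    change S.G 0 _ = T.G 0 (G 0 _)
    rw [hG q hq.1, S.isTransition q ⟨hq.1.1, hq.2⟩, T.isTransition q ⟨hq.1.2, hq.2⟩]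
  have hx : (φ.one A).toFun p ∈ levelSet U (0 + 1) :=
    one_mem_levelSet hB hA p hφ hpφ (mem_image_of_mem _ ⟨⟨hpφ, hpψ⟩, hpχ⟩)
  have := IsScDeriv.unique (hX.nonneg_denseRange _) hUo (S.deriv.mono hU2) hcomp heq hx v
  rw [this]
  change T.DG 0 (G (0 + 1) _, _) = _
  rw [transition_one hX hB hA p hφ hψ hpφ hpψ hG hs]

/-- Nondegeneracy of the symplectic form on `X_0`. -/
def CenterNondegenerate (X : ScaleSystem ℤ)
    (ω : ∀ s t : ℤ, s + t = 0 → X.level s → X.level t → ℝ) : Prop :=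
  ∀ v w : X.nonneg.level 0, (∀ u, centerForm X ω v u = centerForm X ω w u) → v = w

/-- Reading vectors in a fixed chart of `B` gives a function on the quotient, well defined by the
cocycle condition. It separates vectors of the given chart because derivatives of transitions
preserve a nondegenerate form; no inverse derivative is needed. -/
theorem ScTangent.mk_injective (hX : X.IsBanachScale) (hω : CenterNondegenerate X ω)
    (hB : IsSymplecticAtlas X ω B)
    (hA : A = maximalSymplecticAtlas X ω B) (p : levelPoints A 1) {φ : ScChart M X.nonneg}
    (hφ : φ ∈ A) (hp : p.1 ∈ φ.source) : Function.Injective (ScTangent.mk A p φ hφ hp) := by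
  obtain ⟨ψ, hψ, hpψ⟩ := hB.cover p.1
  have hBA : B ⊆ A := by subst hA; exact subset_maximalSymplecticAtlas hB
  have hT : ∀ χ : {φ : ScChart M X.nonneg // φ ∈ A ∧ p.1 ∈ φ.source},
      Nonempty (TransitionData X ω χ.1 ψ) := by
    subst hA
    exact fun χ => (χ.2.1.2 ψ hψ).1.nonempty_transitionData
  let T := fun χ => Classical.choice (hT χ)
  let c : ScTangent A p → X.nonneg.level 0 := Quot.lift
    (fun a => (T a.1).DG 0 ((a.1.1.one A).toFun p, a.2)) (by
      rintro ⟨⟨φ₁, h₁, h₁'⟩, v₁⟩ ⟨⟨φ₂, h₂, h₂'⟩, v₂⟩ ⟨G, DG, hG, hs, hD, e⟩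
      obtain rfl : _ = v₂ := e
      exact transition_deriv_comp hX hB hA p h₁ h₂ (hBA hψ) h₁' h₂' hpψ hG hs hD _ _ v₁)
  intro v w hvw
  have h1 : (T ⟨φ, hφ, hp⟩).DG 0 ((φ.one A).toFun p, v)
      = (T ⟨φ, hφ, hp⟩).DG 0 ((φ.one A).toFun p, w) := congrArg c hvw
  refine hω v w fun u => ?_
  have hx : (φ.one A).toFun p ∈ shiftSet (φ.overlap ψ) :=
    one_mem_levelSet hB hA p hφ hp (ScChart.mem_overlap hp hpψ)
  rw [← (T ⟨φ, hφ, hp⟩).symplectic _ hx v u, h1, (T ⟨φ, hφ, hp⟩).symplectic _ hx w u]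

/-- Any representative is carried to the chart `φ` by two transitions through a chart of `B`. -/
theorem ScTangent.exists_mk_eq (hB : IsSymplecticAtlas X ω B)
    (hA : A = maximalSymplecticAtlas X ω B) {p : levelPoints A 1} (ξ : ScTangent A p)
    {φ : ScChart M X.nonneg} (hφ : φ ∈ A) (hp : p.1 ∈ φ.source) :
    ∃ v, ScTangent.mk A p φ hφ hp v = ξ := by
  obtain ⟨ψ, hψ, hpψ⟩ := hB.cover p.1
  have hBA : B ⊆ A := by subst hA; exact subset_maximalSymplecticAtlas hB
  induction ξ using Quot.ind with | _ a => ?_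
  obtain ⟨⟨χ, hχ, hpχ⟩, v⟩ := a
  have h1 : Nonempty (TransitionData X ω χ ψ) := by
    subst hA; exact (hχ.2 ψ hψ).1.nonempty_transitionData
  have h2 : Nonempty (TransitionData X ω ψ φ) := by
    subst hA; exact (hφ.2 ψ hψ).2.nonempty_transitionData
  obtain ⟨S⟩ := h1
  obtain ⟨T⟩ := h2
  refine ⟨_, ((ScTangent.mk_eq_mk hχ (hBA hψ) hpχ hpψ S v).trans
    (ScTangent.mk_eq_mk (hBA hψ) hφ hpψ hp T _)).symm⟩

theorem ScTangent.mk_coord (hB : IsSymplecticAtlas X ω B)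
    (hA : A = maximalSymplecticAtlas X ω B) {p : levelPoints A 1} (ξ : ScTangent A p)
    {φ : ScChart M X.nonneg} (hφ : φ ∈ A) (hp : p.1 ∈ φ.source) :
    ScTangent.mk A p φ hφ hp (ξ.coord A φ) = ξ := by
  obtain ⟨v, hv⟩ := ScTangent.exists_mk_eq hB hA ξ hφ hp
  have h := Classical.epsilon_spec
    (p := fun v => ∃ hφ hp, ScTangent.mk A p φ hφ hp v = ξ) ⟨v, hφ, hp, hv⟩
  obtain ⟨_, _, h⟩ := h
  exact h

theorem ScTangent.coord_mk (hX : X.IsBanachScale) (hω : CenterNondegenerate X ω)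
    (hB : IsSymplecticAtlas X ω B)
    (hA : A = maximalSymplecticAtlas X ω B) (p : levelPoints A 1) {φ : ScChart M X.nonneg}
    (hφ : φ ∈ A) (hp : p.1 ∈ φ.source) (v : X.nonneg.level 0) :
    (ScTangent.mk A p φ hφ hp v).coord A φ = v :=
  ScTangent.mk_injective hX hω hB hA p hφ hp (ScTangent.mk_coord hB hA _ hφ hp)

theorem ScTangent.coord_mk_of_transition (hX : X.IsBanachScale) (hω : CenterNondegenerate X ω)
    (hB : IsSymplecticAtlas X ω B)
    (hA : A = maximalSymplecticAtlas X ω B) (p : levelPoints A 1) {φ ψ : ScChart M X.nonneg}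
    (hφ : φ ∈ A) (hψ : ψ ∈ A) (hpφ : p.1 ∈ φ.source) (hpψ : p.1 ∈ ψ.source)
    (T : TransitionData X ω φ ψ) (v : X.nonneg.level 0) :
    (ScTangent.mk A p φ hφ hpφ v).coord A ψ = T.DG 0 ((φ.one A).toFun p, v) := by
  rw [ScTangent.mk_eq_mk hφ hψ hpφ hpψ T, ScTangent.coord_mk hX hω hB hA p hψ hpψ]

/-- `tangentForm` uses an arbitrarily chosen chart; invariance of the form under transitions lets
any chart of `B` replace it. -/
theorem tangentForm_eq (hX : X.IsBanachScale) (hω : CenterNondegenerate X ω)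
    (hB : IsSymplecticAtlas X ω B)
    (hA : A = maximalSymplecticAtlas X ω B) (p : levelPoints A 1) {ψ : ScChart M X.nonneg}
    (hψ : ψ ∈ B) (hpψ : p.1 ∈ ψ.source) (ξ η : ScTangent A p) :
    tangentForm X ω A p ξ η = centerForm X ω (ξ.coord A ψ) (η.coord A ψ) := by
  have hψA : ψ ∈ A := by subst hA; exact subset_maximalSymplecticAtlas hB hψ
  have hφ : Classical.choose p.2 ∈ A := (Classical.choose_spec p.2).1
  have hpφ : p.1 ∈ (Classical.choose p.2).source := (Classical.choose_spec p.2).2.1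
  rw [tangentForm]
  generalize Classical.choose p.2 = φ at hφ hpφ ⊢
  have hT : Nonempty (TransitionData X ω φ ψ) := by
    subst hA; exact (hφ.2 ψ hψ).1.nonempty_transitionData
  obtain ⟨T⟩ := hT
  have hx : (φ.one A).toFun p ∈ shiftSet (φ.overlap ψ) :=
    one_mem_levelSet hB hA p hφ hpφ (ScChart.mem_overlap hpφ hpψ)
  have h : ∀ ζ : ScTangent A p, ζ.coord A ψ = T.DG 0 ((φ.one A).toFun p, ζ.coord A φ) := by
    intro ζ
    conv_lhs => rw [← ScTangent.mk_coord hB hA ζ hφ hpφ]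
    exact ScTangent.coord_mk_of_transition hX hω hB hA p hφ hψA hpφ hpψ T _
  rw [h ξ, h η, T.symplectic _ hx]

/-- A continuous linear functional in a chart of the given atlas defines a cotangent vector. -/
def cotangentOfChart (hX : X.IsBanachScale) (hω : CenterNondegenerate X ω)
    (hB : IsSymplecticAtlas X ω B)
    (hA : A = maximalSymplecticAtlas X ω B) (p : levelPoints A 1) {ψ : ScChart M X.nonneg}
    (hψ : ψ ∈ B) (hpψ : p.1 ∈ ψ.source) (L : X.nonneg.level 0 →L[ℝ] ℝ) : ScCotangent A p :=
  ⟨fun ξ => L (ξ.coord A ψ), fun φ hφ hpφ => by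
    have hψA : ψ ∈ A := by subst hA; exact subset_maximalSymplecticAtlas hB hψ
    have hT : Nonempty (TransitionData X ω φ ψ) := by
      subst hA; exact (hφ.2 ψ hψ).1.nonempty_transitionData
    obtain ⟨T⟩ := hT
    have hx : (φ.one A).toFun p ∈ levelSet (φ.overlap ψ) (0 + 1) :=
      one_mem_levelSet hB hA p hφ hpφ (ScChart.mem_overlap hpφ hpψ)
    refine ⟨L.comp (T.deriv.toCLM hx), fun v => ?_⟩
    exact congrArg L (ScTangent.coord_mk_of_transition hX hω hB hA p hφ hψA hpφ hpψ T v)⟩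

end Tangent

end

noncomputable section

open ScaleSystem

/-! ## Unitary groups of multipliers -/

namespace ScaleWeight

variable {W : ScaleWeight}

/-- Testing the difference `d` of the two vectors against `i d` produces `‖d‖²`. -/
theorem centerNondegenerate (W : ScaleWeight) : CenterNondegenerate W.scale W.stdForm := by
  intro v w h
  have h1 : W.l2Equiv _ v - W.l2Equiv _ w = 0 := by
    set d := W.l2Equiv _ v - W.l2Equiv _ w with hd
    have h2 := h ((W.l2Equiv _).symm (Complex.I • d))
    change W.stdForm _ _ (by simp) v _ = W.stdForm _ _ (by simp) w _ at h2
    rw [stdForm_eq_inner, stdForm_eq_inner, LinearIsometryEquiv.apply_symm_apply] at h2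
    have h3 : (inner ℂ (Complex.I • d) d).im = 0 := by
      rw [hd, inner_sub_right, Complex.sub_im]
      linarith
    rw [inner_smul_left, inner_self_eq_norm_sq_to_K] at h3
    have h4 : ‖d‖ ^ 2 = 0 := by
      have : -‖d‖ ^ 2 = 0 := by
        rw [← h3]
        simp [← Complex.ofReal_pow]
      linarith
    exact norm_eq_zero.1 (pow_eq_zero_iff two_ne_zero |>.1 h4)
  exact (W.l2Equiv _).injective (sub_eq_zero.1 h1)

theorem norm_exp_mul_I (t x : ℝ) : ‖Complex.exp ((t * x : ℝ) * Complex.I)‖ = 1 :=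
  Complex.norm_exp_ofReal_mul_I _

theorem norm_exp_sub_exp_le (t s x : ℝ) :
    ‖Complex.exp ((t * x : ℝ) * Complex.I) - Complex.exp ((s * x : ℝ) * Complex.I)‖
      ≤ |t - s| * |x| := by
  have h : Complex.exp ((t * x : ℝ) * Complex.I) - Complex.exp ((s * x : ℝ) * Complex.I)
      = Complex.exp ((s * x : ℝ) * Complex.I) *
        (Complex.exp (Complex.I * ((t - s) * x : ℝ)) - 1) := by
    rw [mul_sub, mul_one, ← Complex.exp_add]
    congr 2
    push_cast
    ring
  rw [h, norm_mul, norm_exp_mul_I, one_mul, ← abs_mul, ← Real.norm_eq_abs]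
  exact Real.norm_exp_I_mul_ofReal_sub_one_le

/-- The multiplication by `e^{itσ_n}`. -/
def unitaryMultiplier (W : ScaleWeight) (σ : ℤ → ℝ) (t : ℝ) (s : ℤ) : W.Seq s →L[ℝ] W.Seq s :=
  clmOfEntry
    { toFun := fun x => ⟨fun n => Complex.exp ((t * σ n : ℝ) * Complex.I) * x.entry n,
        mem_seqSubmodule_of_le (C := 1) (fun n => by
          rw [norm_mul, norm_exp_mul_I, one_mul, one_mul]) x.mem⟩
      map_add' := fun _ _ => Seq.ext (funext fun _ => mul_add _ _ _)
      map_smul' := fun _ _ => Seq.ext (funext fun _ => mul_left_comm _ _ _) }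
    fun n => continuous_const.mul (continuous_entry n)

theorem unitaryMultiplier_entry (σ : ℤ → ℝ) (t : ℝ) {s : ℤ} (x : W.Seq s) (n : ℤ) :
    (W.unitaryMultiplier σ t s x).entry n = Complex.exp ((t * σ n : ℝ) * Complex.I) * x.entry n :=
  rfl

theorem norm_unitaryMultiplier (σ : ℤ → ℝ) (t : ℝ) {s : ℤ} (x : W.Seq s) :
    ‖W.unitaryMultiplier σ t s x‖ = ‖x‖ :=
  norm_eq_of_norm_entry_eq fun n => by
    rw [unitaryMultiplier_entry, norm_mul, norm_exp_mul_I, one_mul]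

theorem unitaryMultiplier_zero (σ : ℤ → ℝ) {s : ℤ} (x : W.Seq s) :
    W.unitaryMultiplier σ 0 s x = x :=
  ext_entryCLM fun n => by rw [unitaryMultiplier_entry]; simp

/-- A symbol of size `O(ν)` costs exactly one level. The unimodular factor `c` covers both `σ` (with
`c = 1`) and the generator `iσ`. -/
theorem multiplier_bound {σ : ℤ → ℝ} {C : ℝ} (hσ : ∀ n, |σ n| ≤ C * W.ν n) (c : ℂ)
    (hc : ‖c‖ = 1) (m : ℕ) (z : ℂ) (n : ℤ) :
    W.ν n ^ (m : ℤ) * ‖c * (σ n * z)‖ ≤ C * (W.ν n ^ ((m + 1 : ℕ) : ℤ) * ‖z‖) := by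
  rw [norm_mul, norm_mul, hc, one_mul, Complex.norm_real, Real.norm_eq_abs, Nat.cast_add,
    Nat.cast_one, zpow_add_one₀ (W.pos n).ne']
  have h := mul_le_mul_of_nonneg_right (hσ n)
    (mul_nonneg (zpow_pos (W.pos n) (m : ℤ)).le (norm_nonneg z))
  nlinarith

theorem multiplier_mem {σ : ℤ → ℝ} {C : ℝ} (hσ : ∀ n, |σ n| ≤ C * W.ν n) {c : ℂ} (hc : ‖c‖ = 1)
    {m : ℕ} {x : ℤ → ℂ} (hx : x ∈ W.seqSubmodule ((m + 1 : ℕ) : ℤ)) :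
    (fun n => c * (σ n * x n)) ∈ W.seqSubmodule (m : ℤ) :=
  mem_seqSubmodule_of_le (fun n => multiplier_bound hσ c hc m (x n) n) hx

/-- The multiplication by `c σ_n`, as an operator of order one. -/
def multiplierCLM (W : ScaleWeight) (σ : ℤ → ℝ) {C : ℝ} (hσ : ∀ n, |σ n| ≤ C * W.ν n) (c : ℂ)
    (hc : ‖c‖ = 1) (m : ℕ) : W.Seq ((m + 1 : ℕ) : ℤ) →L[ℝ] W.Seq (m : ℤ) :=
  clmOfEntry
    { toFun := fun x => ⟨fun n => c * (σ n * x.entry n), multiplier_mem hσ hc x.mem⟩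
      map_add' := fun x y => Seq.ext (funext fun n => by
        change c * (σ n * (x.entry n + y.entry n)) = c * (σ n * x.entry n) + c * (σ n * y.entry n)
        ring)
      map_smul' := fun r x => Seq.ext (funext fun n => by
        change c * (σ n * (r * x.entry n)) = r * (c * (σ n * x.entry n))
        ring) }
    fun n => continuous_const.mul (continuous_const.mul (continuous_entry n))

theorem multiplierCLM_entry {σ : ℤ → ℝ} {C : ℝ} (hσ : ∀ n, |σ n| ≤ C * W.ν n) {c : ℂ}
    (hc : ‖c‖ = 1) {m : ℕ} (x : W.Seq ((m + 1 : ℕ) : ℤ)) (n : ℤ) :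
    (W.multiplierCLM σ hσ c hc m x).entry n = c * (σ n * x.entry n) := rfl

theorem multiplierCLM_bond {σ : ℤ → ℝ} {C : ℝ} (hσ : ∀ n, |σ n| ≤ C * W.ν n) {c : ℂ}
    (hc : ‖c‖ = 1) {r s : ℕ} (h : r ≤ s) (x : W.scale.nonneg.level (s + 1)) :
    W.multiplierCLM σ hσ c hc r (W.scale.nonneg.bond (Nat.add_le_add_right h 1) x)
      = W.scale.nonneg.bond h (W.multiplierCLM σ hσ c hc s x) := by
  apply Seq.ext
  rw [nonneg_bond_entry]
  funext n
  rw [multiplierCLM_entry, nonneg_bond_entry, multiplierCLM_entry]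

/-- Orbits from the next level are Lipschitz in time. That level is dense, and the isometry property
carries continuity over by an `ε / 3` argument. -/
theorem continuous_unitaryMultiplier {σ : ℤ → ℝ} {C : ℝ} (hσ : ∀ n, |σ n| ≤ C * W.ν n) (m : ℕ)
    (y : W.Seq (m : ℤ)) : Continuous fun t => W.unitaryMultiplier σ t (m : ℤ) y := by
  refine Metric.continuous_iff'.2 fun t ε hε => ?_
  obtain ⟨_, hz, ⟨z, rfl⟩⟩ := Metric.dense_iff.1
    (dense_range_nonneg_bond (W := W) (Nat.le_add_right m 1)) y (ε / 3) (div_pos hε three_pos)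
  set z' := W.scale.nonneg.bond (Nat.le_add_right m 1) z with hz'
  have hzy : ‖z' - y‖ < ε / 3 := by rwa [Metric.mem_ball, dist_eq_norm] at hz
  set K := ‖W.multiplierCLM σ hσ 1 norm_one m z‖ with hK
  have hlip : ∀ s, ‖W.unitaryMultiplier σ s (m : ℤ) z' - W.unitaryMultiplier σ t (m : ℤ) z'‖
      ≤ |s - t| * K := by
    intro s
    refine norm_le_of_entry_le (abs_nonneg _) fun n => ?_
    rw [Seq.entry_sub, Pi.sub_apply, unitaryMultiplier_entry, unitaryMultiplier_entry, ← sub_mul,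
      norm_mul, hz', nonneg_bond_entry, multiplierCLM_entry, one_mul, norm_mul, Complex.norm_real,
      Real.norm_eq_abs]
    have h1 := mul_le_mul_of_nonneg_right (norm_exp_sub_exp_le s t (σ n))
      (mul_nonneg (norm_nonneg (z.entry n)) (zpow_pos (W.pos n) (m : ℤ)).le)
    nlinarith
  have hlim : Tendsto (fun s => |s - t| * K) (𝓝 t) (𝓝 0) := by
    have : Continuous fun s => |s - t| * K := by fun_prop
    simpa using this.tendsto t
  filter_upwards [hlim.eventually (gt_mem_nhds (show 0 < ε / 3 by positivity))] with s hs
  have e : W.unitaryMultiplier σ s (m : ℤ) y - W.unitaryMultiplier σ t (m : ℤ) y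
      = (W.unitaryMultiplier σ s (m : ℤ) z' - W.unitaryMultiplier σ t (m : ℤ) z')
        - W.unitaryMultiplier σ s (m : ℤ) (z' - y) + W.unitaryMultiplier σ t (m : ℤ) (z' - y) := by
    simp only [map_sub]; abel
  rw [dist_eq_norm, e]
  have h1 := norm_add_le (W.unitaryMultiplier σ s (m : ℤ) z' - W.unitaryMultiplier σ t (m : ℤ) z'
    - W.unitaryMultiplier σ s (m : ℤ) (z' - y)) (W.unitaryMultiplier σ t (m : ℤ) (z' - y))
  have h2 := norm_sub_le (W.unitaryMultiplier σ s (m : ℤ) z' - W.unitaryMultiplier σ t (m : ℤ) z')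
    (W.unitaryMultiplier σ s (m : ℤ) (z' - y))
  rw [norm_unitaryMultiplier] at h1 h2
  linarith [hlip s]

/-- The orbit equals `y'` plus the integral of the continuous curve `S_r z`, and such an integral is
differentiable. The equality is checked entrywise, by the fundamental theorem for scalar functions.
-/
theorem hasDerivAt_unitaryMultiplier {σ : ℤ → ℝ} {C : ℝ} (hσ : ∀ n, |σ n| ≤ C * W.ν n) (m : ℕ)
    (t : ℝ) (y : W.scale.nonneg.level (m + 1)) :
    HasDerivAt (fun t => W.unitaryMultiplier σ t (m : ℤ)
        (W.scale.nonneg.bond (Nat.le_add_right m 1) y))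
      (W.unitaryMultiplier σ t (m : ℤ)
        (W.multiplierCLM σ hσ Complex.I Complex.norm_I m y)) t := by
  set z := W.multiplierCLM σ hσ Complex.I Complex.norm_I m y with hz
  set y' : W.Seq (m : ℤ) := W.scale.nonneg.bond (Nat.le_add_right m 1) y with hy'
  have hc := continuous_unitaryMultiplier hσ m z
  have h1 := (hc.integral_hasStrictDerivAt 0 t).hasDerivAt.const_add y'
  refine h1.congr_of_eventuallyEq (Eventually.of_forall fun s => ext_entryCLM fun n => ?_)
  have hd : ∀ r : ℝ, HasDerivAt (fun r : ℝ => Complex.exp ((r * σ n : ℝ) * Complex.I) * y.entry n)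
      ((W.unitaryMultiplier σ r (m : ℤ) z).entry n) r := by
    intro r
    have h2 : HasDerivAt (fun r : ℝ => ((r * σ n : ℝ) : ℂ) * Complex.I) (σ n * Complex.I) r := by
      have h3 : HasDerivAt (fun r : ℝ => r * σ n) (σ n) r := by
        simpa using (hasDerivAt_id r).mul_const (σ n)
      exact h3.ofReal_comp.mul_const Complex.I
    have h4 := (h2.cexp).mul_const (y.entry n)
    have e : (W.unitaryMultiplier σ r (m : ℤ) z).entry n
        = Complex.exp ((r * σ n : ℝ) * Complex.I) * (σ n * Complex.I) * y.entry n := by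
      rw [unitaryMultiplier_entry, hz, multiplierCLM_entry]
      ring
    rw [e]
    exact h4
  have hint : W.entryCLM (m : ℤ) n (∫ r in (0 : ℝ)..s, W.unitaryMultiplier σ r (m : ℤ) z)
      = ∫ r in (0 : ℝ)..s, (W.unitaryMultiplier σ r (m : ℤ) z).entry n :=
    (ContinuousLinearMap.intervalIntegral_comp_comm _ (hc.intervalIntegrable 0 s)).symm
  rw [intervalIntegral.integral_eq_sub_of_hasDerivAt (fun r _ => hd r)
    (((continuous_entry n).comp hc).intervalIntegrable 0 s)] at hint
  rw [unitaryMultiplier_entry, Seq.entry_add, Pi.add_apply]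
  rw [entryCLM_apply] at hint
  rw [hint, hy', nonneg_bond_entry]
  simp

/-- The group `e^{itσ}` for a real multiplier of order one. -/
def unitaryGroup (W : ScaleWeight) (σ : ℤ → ℝ) {C : ℝ} (hσ : ∀ n, |σ n| ≤ C * W.ν n) :
    ScGroup W.scale.nonneg where
  S t m := W.unitaryMultiplier σ t (m : ℤ)
  A m := W.multiplierCLM σ hσ Complex.I Complex.norm_I m
  bond_S t r s h y := by
    apply Seq.ext
    rw [nonneg_bond_entry]
    funext n
    rw [unitaryMultiplier_entry, unitaryMultiplier_entry, nonneg_bond_entry]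
  bond_A h y := multiplierCLM_bond hσ Complex.norm_I h y
  norm_S t m y := norm_unitaryMultiplier σ t y
  cont_S m y := continuous_unitaryMultiplier hσ m y
  deriv m t y := hasDerivAt_unitaryMultiplier hσ m t y

theorem pairing_conj {s t : ℤ} (x : W.Seq s) (y : W.Seq t) :
    (starRingEnd ℂ) (W.pairing x y) = W.pairing y x := by
  rw [pairing, Complex.conj_tsum, pairing]
  refine tsum_congr fun n => ?_
  rw [map_mul, Complex.conj_conj, mul_comm]

end ScaleWeight

end

noncomputable section

open ScaleSystem ScaleWeight

/-! ## The filtration of `P(L²)` -/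

theorem sobolevWeight_skip_le (a n : ℤ) : sobolevWeight.ν (skip a n) ≤ 3 * sobolevWeight.ν n := by
  change 1 + ((skip a n : ℤ) : ℝ) ^ 2 ≤ 3 * (1 + (n : ℝ) ^ 2)
  unfold skip
  split_ifs
  · nlinarith [sq_nonneg (n : ℝ)]
  · push_cast
    nlinarith [sq_nonneg ((n : ℝ) - 1), sq_nonneg (n : ℝ)]

theorem sobolevWeight_le_skip (a n : ℤ) : sobolevWeight.ν n ≤ 3 * sobolevWeight.ν (skip a n) := by
  change 1 + (n : ℝ) ^ 2 ≤ 3 * (1 + ((skip a n : ℤ) : ℝ) ^ 2)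
  unfold skip
  split_ifs
  · nlinarith [sq_nonneg (n : ℝ)]
  · push_cast
    nlinarith [sq_nonneg ((n : ℝ) + 1), sq_nonneg ((n : ℝ) + 2), sq_nonneg (n : ℝ)]

theorem ScaleWeight.mem_seqSubmodule_natCast {W : ScaleWeight} {m : ℕ} {x : ℤ → ℂ} :
    x ∈ W.seqSubmodule (m : ℤ) ↔ Summable fun n => (W.ν n ^ m * ‖x n‖) ^ 2 := by
  change Memℓp _ 2 ↔ _
  rw [memℓp_gen_iff (by simp)]
  refine summable_congr fun n => ?_
  simp [abs_of_pos (W.pos n)]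

/-- Neighbouring weights `1 + n²` differ by at most a factor `3`, so deletion of an entry respects
every level. For general weights this holds on level zero only by the argument given there. -/
theorem sobolevWeight_mem_comp_skip (a : ℤ) (m : ℕ) (x : ℤ → ℂ) :
    (fun n => x (skip a n)) ∈ sobolevWeight.seqSubmodule (m : ℤ) ↔
      x ∈ sobolevWeight.seqSubmodule (m : ℤ) := by
  rw [mem_seqSubmodule_natCast, mem_seqSubmodule_natCast,
    ← summable_comp_skip a fun n => (sobolevWeight.ν n ^ m * ‖x n‖) ^ 2]
  -- Stated for two comparable weights so that it can be applied in both directions.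
  have key : ∀ {α β : ℤ → ℝ}, (∀ n, 0 < α n) → (∀ n, 0 < β n) → (∀ n, α n ≤ 3 * β n) →
      (Summable fun n => (β n ^ m * ‖x (skip a n)‖) ^ 2) →
      Summable fun n => (α n ^ m * ‖x (skip a n)‖) ^ 2 := by
    intro α β hα hβ h hs
    refine Summable.of_nonneg_of_le (fun n => sq_nonneg _) (fun n => ?_) (hs.mul_left ((3 ^ m) ^ 2))
    rw [← mul_pow, ← mul_assoc, ← mul_pow]
    have h1 := hα n
    have h2 := h n
    gcongr
  exact ⟨key (fun n => sobolevWeight.pos _) (fun n => sobolevWeight.pos _)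
    (sobolevWeight_skip_le a), key (fun n => sobolevWeight.pos _) (fun n => sobolevWeight.pos _)
    (sobolevWeight_le_skip a)⟩

theorem isSymplecticAtlas_circle : IsSymplecticAtlas sobolevWeight.scale sobolevWeight.stdForm
    (darbouxAtlas circleBasis sobolevWeight) :=
  isSymplecticAtlas_darbouxAtlas _ _

theorem circleChart_mem (a : ℤ) : darbouxChart circleBasis sobolevWeight a ∈ circleStructure :=
  darbouxChart_mem_projectiveStructure _ _ a

theorem circleChart_mem_range_iff {a : ℤ} {m : ℕ} {u : L2Circle} (hu : u ≠ 0)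
    (ha : circleBasis.repr u a ≠ 0) :
    (darbouxChart circleBasis sobolevWeight a).toFun (Projectivization.mk ℂ u hu) ∈
        range (sobolevWeight.scale.nonneg.bond (Nat.zero_le m)) ↔
      (fun n => circleBasis.repr u n) ∈ sobolevWeight.seqSubmodule (m : ℤ) := by
  rw [mem_range_nonneg_bond, darbouxChart_toFun_mk, darbouxMap, Seq.entry_smul,
    Submodule.smul_mem_iff]
  · rw [← sobolevWeight_mem_comp_skip a m fun n => circleBasis.repr u n]
    simp only [← coeff_entry circleBasis sobolevWeight]
    rfl
  · refine phase_ne_zero ?_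
    rwa [coeff_entry]

theorem exists_repr_ne_zero {u : L2Circle} (hu : u ≠ 0) : ∃ a, circleBasis.repr u a ≠ 0 := by
  by_contra hcon
  push Not at hcon
  apply hu
  apply circleBasis.repr.injective
  rw [map_zero]
  ext n
  exact hcon n

theorem mk_mem_levelPoints_iff (m : ℕ) (u : L2Circle) (hu : u ≠ 0) :
    Projectivization.mk ℂ u hu ∈ levelPoints circleStructure m ↔
      (fun n => circleBasis.repr u n) ∈ sobolevWeight.seqSubmodule m := by
  obtain ⟨a, ha⟩ := exists_repr_ne_zero hu
  have hs : Projectivization.mk ℂ u hu ∈ (darbouxChart circleBasis sobolevWeight a).source :=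
    (mk_mem_darbouxChart_source _ _ a u hu).2 ha
  rw [← circleChart_mem_range_iff hu ha]
  exact ⟨fun h => mem_range_bond_of_levelPoints isSymplecticAtlas_circle rfl h (circleChart_mem a) hs,
    fun h => ⟨_, circleChart_mem a, hs, h⟩⟩

/-! ## The flow in the charts -/

theorem sigmaCoeff_eq (a n : ℤ) : sigmaCoeff a n = (a : ℝ) ^ 2 - (skip a n : ℝ) ^ 2 := by
  unfold sigmaCoeff skip
  split_ifs
  · rfl
  · push_cast; rfl

/-- The constant comes from `|a² - k²| ≤ a² + k²` with `k = skip a n` and `k² ≤ 3 (1 + n²)`. -/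
theorem abs_sigmaCoeff_le (a n : ℤ) :
    |sigmaCoeff a n| ≤ ((a : ℝ) ^ 2 + 3) * sobolevWeight.ν n := by
  have h1 : 1 + (skip a n : ℝ) ^ 2 ≤ 3 * (1 + (n : ℝ) ^ 2) := sobolevWeight_skip_le a n
  change _ ≤ ((a : ℝ) ^ 2 + 3) * (1 + (n : ℝ) ^ 2)
  have h2 : 0 ≤ (a : ℝ) ^ 2 * (n : ℝ) ^ 2 := by positivity
  rw [sigmaCoeff_eq, abs_le]
  constructor <;> nlinarith [sq_nonneg (a : ℝ), sq_nonneg (n : ℝ), sq_nonneg (skip a n : ℝ)]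

/-- The group `e^{itσ_a}`. -/
def sigmaGroup (a : ℤ) : ScGroup sobolevWeight.scale.nonneg :=
  sobolevWeight.unitaryGroup (sigmaCoeff a) (abs_sigmaCoeff_le a)

theorem sigmaOp_entry (a : ℤ) {m : ℕ} (x : sobolevWeight.scale.nonneg.level (m + 1)) (n : ℤ) :
    (sigmaOp a m x).entry n = (sigmaCoeff a n : ℂ) * x.entry n := by
  have h := multiplier_mem (abs_sigmaCoeff_le a) norm_one x.mem
  simp only [one_mul] at h
  exact congrFun (ofSeq_entry h) n

theorem sigmaOp_eq (a : ℤ) (m : ℕ) (x : sobolevWeight.scale.nonneg.level (m + 1)) :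
    sigmaOp a m x = sobolevWeight.multiplierCLM (sigmaCoeff a) (abs_sigmaCoeff_le a) 1 norm_one m x :=
  ext_entryCLM fun n => by rw [sigmaOp_entry, multiplierCLM_entry, one_mul]

theorem isScOperator_sigmaOp (a : ℤ) : IsScOperator (sigmaOp a) := by
  have h : sigmaOp a = fun m (x : (sobolevWeight.scale.nonneg.shift 1).level m) =>
      sobolevWeight.multiplierCLM (sigmaCoeff a) (abs_sigmaCoeff_le a) 1 norm_one m x :=
    funext fun m => funext fun x => sigmaOp_eq a m x
  rw [h]
  exact ⟨fun m => (sobolevWeight.multiplierCLM (sigmaCoeff a) (abs_sigmaCoeff_le a) 1 norm_one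
    m).toLinearMap.isLinear,
    (isLevelSmooth_of_clm (X := sobolevWeight.scale.nonneg.shift 1) (Y := sobolevWeight.scale.nonneg)
      univ _ fun r s h x => multiplierCLM_bond _ norm_one h x).isSc0⟩

theorem sigmaGroup_S_entry (a : ℤ) (t : ℝ) {m : ℕ} (x : sobolevWeight.scale.nonneg.level m) (n : ℤ) :
    ((sigmaGroup a).S t m x).entry n = Complex.exp ((t * sigmaCoeff a n : ℝ) * Complex.I) * x.entry n :=
  rfl

theorem sigmaGroup_A_entry (a : ℤ) {m : ℕ} (x : sobolevWeight.scale.nonneg.level (m + 1)) (n : ℤ) :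
    ((sigmaGroup a).A m x).entry n = Complex.I * (sigmaOp a m x).entry n := by
  rw [sigmaOp_entry]; rfl

theorem sigmaGroup_S_zero (a : ℤ) {m : ℕ} (x : sobolevWeight.scale.nonneg.level m) :
    (sigmaGroup a).S 0 m x = x := unitaryMultiplier_zero _ x

theorem sigmaGroup_A_S (a : ℤ) (t : ℝ) (m : ℕ) (x : sobolevWeight.scale.nonneg.level (m + 1)) :
    (sigmaGroup a).A m ((sigmaGroup a).S t (m + 1) x) = (sigmaGroup a).S t m ((sigmaGroup a).A m x) :=
  ext_entryCLM fun n => by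
    rw [sigmaGroup_A_entry, sigmaOp_entry, sigmaGroup_S_entry, sigmaGroup_S_entry,
      sigmaGroup_A_entry, sigmaOp_entry]
    ring

theorem repr_schrodinger (t : ℝ) (u : L2Circle) (n : ℤ) :
    circleBasis.repr (schrodinger t u) n
      = Complex.exp (-Complex.I * t * (n : ℂ) ^ 2) * circleBasis.repr u n := by
  change circleBasis.repr (circleBasis.repr.symm (schrodingerSeq t (circleBasis.repr u))) n = _
  rw [LinearIsometryEquiv.apply_symm_apply]
  rfl

theorem projectivization_map_mk {V : Type*} [AddCommGroup V] [Module ℂ V] (f : V →ₗ[ℂ] V)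
    (hf : Function.Injective f) (v : V) (hv : v ≠ 0) (hv' : f v ≠ 0) :
    Projectivization.map f hf (Projectivization.mk ℂ v hv) = Projectivization.mk ℂ (f v) hv' :=
  rfl

theorem schrodinger_ne_zero (t : ℝ) {u : L2Circle} (hu : u ≠ 0) : schrodinger t u ≠ 0 :=
  fun h => hu (schrodinger_injective t (h.trans (map_zero _).symm))

theorem projectiveFlow_mk (t : ℝ) (u : L2Circle) (hu : u ≠ 0) : ∃ hu' : schrodinger t u ≠ 0,
    projectiveFlow (t, Projectivization.mk ℂ u hu) = Projectivization.mk ℂ (schrodinger t u) hu' :=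
  ⟨schrodinger_ne_zero t hu, projectivization_map_mk _ _ u hu _⟩

theorem projectiveFlow_mem (a : ℤ) (t : ℝ) {p : ℙ ℂ L2Circle}
    (hp : p ∈ (darbouxChart circleBasis sobolevWeight a).source) :
    projectiveFlow (t, p) ∈ (darbouxChart circleBasis sobolevWeight a).source := by
  induction p using Projectivization.ind with | _ u hu => ?_
  obtain ⟨hu', e⟩ := projectiveFlow_mk t u hu
  rw [mk_mem_darbouxChart_source] at hp
  rw [e, mk_mem_darbouxChart_source, repr_schrodinger]
  exact mul_ne_zero (Complex.exp_ne_zero _) hp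

theorem norm_coeff_schrodinger (t : ℝ) (u : L2Circle) :
    ‖coeff circleBasis sobolevWeight (schrodinger t u)‖ = ‖coeff circleBasis sobolevWeight u‖ :=
  norm_eq_of_norm_entry_eq fun n => by
    rw [coeff_entry, coeff_entry, repr_schrodinger, norm_mul, norm_schrodingerPhase, one_mul]

/-- The flow rotates the mode `k = skip a n` by `e^{-itk²}`, and the phase factor of the chart
divides by `e^{-ita²}`. The quotient is `e^{it(a² - k²)}`; norms are unchanged. -/
theorem circleChart_projectiveFlow (a : ℤ) (t : ℝ) {p : ℙ ℂ L2Circle}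
    (_hp : p ∈ (darbouxChart circleBasis sobolevWeight a).source) :
    (darbouxChart circleBasis sobolevWeight a).toFun (projectiveFlow (t, p))
      = (sigmaGroup a).S t 0 ((darbouxChart circleBasis sobolevWeight a).toFun p) := by
  induction p using Projectivization.ind with | _ u hu => ?_
  obtain ⟨hu', e⟩ := projectiveFlow_mk t u hu
  rw [e, darbouxChart_toFun_mk, darbouxChart_toFun_mk]
  refine ext_entryCLM fun n => ?_
  rw [sigmaGroup_S_entry, darbouxMap, darbouxMap, Seq.entry_smul, Seq.entry_smul, Pi.smul_apply,
    Pi.smul_apply, drop_entry, drop_entry, norm_coeff_schrodinger, coeff_entry, coeff_entry,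
    coeff_entry, coeff_entry, repr_schrodinger, repr_schrodinger, smul_eq_mul, smul_eq_mul]
  have h1 := phase_mul (z := circleBasis.repr u a) (r := ‖coeff circleBasis sobolevWeight u‖)
    (Complex.exp_ne_zero (-Complex.I * t * (a : ℂ) ^ 2))
  rw [norm_schrodingerPhase, one_mul] at h1
  rw [← h1, sigmaCoeff_eq]
  have h2 : Complex.exp (-Complex.I * t * (skip a n : ℂ) ^ 2)
      = Complex.exp ((t * ((a : ℝ) ^ 2 - (skip a n : ℝ) ^ 2) : ℝ) * Complex.I) *
        Complex.exp (-Complex.I * t * (a : ℂ) ^ 2) := by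
    rw [← Complex.exp_add]
    congr 1
    push_cast
    ring
  rw [h2]
  ring

/-- The chart of the whole real line. -/
def realChart : ScChart ℝ realLine := ⟨univ, fun t => t⟩

theorem realChart_mem : realChart ∈ realCharts := ⟨isOpen_univ, rfl⟩

theorem exists_circleChart (p : ℙ ℂ L2Circle) :
    ∃ a, p ∈ (darbouxChart circleBasis sobolevWeight a).source := by
  obtain ⟨_, ⟨a, rfl⟩, h⟩ := isSymplecticAtlas_circle.cover p
  exact ⟨a, h⟩

theorem mapsTo_projectiveFlow (a : ℤ) : MapsTo projectiveFlow
    (realChart.prod (darbouxChart circleBasis sobolevWeight a)).source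
    (darbouxChart circleBasis sobolevWeight a).source :=
  fun z hz => projectiveFlow_mem a z.1 hz.2

theorem represents_projectiveFlow (a : ℤ) :
    (realChart.prod (darbouxChart circleBasis sobolevWeight a)).Represents
      (darbouxChart circleBasis sobolevWeight a) projectiveFlow (sigmaGroup a).flow :=
  fun z hz => (circleChart_projectiveFlow a z.1 hz.2).symm

/-- Moduli of coefficients are conserved, so each chart domain is invariant for all times, and one
chart serves for source and target over the whole real line. -/
theorem isScSmoothMap_projectiveFlow :
    IsScSmoothMap (prodCharts realCharts circleStructure) circleStructure projectiveFlow := by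
  rintro ⟨t, p⟩
  obtain ⟨a, ha⟩ := exists_circleChart p
  exact ⟨_, ⟨_, realChart_mem, _, circleChart_mem a, rfl⟩, _, circleChart_mem a, ⟨mem_univ _, ha⟩,
    mapsTo_projectiveFlow a, _, represents_projectiveFlow a,
    ((sigmaGroup a).isScSmooth_flow (hasCompactBonds_nonneg _)).mono (subset_univ _)⟩

theorem projectiveFlow_zero (p : ℙ ℂ L2Circle) : projectiveFlow (0, p) = p := by
  obtain ⟨a, ha⟩ := exists_circleChart p
  refine (isChart_darbouxChart circleBasis sobolevWeight a).injOn (projectiveFlow_mem a 0 ha) ha ?_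
  rw [circleChart_projectiveFlow a 0 ha, sigmaGroup_S_zero]

/-! ## The vector field -/

/-- The chart `ψ_a` on the first level. -/
abbrev circleOne (a : ℤ) :
    ScChart (levelPoints circleStructure 1) (sobolevWeight.scale.nonneg.shift 1) :=
  (darbouxChart circleBasis sobolevWeight a).one circleStructure

theorem bond_circleOne {a : ℤ} (p : levelPoints circleStructure 1)
    (hp : p.1 ∈ (darbouxChart circleBasis sobolevWeight a).source) :
    sobolevWeight.scale.nonneg.bond (Nat.zero_le (0 + 1)) ((circleOne a).toFun p)
      = (darbouxChart circleBasis sobolevWeight a).toFun p.1 :=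
  bond_one isSymplecticAtlas_circle rfl p (circleChart_mem a) hp

theorem projectiveFlow_levelPoints (t : ℝ) (p : levelPoints circleStructure 1) :
    projectiveFlow (t, p.1) ∈ levelPoints circleStructure 1 := by
  obtain ⟨a, ha⟩ := exists_circleChart p.1
  refine ⟨_, circleChart_mem a, projectiveFlow_mem a t ha, ?_⟩
  rw [circleChart_projectiveFlow a t ha, ← bond_circleOne p ha, (sigmaGroup a).bond_S]
  exact mem_range_self _

theorem circleOne_projectiveFlow {a : ℤ} (t : ℝ) (p : levelPoints circleStructure 1)
    (hp : p.1 ∈ (darbouxChart circleBasis sobolevWeight a).source) :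
    (circleOne a).toFun ⟨projectiveFlow (t, p.1), projectiveFlow_levelPoints t p⟩
      = (sigmaGroup a).S t (0 + 1) ((circleOne a).toFun p) := by
  apply nonneg_bond_injective (Nat.zero_le (0 + 1))
  rw [bond_circleOne _ (projectiveFlow_mem a t hp), ← (sigmaGroup a).bond_S, bond_circleOne p hp,
    circleChart_projectiveFlow a t hp]

/-- The transition maps intertwine the generators. -/
theorem levelDeriv_transition_generator {a c : ℤ} (p : levelPoints circleStructure 1)
    (ha : p.1 ∈ (darbouxChart circleBasis sobolevWeight a).source)
    (hc : p.1 ∈ (darbouxChart circleBasis sobolevWeight c).source) :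
    levelDeriv (sobolevWeight.transition a c) 0
        ((circleOne a).toFun p, (sigmaGroup a).A 0 ((circleOne a).toFun p))
      = (sigmaGroup c).A 0 ((circleOne c).toFun p) := by
  have hdom : (darbouxChart circleBasis sobolevWeight a).toFun p.1
      ∈ sobolevWeight.transitionDomain a c :=
    overlap_darbouxChart_subset _ _ a c (ScChart.mem_overlap ha hc)
  have h1 := (sigmaGroup a).deriv 0 0 ((circleOne a).toFun p)
  have h2 := (sigmaGroup c).deriv 0 0 ((circleOne c).toFun p)
  rw [sigmaGroup_S_zero] at h1 h2
  have e1 : sobolevWeight.scale.nonneg.bond (Nat.le_add_right 0 1) ((circleOne a).toFun p) = _ :=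
    bond_circleOne p ha
  have e2 : sobolevWeight.scale.nonneg.bond (Nat.le_add_right 0 1) ((circleOne c).toFun p) = _ :=
    bond_circleOne p hc
  change fderiv ℝ (sobolevWeight.transition a c 0)
    (sobolevWeight.scale.nonneg.bond (Nat.le_add_right 0 1) ((circleOne a).toFun p)) _ = _
  rw [e1] at h1 ⊢
  rw [e2] at h2
  have h3 : HasFDerivAt (sobolevWeight.transition a c 0)
      (fderiv ℝ (sobolevWeight.transition a c 0)
        ((darbouxChart circleBasis sobolevWeight a).toFun p.1))
      ((darbouxChart circleBasis sobolevWeight a).toFun p.1) :=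
    (((isLevelSmooth_transition a c).smooth 0).contDiffAt
      ((isOpen_levelSet (isOpen_transitionDomain a c) 0).mem_nhds
        (mem_levelSet_zero.2 hdom))).differentiableAt (by simp) |>.hasFDerivAt
  -- The transition map carries the orbit in the chart `a` to the orbit in the chart `c`; both sides
  -- of the claim are velocities of that curve at time zero.
  have h4 := h3.comp_hasDerivAt_of_eq (0 : ℝ) h1 (sigmaGroup_S_zero a _).symm
  refine h4.unique (h2.congr_of_eventuallyEq (Eventually.of_forall fun t => ?_))
  change sobolevWeight.transition a c 0 ((sigmaGroup a).S t 0 _) = (sigmaGroup c).S t 0 _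
  rw [← circleChart_projectiveFlow a t ha, ← circleChart_projectiveFlow c t hc,
    transition_darbouxChart _ _ a c (projectiveFlow_mem a t ha)]

/-- An index of a chart around a point. -/
def chartIndex (p : ℙ ℂ L2Circle) : ℤ := Classical.choose (exists_circleChart p)

theorem mem_chartIndex (p : ℙ ℂ L2Circle) :
    p ∈ (darbouxChart circleBasis sobolevWeight (chartIndex p)).source :=
  Classical.choose_spec (exists_circleChart p)

/-- The generator of the flow on projective space. -/
def circleField (p : levelPoints circleStructure 1) : ScTangent circleStructure p :=
  ScTangent.mk circleStructure p _ (circleChart_mem (chartIndex p.1)) (mem_chartIndex p.1)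
    ((sigmaGroup (chartIndex p.1)).A 0 ((circleOne (chartIndex p.1)).toFun p))

theorem circleField_eq {c : ℤ} (p : levelPoints circleStructure 1)
    (hc : p.1 ∈ (darbouxChart circleBasis sobolevWeight c).source) :
    circleField p = ScTangent.mk circleStructure p _ (circleChart_mem c) hc
      ((sigmaGroup c).A 0 ((circleOne c).toFun p)) := by
  rw [← levelDeriv_transition_generator p (mem_chartIndex p.1) hc]
  have h := overlap_darbouxChart_subset circleBasis sobolevWeight (chartIndex p.1) c
  have hs := (isLevelSmooth_transition (W := sobolevWeight) (chartIndex p.1) c)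
  exact Quot.sound ⟨_, _, isTransition_darbouxChart _ _ _ c, hs.isSc0.mono h,
    (hs.isScDeriv (isOpen_transitionDomain _ c)).mono h, rfl⟩

theorem circleField_coord {c : ℤ} (p : levelPoints circleStructure 1)
    (hc : p.1 ∈ (darbouxChart circleBasis sobolevWeight c).source) :
    (circleField p).coord circleStructure (darbouxChart circleBasis sobolevWeight c)
      = (sigmaGroup c).A 0 ((circleOne c).toFun p) := by
  rw [circleField_eq p hc]
  exact ScTangent.coord_mk (isBanachScale_scale _) (centerNondegenerate _) isSymplecticAtlas_circle
    rfl p (circleChart_mem c) hc _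

/-- In charts the section is `x ↦ (x, A x)`, a compatible family of bounded linear maps, hence
levelwise smooth. -/
theorem isScSmoothVectorField_circleField : IsScSmoothVectorField circleStructure circleField := by
  intro p
  obtain ⟨a, ha⟩ := exists_circleChart p.1
  refine ⟨_, ⟨_, circleChart_mem a, rfl⟩,
    ⟨{z | z.1.1 ∈ (darbouxChart circleBasis sobolevWeight a).source},
      fun z => ((circleOne a).toFun z.1, z.2.coord circleStructure _)⟩,
    ⟨_, circleChart_mem a, rfl, rfl⟩, ha, fun q hq => hq,
    fun m x => (x, (sigmaGroup a).A m x), fun q hq => ?_, ?_⟩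
  · exact Prod.ext rfl (circleField_coord q hq).symm
  · have h := isLevelSmooth_of_clm (X := sobolevWeight.scale.nonneg.shift 1)
      (Y := sobolevWeight.scale.nonneg.tangent) univ
      (fun m => (ContinuousLinearMap.id ℝ (sobolevWeight.scale.nonneg.level (m + 1))).prod
        ((sigmaGroup a).A m)) fun r s h x => Prod.ext rfl ((sigmaGroup a).bond_A h x)
    exact (h.isScSmooth isOpen_univ).mono (subset_univ _)

theorem isGlobalFlow_projectiveFlow : IsGlobalFlow circleStructure circleField projectiveFlow where
  smooth := isScSmoothMap_projectiveFlow
  initial := projectiveFlow_zero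
  deriv t p := by
    refine ⟨⟨_, projectiveFlow_levelPoints t p⟩, rfl, rfl, ?_⟩
    obtain ⟨a, ha⟩ := exists_circleChart p.1
    have hq := projectiveFlow_mem a t ha
    refine ⟨_, realChart_mem, _, circleChart_mem a, _, circleChart_mem a, hq, mem_univ _, ha,
      mapsTo_projectiveFlow a, _, (sigmaGroup a).flowDeriv, represents_projectiveFlow a,
      (sigmaGroup a).isSc0_flow.mono (subset_univ _),
      (sigmaGroup a).isScDeriv_flow.mono (subset_univ _), ?_⟩
    rw [circleField_eq _ hq, circleOne_projectiveFlow t p ha]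
    refine congrArg (ScTangent.mk circleStructure _ _ (circleChart_mem a) hq) ?_
    -- The direction `(1, 0)` gives `S_t (A x)`, which equals `A (S_t x)`, the field at the moved
    -- point.
    change _ = (sigmaGroup a).S t 0 (0 + (1 : ℝ) • (sigmaGroup a).A 0 ((circleOne a).toFun p))
    rw [zero_add ((1 : ℝ) • _), one_smul]
    exact sigmaGroup_A_S a t 0 _

end

noncomputable section

open ScaleSystem ScaleWeight

/-! ## Weak derivatives on the circle -/

theorem circleBasis_repr (u : L2Circle) (n : ℤ) :
    circleBasis.repr u n = ∫ x, u x * fourier (-n) x ∂AddCircle.haarAddCircle := by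
  rw [circleBasis, fourierBasis_repr, fourierCoeff]
  simp only [smul_eq_mul, mul_comm]

theorem hasDerivAt_circleFourier (n : ℤ) (t : ℝ) :
    HasDerivAt (fun s : ℝ => fourier n (s : AddCircle (2 * Real.pi))) (Complex.I * n * fourier n (t : AddCircle (2 * Real.pi))) t := by
  convert hasDerivAt_fourier (2 * Real.pi) n t using 1
  have : (Real.pi : ℂ) ≠ 0 := Complex.ofReal_ne_zero.2 Real.pi_ne_zero
  push_cast
  field_simp

theorem contDiff_circleFourier (n : ℤ) :
    ContDiff ℝ (⊤ : ℕ∞) (fun t : ℝ => fourier n (t : AddCircle (2 * Real.pi))) := by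
  simp only [fourier_coe_apply]
  have h : ContDiff ℝ (⊤ : ℕ∞) fun t : ℝ => (t : ℂ) := Complex.ofRealCLM.contDiff
  exact (((contDiff_const.mul h).div_const _)).cexp

/-- Testing with `e^{-inx}` reads off the coefficient. -/
theorem HasWeakDeriv.repr {u v : L2Circle} (h : HasWeakDeriv u v) (n : ℤ) :
    circleBasis.repr v n = Complex.I * n * circleBasis.repr u n := by
  have h1 := h (fun x => fourier (-n) x) (fun x => Complex.I * (-n : ℤ) * fourier (-n) x)
    (contDiff_circleFourier _) (hasDerivAt_circleFourier _)
  rw [circleBasis_repr, circleBasis_repr, ← neg_eq_iff_eq_neg.2 h1,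
    ← MeasureTheory.integral_const_mul, ← MeasureTheory.integral_neg]
  refine MeasureTheory.integral_congr_ae (Eventually.of_forall fun x => ?_)
  simp only [Int.cast_neg]
  ring

theorem continuous_of_continuous_coe {k : AddCircle (2 * Real.pi) → ℂ} (hk : Continuous fun t : ℝ => k t) :
    Continuous k :=
  isQuotientMap_quotient_mk'.continuous_iff.2 hk

/-- The integral over a period is the difference of values at two identified points. -/
theorem integral_circle_deriv_eq_zero {k k' : AddCircle (2 * Real.pi) → ℂ}
    (hk : ∀ t : ℝ, HasDerivAt (fun s : ℝ => k s) (k' t) t)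
    (hk' : Continuous fun t : ℝ => k' t) : ∫ x, k' x ∂AddCircle.haarAddCircle = 0 := by
  have h := fourierCoeff_eq_intervalIntegral k' 0 0
  simp only [fourierCoeff, neg_zero, fourier_zero, one_smul] at h
  rw [h, intervalIntegral.integral_eq_sub_of_hasDerivAt (fun t _ => hk t)
    (hk'.intervalIntegrable _ _)]
  simp [AddCircle.coe_period]

theorem integrable_circle {k : AddCircle (2 * Real.pi) → ℂ} (hk : Continuous k) :
    MeasureTheory.Integrable k AddCircle.haarAddCircle :=
  hk.integrable_of_hasCompactSupport (HasCompactSupport.of_compactSpace k)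

theorem integral_circleFourier_deriv {g g' : AddCircle (2 * Real.pi) → ℂ}
    (hg : ∀ t : ℝ, HasDerivAt (fun s : ℝ => g s) (g' t) t) (hc : Continuous g) (hc' : Continuous g')
    (n : ℤ) : ∫ x, fourier n x * g' x ∂AddCircle.haarAddCircle
      = -(Complex.I * n * ∫ x, fourier n x * g x ∂AddCircle.haarAddCircle) := by
  have hf : Continuous fun x : AddCircle (2 * Real.pi) => fourier n x := (fourier n).continuous
  have h := integral_circle_deriv_eq_zero (k := fun x => fourier n x * g x)
    (k' := fun x => Complex.I * n * fourier n x * g x + fourier n x * g' x)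
    (fun t => (hasDerivAt_circleFourier n t).mul (hg t))
    ((((continuous_const.mul hf).mul hc).add (hf.mul hc')).comp (AddCircle.continuous_mk' _))
  have h1 : Continuous fun x => Complex.I * n * fourier n x * g x :=
    (continuous_const.mul hf).mul hc
  have h2 : Continuous fun x => fourier n x * g' x := hf.mul hc'
  rw [MeasureTheory.integral_add (integrable_circle h1) (integrable_circle h2)] at h
  simp only [mul_assoc, MeasureTheory.integral_const_mul] at h ⊢
  linear_combination h

/-- Integration against `k` is the inner product with `conj k`, a bounded functional, so it may be
applied termwise to the Fourier series. -/
theorem hasSum_integral_mul {k : AddCircle (2 * Real.pi) → ℂ} (hk : Continuous k) (u : L2Circle) :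
    HasSum (fun n => circleBasis.repr u n * ∫ x, fourier n x * k x ∂AddCircle.haarAddCircle)
      (∫ x, u x * k x ∂AddCircle.haarAddCircle) := by
  let K : L2Circle := ContinuousMap.toLp 2 AddCircle.haarAddCircle ℂ
    ⟨fun x => (starRingEnd ℂ) (k x), Complex.continuous_conj.comp hk⟩
  have hK : ∀ w : L2Circle, innerSL ℂ K w = ∫ x, w x * k x ∂AddCircle.haarAddCircle := by
    intro w
    rw [innerSL_apply_apply, MeasureTheory.L2.inner_def]
    refine MeasureTheory.integral_congr_ae ?_
    filter_upwards [ContinuousMap.coeFn_toLp (p := 2) (𝕜 := ℂ) AddCircle.haarAddCircle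
      (⟨fun x => (starRingEnd ℂ) (k x), Complex.continuous_conj.comp hk⟩ : C(AddCircle (2 * Real.pi), ℂ))] with x hx
    rw [RCLike.inner_apply, hx]
    simp
  have h := (circleBasis.hasSum_repr u).mapL (innerSL ℂ K)
  rw [hK] at h
  refine (congrArg (HasSum · _) (funext fun n => ?_)).mp h
  rw [map_smul, hK, smul_eq_mul]
  congr 1
  refine MeasureTheory.integral_congr_ae ?_
  have e : circleBasis n = fourierLp 2 n := congrFun coe_fourierBasis n
  rw [e]
  filter_upwards [coeFn_fourierLp (T := 2 * Real.pi) 2 n] with x hx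
  rw [hx]

/-- Both integrals are expanded in Fourier series, and integration by parts matches them mode by
mode. -/
theorem hasWeakDeriv_of_repr {u v : L2Circle}
    (h : ∀ n, circleBasis.repr v n = Complex.I * n * circleBasis.repr u n) : HasWeakDeriv u v := by
  intro g g' hg hd
  have hc : Continuous g := continuous_of_continuous_coe hg.continuous
  have hc' : Continuous g' := by
    refine continuous_of_continuous_coe ?_
    have e : (fun t : ℝ => g' t) = deriv fun t : ℝ => g t := funext fun t => (hd t).deriv.symm
    rw [e]
    exact hg.continuous_deriv (by simp)
  refine (hasSum_integral_mul hc' u).unique ?_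
  refine (congrArg (HasSum · _) (funext fun n => ?_)).mp (hasSum_integral_mul hc v).neg
  rw [integral_circleFourier_deriv hd hc hc', h]
  ring

/-- Since `|n| ≤ 1 + n²`, the coefficients `i n u_n` are square summable and define the derivative.
-/
theorem exists_hasWeakDeriv {u : L2Circle}
    (hu : (fun n => circleBasis.repr u n) ∈ sobolevWeight.seqSubmodule ((1 : ℕ) : ℤ)) :
    ∃ v, HasWeakDeriv u v := by
  have h1 : (fun n : ℤ => Complex.I * n * circleBasis.repr u n) ∈
      sobolevWeight.seqSubmodule ((0 : ℕ) : ℤ) := by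
    refine mem_seqSubmodule_of_le (C := 1) (fun n => ?_) hu
    change _ ≤ 1 * ((1 + (n : ℝ) ^ 2) ^ ((1 : ℕ) : ℤ) * _)
    rw [norm_mul, norm_mul, Complex.norm_I, one_mul, Complex.norm_intCast, Nat.cast_zero, zpow_zero,
      one_mul, one_mul, Nat.cast_one, zpow_one]
    refine mul_le_mul_of_nonneg_right ?_ (norm_nonneg _)
    nlinarith [sq_abs (n : ℝ), sq_nonneg (|(n : ℝ)| - 1)]
  refine ⟨(coeff circleBasis sobolevWeight).symm ⟨_, h1⟩, hasWeakDeriv_of_repr fun n => ?_⟩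
  rw [← coeff_entry circleBasis sobolevWeight, LinearIsometryEquiv.apply_symm_apply]

theorem norm_sq_eq_tsum (u : L2Circle) :
    HasSum (fun n => ‖circleBasis.repr u n‖ ^ 2) (‖u‖ ^ 2) := by
  have h := lp.hasSum_norm (p := 2) (by simp) (circleBasis.repr u)
  rw [LinearIsometryEquiv.norm_map] at h
  simpa using h

theorem HasWeakDeriv.norm_sq {u v : L2Circle} (h : HasWeakDeriv u v) :
    HasSum (fun n : ℤ => (n : ℝ) ^ 2 * ‖circleBasis.repr u n‖ ^ 2) (‖v‖ ^ 2) := by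
  convert norm_sq_eq_tsum v using 2 with n
  rw [h.repr, norm_mul, norm_mul, Complex.norm_I, one_mul, Complex.norm_intCast, mul_pow, sq_abs]

/-- The quotient is invariant under scaling, and the norm of a weak derivative is determined by the
coefficients of `u`, so neither the chosen representative nor the chosen derivative matters. -/
theorem projectiveHamiltonian_mk {u v : L2Circle} (hu : u ≠ 0)
    (hp : Projectivization.mk ℂ u hu ∈ levelPoints circleStructure 1) (h : HasWeakDeriv u v) :
    projectiveHamiltonian ⟨_, hp⟩ = 1 / 2 * (‖v‖ ^ 2 / ‖u‖ ^ 2) := by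
  obtain ⟨c, hc⟩ := Projectivization.exists_smul_eq_mk_rep ℂ u hu
  have hc0 : ‖(c : ℂ)‖ ≠ 0 := norm_ne_zero_iff.2 c.ne_zero
  change (c : ℂ) • u = _ at hc
  have h2 : HasWeakDeriv ((c : ℂ) • u) ((c : ℂ) • v) := hasWeakDeriv_of_repr fun n => by
    rw [map_smul, map_smul, lp.coeFn_smul, lp.coeFn_smul, Pi.smul_apply, Pi.smul_apply, h.repr,
      smul_eq_mul, smul_eq_mul]
    ring
  rw [hc] at h2
  have h3 : HasWeakDeriv (Projectivization.mk ℂ u hu).rep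
      (weakDeriv (Projectivization.mk ℂ u hu).rep) := by
    have h4 : ∃ w, HasWeakDeriv (Projectivization.mk ℂ u hu).rep w := ⟨_, h2⟩
    rw [weakDeriv, dif_pos h4]
    exact Classical.choose_spec h4
  have h5 := h3.norm_sq.unique h2.norm_sq
  rw [projectiveHamiltonian, h5, ← hc, norm_smul, norm_smul, mul_pow, mul_pow,
    mul_div_mul_left _ _ (pow_ne_zero 2 hc0)]

theorem exists_projectiveHamiltonian_eq (u : L2Circle) (hu : u ≠ 0)
    (hp : Projectivization.mk ℂ u hu ∈ levelPoints circleStructure 1) :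
    ∃ v, HasWeakDeriv u v ∧
      projectiveHamiltonian ⟨_, hp⟩ = 1 / 2 * (‖v‖ ^ 2 / ‖u‖ ^ 2) := by
  obtain ⟨v, hv⟩ := exists_hasWeakDeriv ((mk_mem_levelPoints_iff 1 u hu).1 hp)
  exact ⟨v, hv, projectiveHamiltonian_mk hu hp hv⟩

end

noncomputable section

open ScaleSystem ScaleWeight

/-! ## The Hamiltonian in the charts -/

/-- The local representative `x ↦ (a² - ⟨σ_a x, x⟩) / 2` of the Hamiltonian. -/
def localHamiltonian (a : ℤ) : LevelMap (sobolevWeight.scale.nonneg.shift 1) realLine :=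
  fun m (x : sobolevWeight.Seq ((m + 1 : ℕ) : ℤ)) =>
    1 / 2 * ((a : ℝ) ^ 2 - (sobolevWeight.pairing (sigmaOp a m x) x).re)

/-- The derivative of the local representative: `w ↦ -ω(·, i σ_a w)`. -/
def localDifferential (a : ℤ) (m : ℕ) :
    sobolevWeight.scale.nonneg.level (m + 1) →L[ℝ] sobolevWeight.scale.dual.nonneg.level m :=
  -((sobolevWeight.stdFormDual (m : ℤ)).comp ((sigmaGroup a).A m))

theorem pairing_sigmaGroup_A (a : ℤ) {m : ℕ} {t : ℤ} (x : sobolevWeight.scale.nonneg.level (m + 1))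
    (ξ : sobolevWeight.Seq t) : sobolevWeight.pairing ξ ((sigmaGroup a).A m x)
      = -Complex.I * sobolevWeight.pairing ξ (sigmaOp a m x) := by
  rw [pairing, pairing, ← tsum_mul_left]
  refine tsum_congr fun n => ?_
  rw [sigmaGroup_A_entry, map_mul, Complex.conj_I]
  ring

theorem localDifferential_apply (a : ℤ) (m : ℕ) (x : sobolevWeight.scale.nonneg.level (m + 1))
    (ξ : sobolevWeight.Seq (-(m : ℤ))) :
    localDifferential a m x ξ = -(sobolevWeight.pairing (sigmaOp a m x) ξ).re := by
  change -(-(sobolevWeight.pairing ξ ((sigmaGroup a).A m x)).im) = _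
  rw [pairing_sigmaGroup_A, ← pairing_conj ξ]
  simp

/-- The multipliers are real, so the real bilinear form is symmetric. -/
theorem localDifferential_symm (a : ℤ) {m : ℕ} (h : -(m : ℤ) ≤ ((m + 1 : ℕ) : ℤ))
    (x y : sobolevWeight.scale.nonneg.level (m + 1)) :
    localDifferential a m x (sobolevWeight.scale.bond h y)
      = localDifferential a m y (sobolevWeight.scale.bond h x) := by
  rw [localDifferential_apply, localDifferential_apply,
    ← pairing_conj (sobolevWeight.scale.bond h x), Complex.conj_re]
  congr 2
  refine tsum_congr fun n => ?_
  rw [scale_bond_entry, scale_bond_entry, sigmaOp_entry, sigmaOp_entry, map_mul,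
    Complex.conj_ofReal]
  ring

/-- Through the dual pairing the local Hamiltonian is a constant plus a bounded quadratic form,
which yields continuity and the derivative at once. -/
theorem localHamiltonian_eq (a : ℤ) {m : ℕ} (h : -(m : ℤ) ≤ ((m + 1 : ℕ) : ℤ))
    (x : sobolevWeight.scale.nonneg.level (m + 1)) : localHamiltonian a m x
      = 1 / 2 * ((a : ℝ) ^ 2 + localDifferential a m x (sobolevWeight.scale.bond h x)) := by
  rw [localDifferential_apply, ← sub_eq_add_neg, localHamiltonian]
  simp only [pairing, incl_entry]

theorem localDifferential_bond (a : ℤ) (r s : ℕ) (h : r ≤ s)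
    (x : sobolevWeight.scale.nonneg.level (s + 1)) :
    localDifferential a r ((sobolevWeight.scale.nonneg.shift 1).bond h x)
      = sobolevWeight.scale.dual.nonneg.bond h (localDifferential a s x) := by
  ext ξ
  have e : sobolevWeight.scale.dual.nonneg.bond h (localDifferential a s x) ξ
      = localDifferential a s x (sobolevWeight.scale.bond (neg_le_neg (Int.ofNat_le.mpr h)) ξ) := rfl
  rw [e, localDifferential_apply, localDifferential_apply]
  simp only [pairing, incl_entry, sigmaOp_entry]

/-- The derivative of a symmetric quadratic form is twice its linear map, cancelling the factor `1 /
2`. That map is bounded linear between the levels of `X^1` and `X^*`, so it is sc-smooth. -/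
theorem isStronglyScSmooth_localHamiltonian (a : ℤ)
    (U : Set (sobolevWeight.scale.nonneg.level 0)) :
    IsStronglyScSmooth sobolevWeight.scale U (localHamiltonian a) fun m x =>
      localDifferential a m x := by
  have hD := isLevelSmooth_of_clm (X := sobolevWeight.scale.nonneg.shift 1)
    (Y := sobolevWeight.scale.dual.nonneg) univ (localDifferential a) (localDifferential_bond a)
  refine ⟨⟨⟨fun r s h x _ => ?_, fun m => Continuous.continuousOn ?_⟩,
    hD.isSc0.mono (subset_univ _), fun x _ => ?_⟩, (hD.isScSmooth isOpen_univ).mono (subset_univ _)⟩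
  · change 1 / 2 * ((a : ℝ) ^ 2 - (sobolevWeight.pairing _ _).re)
      = 1 / 2 * ((a : ℝ) ^ 2 - (sobolevWeight.pairing _ _).re)
    simp only [pairing, sigmaOp_entry, incl_entry]
  · have h : -(m : ℤ) ≤ ((m + 1 : ℕ) : ℤ) := by omega
    have e : localHamiltonian a m = _ := funext (localHamiltonian_eq a h)
    rw [e]
    exact continuous_const.mul (continuous_const.add
      ((localDifferential a m).continuous.clm_apply (sobolevWeight.scale.bond h).continuous))
  · have h : -((0 : ℕ) : ℤ) ≤ ((0 + 1 : ℕ) : ℤ) := by simp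
    have h1 := ((((localDifferential a 0).hasFDerivAt (x := x)).clm_apply
      ((sobolevWeight.scale.bond h).hasFDerivAt (x := x))).const_add
        ((a : ℝ) ^ 2)).const_mul (1 / 2 : ℝ)
    refine (hasFDerivAt_iff_isLittleO_nhds_zero.1 h1).congr_left fun t => ?_
    rw [localHamiltonian_eq a h, localHamiltonian_eq a h]
    congr 1
    change (1 / 2 : ℝ) * (localDifferential a 0 x (sobolevWeight.scale.bond h t)
      + localDifferential a 0 t (sobolevWeight.scale.bond h x)) = _
    rw [localDifferential_symm a h t x]
    ring

/-- The coefficient `a² - n²` vanishes at `n = a`, so the sum over the remaining indices is already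
the sum over all of `ℤ`. -/
theorem hasSum_sigma {u v : L2Circle} (h : HasWeakDeriv u v) (a : ℤ) :
    HasSum (fun n => sigmaCoeff a n * ‖circleBasis.repr u (skip a n)‖ ^ 2)
      ((a : ℝ) ^ 2 * ‖u‖ ^ 2 - ‖v‖ ^ 2) := by
  simp only [sigmaCoeff_eq]
  refine ((skip_injective a).hasSum_iff
    (f := fun n : ℤ => ((a : ℝ) ^ 2 - (n : ℝ) ^ 2) * ‖circleBasis.repr u n‖ ^ 2) fun n hn => ?_).2 ?_
  · rw [range_skip, mem_compl_iff, not_not, mem_singleton_iff] at hn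
    rw [hn, sub_self, zero_mul]
  · simpa only [sub_mul] using ((norm_sq_eq_tsum u).mul_left _).sub h.norm_sq

/-- The chart coordinates have moduli `|u_k| / ‖u‖` with `k ≠ a`, so `⟨σ_a y, y⟩ = a² - ‖v‖² / ‖u‖²`
by `hasSum_sigma`. -/
theorem representsFunction_localHamiltonian (a : ℤ) :
    RepresentsFunction sobolevWeight.scale circleStructure
      (darbouxChart circleBasis sobolevWeight a) projectiveHamiltonian (localHamiltonian a) := by
  rintro ⟨p, hp⟩ (hs : p ∈ (darbouxChart circleBasis sobolevWeight a).source)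
  induction p using Projectivization.ind with | _ u hu => ?_
  obtain ⟨v, hv, e⟩ := exists_projectiveHamiltonian_eq u hu hp
  rw [e]
  have hua := (mk_mem_darbouxChart_source _ _ a u hu).1 hs
  have hpos : 0 < ‖u‖ := norm_pos_iff.2 hu
  have hy := congrArg Seq.entry (bond_circleOne ⟨_, hp⟩ hs)
  rw [nonneg_bond_entry, darbouxChart_toFun_mk] at hy
  have h1 : ∀ n, ((circleOne a).toFun ⟨_, hp⟩).entry n
      * (starRingEnd ℂ) (((circleOne a).toFun ⟨_, hp⟩).entry n)
      = ((‖u‖⁻¹ ^ 2 * ‖circleBasis.repr u (skip a n)‖ ^ 2 : ℝ) : ℂ) := by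
    intro n
    rw [Complex.mul_conj, Complex.normSq_eq_norm_sq, hy, darbouxMap, Seq.entry_smul, Pi.smul_apply,
      norm_smul, LinearIsometryEquiv.norm_map, coeff_entry, norm_phase hua hpos, drop_entry,
      coeff_entry, mul_pow]
  have h2 : sobolevWeight.pairing (sigmaOp a 0 ((circleOne a).toFun ⟨_, hp⟩))
      ((circleOne a).toFun ⟨_, hp⟩)
      = ((‖u‖⁻¹ ^ 2 * ((a : ℝ) ^ 2 * ‖u‖ ^ 2 - ‖v‖ ^ 2) : ℝ) : ℂ) := by
    refine HasSum.tsum_eq ?_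
    refine (congrArg (HasSum · _) (funext fun n => ?_)).mp
      (Complex.hasSum_ofReal.2 ((hasSum_sigma hv a).mul_left (‖u‖⁻¹ ^ 2)))
    rw [sigmaOp_entry, mul_assoc, h1, ← Complex.ofReal_mul]
    congr 1
    ring
  change 1 / 2 * ((a : ℝ) ^ 2 - (sobolevWeight.pairing (sigmaOp a 0 ((circleOne a).toFun ⟨_, hp⟩))
      ((circleOne a).toFun ⟨_, hp⟩)).re) = _
  rw [h2, Complex.ofReal_re]
  field_simp
  ring

theorem isStronglyScSmoothFunction_projectiveHamiltonian :
    IsStronglyScSmoothFunction sobolevWeight.scale circleStructure projectiveHamiltonian := by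
  intro p
  obtain ⟨a, ha⟩ := exists_circleChart p.1
  exact ⟨_, circleChart_mem a, ha, _, _, representsFunction_localHamiltonian a,
    isStronglyScSmooth_localHamiltonian a _⟩

/-- The differential of the Hamiltonian. -/
def circleDifferential (p : levelPoints circleStructure 1) : ScCotangent circleStructure p :=
  cotangentOfChart (isBanachScale_scale _) (centerNondegenerate _) isSymplecticAtlas_circle rfl p
    ⟨chartIndex p.1, rfl⟩ (mem_chartIndex p.1)
    ((localDifferential (chartIndex p.1) 0 ((circleOne (chartIndex p.1)).toFun p)).comp
      (sobolevWeight.scale.bond (by simp)))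

theorem isDifferential_circleDifferential :
    IsDifferential sobolevWeight.scale circleStructure projectiveHamiltonian circleDifferential := by
  intro p
  refine ⟨_, circleChart_mem (chartIndex p.1), mem_chartIndex p.1, _, _,
    representsFunction_localHamiltonian _, isStronglyScSmooth_localHamiltonian _ _, fun v => ?_⟩
  exact congrArg (fun w => localDifferential (chartIndex p.1) 0
    ((circleOne (chartIndex p.1)).toFun p) (sobolevWeight.scale.bond (by simp) w))
    (ScTangent.coord_mk (isBanachScale_scale _) (centerNondegenerate _) isSymplecticAtlas_circle
      rfl p (circleChart_mem (chartIndex p.1)) (mem_chartIndex p.1) v)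

/-- `localDifferential` is built as `-ω(·, A x)`, and `A x` represents the field in the same chart,
so the equation becomes an identity once `tangentForm` is read there. -/
theorem generates_projectiveHamiltonian :
    Generates sobolevWeight.scale sobolevWeight.stdForm circleStructure projectiveHamiltonian
      circleField := by
  refine ⟨isStronglyScSmoothFunction_projectiveHamiltonian, _, isDifferential_circleDifferential,
    fun p ξ => ?_⟩
  refine Eq.trans ?_ (tangentForm_eq (A := circleStructure) (isBanachScale_scale _)
    (centerNondegenerate _) isSymplecticAtlas_circle rfl p ⟨chartIndex p.1, rfl⟩ (mem_chartIndex p.1) ξ _).symm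
  rw [circleField_coord p (mem_chartIndex p.1)]
  have h : -((0 : ℕ) : ℤ) ≤ ((0 : ℕ) : ℤ) := by simp
  change - -(-(sobolevWeight.pairing (sobolevWeight.scale.bond h _) _).im)
    = -(sobolevWeight.pairing _ _).im
  simp only [pairing, incl_entry]
  exact neg_neg _

end

theorem mainTheorem6 :
    -- the projective space of any separable Hilbert space, modeled on its induced scale
    (∀ (E : Type*) [NormedAddCommGroup E] [InnerProductSpace ℂ E] (b : HilbertBasis ℤ ℂ E)
        (W : ScaleWeight),
      W.scale.IsBanachScale ∧ W.scale.IsSymplectic W.stdForm ∧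
      IsSymplecticAtlas W.scale W.stdForm (darbouxAtlas b W) ∧
      ∀ a : ℤ, (darbouxChart b W a).target = Metric.ball 0 1 ∧
        ∀ (u : E) (hu : u ≠ 0),
          (Projectivization.mk ℂ u hu ∈ (darbouxChart b W a).source ↔ b.repr u a ≠ 0) ∧
          (b.repr u a ≠ 0 →
            ((darbouxChart b W a).toFun (Projectivization.mk ℂ u hu)).entry
              = darbouxEntry b a u)) ∧
    -- the filtration of `P(L²)` by the projective spaces of `W^{2m,2}`
    (∀ (m : ℕ) (u : L2Circle) (hu : u ≠ 0),
      Projectivization.mk ℂ u hu ∈ levelPoints circleStructure m ↔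
        (fun n => circleBasis.repr u n) ∈ sobolevWeight.seqSubmodule m) ∧
    -- the Schrödinger flow descends to an sc-smooth flow
    (∀ (t : ℝ) (u : L2Circle) (hu : u ≠ 0), ∃ hu' : schrodinger t u ≠ 0,
      projectiveFlow (t, Projectivization.mk ℂ u hu)
        = Projectivization.mk ℂ (schrodinger t u) hu') ∧
    IsScSmoothMap (prodCharts realCharts circleStructure) circleStructure projectiveFlow ∧
    -- the multipliers `σ_a`
    (∀ a : ℤ, ScaleSystem.IsScOperator (sigmaOp a) ∧ ∀ (m : ℕ) x (n : ℤ),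
      (sigmaOp a m x).entry n = (sigmaCoeff a n : ℂ) * x.entry n) ∧
    -- the Hamiltonian and its local derivatives
    (∀ (u : L2Circle) (hu : u ≠ 0) (hp : Projectivization.mk ℂ u hu ∈ levelPoints circleStructure 1),
      ∃ v, HasWeakDeriv u v ∧
        projectiveHamiltonian ⟨_, hp⟩ = 1 / 2 * (‖v‖ ^ 2 / ‖u‖ ^ 2)) ∧
    IsStronglyScSmoothFunction sobolevWeight.scale circleStructure projectiveHamiltonian ∧
    (∀ a : ℤ, ∃ H DH,
      RepresentsFunction sobolevWeight.scale circleStructure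
        (darbouxChart circleBasis sobolevWeight a) projectiveHamiltonian H ∧
      ScaleSystem.IsStronglyScSmooth sobolevWeight.scale (darbouxChart circleBasis sobolevWeight a).target
        H DH ∧
      ∀ (m : ℕ), ∀ x ∈ ScaleSystem.levelSet (darbouxChart circleBasis sobolevWeight a).target (m + 1),
        ∀ ξ, DH m x ξ = -(sobolevWeight.pairing (sigmaOp a m x) ξ).re) ∧
    -- the vector field of the descended flow, which is generated by the Hamiltonian
    (∃ V, IsScSmoothVectorField circleStructure V ∧ IsGlobalFlow circleStructure V projectiveFlow ∧
      (∀ (a : ℤ) (p : levelPoints circleStructure 1),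
        p.1 ∈ (darbouxChart circleBasis sobolevWeight a).source → ∀ n : ℤ,
        ((V p).coord circleStructure (darbouxChart circleBasis sobolevWeight a)).entry n =
          Complex.I * (sigmaOp a 0 (((darbouxChart circleBasis sobolevWeight a).one
            circleStructure).toFun p)).entry n) ∧
      Generates sobolevWeight.scale sobolevWeight.stdForm circleStructure
        projectiveHamiltonian V) ∧
    IsHamiltonianFlow sobolevWeight.scale sobolevWeight.stdForm circleStructure
      projectiveFlow := by 
  refine ⟨fun E _ _ b W => ⟨W.isBanachScale_scale, W.isSymplectic_scale,
      isSymplecticAtlas_darbouxAtlas b W, fun a => ⟨darbouxChart_target b W a, fun u hu =>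
        ⟨mk_mem_darbouxChart_source b W a u hu, fun _ => ?_⟩⟩⟩,
    mk_mem_levelPoints_iff, projectiveFlow_mk, isScSmoothMap_projectiveFlow,
    fun a => ⟨isScOperator_sigmaOp a, fun m x n => sigmaOp_entry a x n⟩,
    exists_projectiveHamiltonian_eq, isStronglyScSmoothFunction_projectiveHamiltonian,
    fun a => ⟨_, _, representsFunction_localHamiltonian a, isStronglyScSmooth_localHamiltonian a _,
      fun m x _ ξ => localDifferential_apply a m x ξ⟩,
    ⟨circleField, isScSmoothVectorField_circleField, isGlobalFlow_projectiveFlow,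
      fun a p hp n => ?_, generates_projectiveHamiltonian⟩,
    ⟨circleField, isScSmoothVectorField_circleField, isGlobalFlow_projectiveFlow, _,
      generates_projectiveHamiltonian⟩⟩
  · rw [darbouxChart_toFun_mk, darbouxEntry_eq b W]
  · rw [circleField_coord p hp, sigmaGroup_A_entry]
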